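/- Let $N\in\mathbb N$, $T>0$, $I=[-T,T]$ with $|I|=2T\ge 1$. Let $G:\mathbb R^N\to[0,\infty)$ be a continuously differentiable G-function: $G$ is convex, even, $G(0)=0$, $G(x)/|x|\to\infty$ as $|x|\to\infty$; suppose that $G$ satisfies the $\Delta_2$ and $\nabla_2$ conditions at infinity, i.e. there are $k_1>0$, $k_2>1$, $R>0$ with $G(2x)\le k_1G(x)$ and $G(x)\le \frac1{2k_2}G(k_2x)$ for $|x|\ge R$. Put $G^*(y)=\sup_{x}(\langle x,y\rangle-G(x))$. Let $F\in C^1(I\times\mathbb R^N\times\mathbb R^N,\mathbb R)$ satisfy, for all $(t,x,v)\in I\times\mathbb R^N\times\mathbb R^N$: (F1) $F(t,x,\cdot)$ is convex; (F2) there are $a\in C([0,\infty),[0,\infty))$ and $\beta\in L^1(I,[0,\infty))$, independent of $(t,x,v)$, such that $|F(t,x,v)|\le a(|x|)(\beta(t)+G(v))$, $|F_x(t,x,v)|\le a(|x|)(\beta(t)+G(v))$ and $G^*(F_v(t,x,v))\le a(|x|)(\beta(t)+G^*(\nabla G(v)))$; (F3) $\langle F_x(t,x,v),x\rangle+\langle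 F_v(t,x,v),v\rangle\le\theta_F F(t,x,v)$ with a constant $\theta_F>0$; (F4) $F(t,x,v)\ge\Lambda G(v)$ with a constant $\Lambda>0$; (F5) $F(t,x,0)=0$ and $F_v(t,x,0)=0$. Let $V\in C^1(I\times\mathbb R^N,\mathbb R)$ satisfy: (V1) $V=K-W$ on $I\times\mathbb R^N$ for some functions $K,W:I\times\mathbb R^N\to\mathbb R$; (V2) there are $M>0$, $\varepsilon_V>0$, $\theta_V>\theta_F$ and $1<p_K\le\theta_V-\varepsilon_V$ such that $\langle V_x(t,x),x\rangle\le(\theta_V-\varepsilon_V)K(t,x)-\theta_VW(t,x)$ and $W(t,x)>K(t,x)>|x|^{p_K}$ for $|x|>M$, $t\in I$; (V3) there are $\rho>0$, $b>1$ and $g\in L^1(I,\mathbb R)$ such that $V(t,x)\ge bG(x)-g(t)$ for all $t\in I$ and all $x$ with $G\left(\frac{x}{2|I|}\right)\le\rho/2$; (V4) $\int_IV(t,0)\,dt=0$. Let $f:I\to\mathbb R^N$ be measurable with $\int_IG^*(f)\,dt<\infty$, not almost everywhere $0$, and such that (f) $\int_I G^*(f(t))+g(t)\,dt<\min\{\Lambda,b-1\}\,\rho$.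 Let $L^G$ be the Orlicz space of measurable $u:I\to\mathbb R^N$ with $\int_IG(u)\,dt<\infty$, with the Luxemburg norm $\|u\|_{L^G}=\inf\{\lambda>0:\int_IG(u/\lambda)\,dt\le1\}$, and let $W^1_TL^G$ be the space of absolutely continuous $u:I\to\mathbb R^N$ with $u,\dot u\in L^G$ and $u(-T)=u(T)$, with the norm $\|u\|_{L^G}+\|\dot u\|_{L^G}$. Put $\mathcal L(t,x,v)=F(t,x,v)+V(t,x)+\langle f(t),x\rangle$, and on $W^1_TL^G$ put $\mathcal J(u)=\int_I\mathcal L(t,u,\dot u)\,dt$, $\Phi(u)=\int_IG(\dot u)+G(u)\,dt$ and $\Omega=\{u:\Phi(u)<\rho\}$. A solution of $$\frac{d}{dt}\mathcal L_v(t,u(t),\dot u(t))=\mathcal L_x(t,u(t),\dot u(t))\ \text{ for a.e. } t\in I,\qquad u(-T)=u(T)\tag{AELT}$$ is a $u\in W^1_TL^G$ such that $t\mapsto\mathcal L_v(t,u(t),\dot u(t))$ agrees a.e. on $I$ with an absolutely continuous function whose derivative is $\mathcal L_x(t,u(t),\dot u(t))$ for a.e. $t\in I$. Then (AELT) has at least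 two solutions. More precisely, there are solutions $u_1\ne u_2$ of (AELT), both critical points of $\mathcal J$ on $W^1_TL^G$, such that: (i) $u_1\ne0$, $\mathcal J(u_1)>0$, and $u_1$ is of mountain pass type: there is $e\in W^1_TL^G$ with $\Phi(e)>\rho$, $\mathcal J(e)<0$ and $\mathcal J(u_1)=\inf_{\gamma}\max_{s\in[0,1]}\mathcal J(\gamma(s))$, the infimum being over all continuous $\gamma:[0,1]\to W^1_TL^G$ with $\gamma(0)=0$, $\gamma(1)=e$; (ii) $u_2\in\Omega$ and $\mathcal J(u_2)=\min_{\overline\Omega}\mathcal J\le0$; moreover, if $V_x(t,0)=0$ for a.e. $t\in I$, then $u_2\ne0$. -/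

import Mathlib

open Set Filter Topology MeasureTheory

noncomputable section

namespace AnisotropicEL

/-- `ℝ^N` with the Euclidean norm and inner product. -/
abbrev E (N : ℕ) : Type := EuclideanSpace ℝ (Fin N)

/-- The interval `I = [-T, T]`, of length `|I| = 2 * T`. -/
abbrev I (T : ℝ) : Set ℝ := Icc (-T) T

/-- The Fenchel conjugate `G*(y) = sup_x (⟨x, y⟩ - G x)`. For a superlinear continuous `G` the
supremum is finite. -/
def conj {N : ℕ} (G : E N → ℝ) (y : E N) : ℝ := ⨆ x : E N, (inner ℝ x y - G x)

/-- `G` is a continuously differentiable G-function satisfying the `Δ₂` and `∇₂` conditions at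
infinity. -/
structure IsGFunction {N : ℕ} (G : E N → ℝ) : Prop where
  nonneg : ∀ x, 0 ≤ G x
  contDiff : ContDiff ℝ 1 G
  convex : ConvexOn ℝ univ G
  even : ∀ x, G (-x) = G x
  zero : G 0 = 0
  superlinear : Tendsto (fun x => G x / ‖x‖) (Bornology.cobounded (E N)) atTop
  delta_two : ∃ k > 0, ∃ R > 0, ∀ x, R ≤ ‖x‖ → G ((2 : ℝ) • x) ≤ k * G x
  nabla_two : ∃ k > 1, ∃ R > 0, ∀ x, R ≤ ‖x‖ → G x ≤ 1 / (2 * k) * G (k • x)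

/-- Assumptions (F1)-(F5) on the `C¹` function `F : I × ℝ^N × ℝ^N → ℝ`, with the constants `Λ` of
(F4) and `θF` of (F3). Partial derivatives `F_x`, `F_v` are gradients in the respective variable. -/
structure AssumptionF {N : ℕ} (T : ℝ) (G : E N → ℝ) (F : ℝ → E N → E N → ℝ)
    (Λ θF : ℝ) : Prop where
  contDiffOn : ContDiffOn ℝ 1 (fun p : ℝ × E N × E N => F p.1 p.2.1 p.2.2) (I T ×ˢ univ)
  convex : ∀ t ∈ I T, ∀ x, ConvexOn ℝ univ (F t x)
  growth : ∃ a b : ℝ → ℝ, ContinuousOn a (Ici 0) ∧ (∀ r, 0 ≤ r → 0 ≤ a r) ∧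
    IntegrableOn b (I T) ∧ (∀ t ∈ I T, 0 ≤ b t) ∧
    ∀ t ∈ I T, ∀ x v,
      |F t x v| ≤ a ‖x‖ * (b t + G v) ∧
      ‖gradient (fun y => F t y v) x‖ ≤ a ‖x‖ * (b t + G v) ∧
      conj G (gradient (F t x) v) ≤ a ‖x‖ * (b t + conj G (gradient G v))
  theta_pos : 0 < θF
  ar : ∀ t ∈ I T, ∀ x v,
    inner ℝ (gradient (fun y => F t y v) x) x + inner ℝ (gradient (F t x) v) v ≤ θF * F t x v
  lambda_pos : 0 < Λ
  ellipticity : ∀ t ∈ I T, ∀ x v, Λ * G v ≤ F t x v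
  zero : ∀ t ∈ I T, ∀ x, F t x 0 = 0 ∧ gradient (F t x) 0 = 0

/-- Assumptions (V1)-(V4) on the `C¹` potential `V : I × ℝ^N → ℝ`, with the constants `ρ`, `b` and
the function `g` of (V3); `θF` is the constant of (F3). -/
structure AssumptionV {N : ℕ} (T : ℝ) (G : E N → ℝ) (V : ℝ → E N → ℝ)
    (θF ρ b : ℝ) (g : ℝ → ℝ) : Prop where
  contDiffOn : ContDiffOn ℝ 1 (fun p : ℝ × E N => V p.1 p.2) (I T ×ˢ univ)
  decomposition : ∃ K W : ℝ → E N → ℝ, (∀ t ∈ I T, ∀ x, V t x = K t x - W t x) ∧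
    ∃ M ε θV pK : ℝ, 0 < M ∧ 0 < ε ∧ θF < θV ∧ 1 < pK ∧ pK ≤ θV - ε ∧
      ∀ t ∈ I T, ∀ x, M < ‖x‖ →
        inner ℝ (gradient (V t) x) x ≤ (θV - ε) * K t x - θV * W t x ∧
        K t x < W t x ∧ ‖x‖ ^ pK < K t x
  rho_pos : 0 < ρ
  one_lt_b : 1 < b
  integrable_g : IntegrableOn g (I T)
  lower_bound : ∀ t ∈ I T, ∀ x, G ((2 * (2 * T))⁻¹ • x) ≤ ρ / 2 → b * G x - g t ≤ V t x
  integral_zero : ∫ t in I T, V t 0 = 0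

/-- Membership in the Orlicz space `L^G(I, ℝ^N)`. -/
def MemLG {N : ℕ} (T : ℝ) (G : E N → ℝ) (u : ℝ → E N) : Prop :=
  AEStronglyMeasurable u (volume.restrict (I T)) ∧ IntegrableOn (fun t => G (u t)) (I T)

/-- The Luxemburg norm of `L^G(I, ℝ^N)`. -/
def luxNorm {N : ℕ} (T : ℝ) (G : E N → ℝ) (u : ℝ → E N) : ℝ :=
  sInf {l : ℝ | 0 < l ∧ ∫⁻ t in I T, ENNReal.ofReal (G (l⁻¹ • u t)) ≤ 1}

/-- The periodic Orlicz-Sobolev space `W¹_T L^G`: absolutely continuous `u` on `I` with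
`u, u' ∈ L^G` and `u(-T) = u(T)`. Only the values on `I` matter. -/
def WT {N : ℕ} (T : ℝ) (G : E N → ℝ) : Set (ℝ → E N) :=
  {u | AbsolutelyContinuousOnInterval u (-T) T ∧ MemLG T G u ∧ MemLG T G (deriv u) ∧
    u (-T) = u T}

/-- The norm of the Orlicz-Sobolev space. -/
def sobNorm {N : ℕ} (T : ℝ) (G : E N → ℝ) (u : ℝ → E N) : ℝ :=
  luxNorm T G u + luxNorm T G (deriv u)

/-- The functional `Φ(u) = ∫_I G(u') + G(u)`. -/
def Phi {N : ℕ} (T : ℝ) (G : E N → ℝ) (u : ℝ → E N) : ℝ :=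
  ∫ t in I T, (G (deriv u t) + G (u t))

/-- The set `Ω = {u : Φ(u) < ρ}`. -/
def Omega {N : ℕ} (T : ℝ) (G : E N → ℝ) (ρ : ℝ) : Set (ℝ → E N) :=
  {u | u ∈ WT T G ∧ Phi T G u < ρ}

/-- Closure in `W¹_T L^G` with respect to the Orlicz-Sobolev norm. -/
def normClosure {N : ℕ} (T : ℝ) (G : E N → ℝ) (S : Set (ℝ → E N)) : Set (ℝ → E N) :=
  {u | u ∈ WT T G ∧ ∀ ε > 0, ∃ v ∈ S, sobNorm T G (u - v) < ε}

/-- The Lagrangian `L(t, x, v) = F(t, x, v) + V(t, x) + ⟨f(t), x⟩`. -/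
def lagrangian {N : ℕ} (F : ℝ → E N → E N → ℝ) (V : ℝ → E N → ℝ) (f : ℝ → E N)
    (t : ℝ) (x v : E N) : ℝ :=
  F t x v + V t x + inner ℝ (f t) x

/-- The action functional `u ↦ ∫_I L(t, u, u') dt`. -/
def action {N : ℕ} (T : ℝ) (L : ℝ → E N → E N → ℝ) (u : ℝ → E N) : ℝ :=
  ∫ t in I T, L t (u t) (deriv u t)

/-- `u ∈ W¹_T L^G` solves `d/dt L_v(t, u, u') = L_x(t, u, u')` for a.e. `t ∈ I`, `u(-T) = u(T)`:
the a.e. defined function `t ↦ L_v(t, u(t), u'(t))` has an absolutely continuous representative `p`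
on `I`, whose derivative is `L_x(t, u(t), u'(t))` for a.e. `t ∈ I`. -/
def IsPeriodicSolution {N : ℕ} (T : ℝ) (G : E N → ℝ) (L : ℝ → E N → E N → ℝ)
    (u : ℝ → E N) : Prop :=
  u ∈ WT T G ∧ ∃ p : ℝ → E N, AbsolutelyContinuousOnInterval p (-T) T ∧
    (∀ᵐ t ∂(volume.restrict (I T)), p t = gradient (L t (u t)) (deriv u t)) ∧
    (∀ᵐ t ∂(volume.restrict (I T)),
      HasDerivAt p (gradient (fun x => L t x (deriv u t)) (u t)) t)

/-- `u` is a critical point of `J` on `W¹_T L^G`: the Fréchet derivative of `J` at `u` is `0`. -/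
def IsCriticalPoint {N : ℕ} (T : ℝ) (G : E N → ℝ) (J : (ℝ → E N) → ℝ) (u : ℝ → E N) : Prop :=
  u ∈ WT T G ∧ ∀ ε > 0, ∃ δ > 0, ∀ φ ∈ WT T G, sobNorm T G φ < δ →
    |J (u + φ) - J u| ≤ ε * sobNorm T G φ

/-- Norm-continuous paths `[0, 1] → W¹_T L^G` from `0` to `e`. -/
def IsPath {N : ℕ} (T : ℝ) (G : E N → ℝ) (e : ℝ → E N) (γ : ℝ → ℝ → E N) : Prop :=
  (∀ s ∈ Icc (0 : ℝ) 1, γ s ∈ WT T G) ∧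
  (∀ s ∈ Icc (0 : ℝ) 1, ∀ ε > 0, ∃ δ > 0, ∀ r ∈ Icc (0 : ℝ) 1, |r - s| < δ →
    sobNorm T G (γ r - γ s) < ε) ∧
  EqOn (γ 0) 0 (I T) ∧ EqOn (γ 1) e (I T)

/-- `c = inf_γ max_{s ∈ [0,1]} J(γ(s))` over all paths `γ` from `0` to `e`. -/
def IsMountainPassLevel {N : ℕ} (T : ℝ) (G : E N → ℝ) (J : (ℝ → E N) → ℝ) (e : ℝ → E N)
    (c : ℝ) : Prop :=
  IsGLB {m : ℝ | ∃ γ, IsPath T G e γ ∧ IsGreatest ((fun s => J (γ s)) '' Icc (0 : ℝ) 1) m} c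

end AnisotropicEL

end

open Set Filter Topology MeasureTheory

noncomputable section

namespace AnisotropicEL

/-! ### Young functions -/

/-! The action J has a well around 0 inside the rim Φ = ρ and takes negative values beyond it. One
solution is the minimum in the well, the other is a mountain pass over the rim.

The analysis takes place in the model space `Sob`: an initial value together with a velocity of mean
zero, the zero mean encoding periodicity. Its norm is equivalent to the Orlicz–Sobolev norm and it
is complete. By Δ₂ and ∇₂ both G and G* satisfy a doubling inequality up to constants (`young`,
`conj_young`), so small Luxemburg norm and small modular are interchangeable. J is then C¹
(`hasFDerivAt_actionS`, `continuous_dAction`), and its critical points solve the equation by the Du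
Bois-Reymond lemma `exists_ac_of_pairing_eq_zero`.

Geometry: Jensen's inequality and |I| ≥ 1 show that Φ(u) ≤ ρ forces G(u(t)/(2|I|)) ≤ ρ/2 for all t.
Hence (V3) applies along u, and with (F4) and Fenchel–Young one gets J(u) ≥ min(Λ, b−1) Φ(u) −
∫(G*(f) + g) (`le_actionS`). By (f) this is positive on the rim, while J(0) = 0. Far out on a ray of
constant curves V is negative and superlinear, so J < 0 there (`exists_neg_endpoint`).

The well: bounded modulars give weakly convergent subsequences (`Sob.exists_weakConv`), and
convexity in the velocity makes J and Φ weakly lower semicontinuous (`actionS_le_of_weakConv`). A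
minimizer on Φ ≤ ρ exists; its value is at most 0, so it lies off the rim and is critical.

The pass: Ekeland's principle on the space of paths gives almost critical points (`mountain_pass`).
They are bounded, because θ_V J(u) − J'(u)u controls the modular of u' and the mean of |u|
(`palaisSmale_bounded`). Passage to the limit (`palaisSmale_limit`) works without strict convexity,
hence without strong convergence of velocities. Testing with z₀ − zₙ gives J(zₙ) → J(z₀), so the
nonnegative convexity defect tends to 0 in L¹. Along a subsequence it is dominated, and with it
G(zₙ'). Lower semicontinuity at z₀ + sφ bounds the difference quotient of J at z₀ by that at zₙ, up
to o(1). The latter is close to J'(zₙ)φ → 0 thanks to the domination, so J'(z₀)φ ≤ 0 for every φ,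
and J'(z₀) = 0. -/

theorem hasFDerivAt_gradient {N : ℕ} {f : E N → ℝ} {v : E N} (hd : DifferentiableAt ℝ f v) :
    HasFDerivAt f (innerSL ℝ (gradient f v)) v :=
  hasGradientAt_iff_hasFDerivAt.1 hd.hasGradientAt

theorem fderiv_apply_eq_inner {N : ℕ} {f : E N → ℝ} {v : E N} (hd : DifferentiableAt ℝ f v)
    (x : E N) : fderiv ℝ f v x = inner ℝ (gradient f v) x := by
  rw [(hasFDerivAt_gradient hd).fderiv]; rfl

/-- The gradient inequality for differentiable convex functions. -/
theorem gradient_inequality {N : ℕ} {f : E N → ℝ} (hf : ConvexOn ℝ univ f) {v : E N}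
    (hd : DifferentiableAt ℝ f v) (x : E N) :
    f v + inner ℝ (gradient f v) (x - v) ≤ f x := by
  have hc : ConvexOn ℝ univ (fun s : ℝ => f (AffineMap.lineMap v x s)) := by
    have := hf.comp_affineMap (AffineMap.lineMap v x : ℝ →ᵃ[ℝ] E N)
    rwa [preimage_univ] at this
  have hd' : HasDerivAt (fun s : ℝ => f (AffineMap.lineMap v x s))
      (inner ℝ (gradient f v) (x - v)) 0 := by
    have h1 : HasFDerivAt f (innerSL ℝ (gradient f v)) (AffineMap.lineMap v x (0 : ℝ)) := by
      simpa using hasFDerivAt_gradient hd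
    exact h1.comp_hasDerivAt 0 (AffineMap.hasDerivAt_lineMap (a := v) (b := x) (x := (0 : ℝ)))
  have := hc.le_slope_of_hasDerivAt (mem_univ 0) (mem_univ 1) zero_lt_one hd'
  rw [slope_def_field, sub_zero, div_one, AffineMap.lineMap_apply_one,
    AffineMap.lineMap_apply_zero] at this
  linarith

/-- Finite, even, convex functions with superlinear growth and a doubling property up to additive
constants. -/
structure YoungFn {N : ℕ} (Φ : E N → ℝ) : Prop where
  nonneg : ∀ x, 0 ≤ Φ x
  cont : Continuous Φ
  convex : ConvexOn ℝ univ Φ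
  even : ∀ x, Φ (-x) = Φ x
  zero : Φ 0 = 0
  doubling : ∀ m : ℝ, ∃ k C : ℝ, 0 ≤ k ∧ 0 ≤ C ∧ ∀ x, Φ (m • x) ≤ k * Φ x + C
  superlinear : ∀ η > 0, ∃ C : ℝ, 0 ≤ C ∧ ∀ x, ‖x‖ ≤ η * Φ x + C

theorem smul_le_of_convex {N : ℕ} {Φ : E N → ℝ} (hc : ConvexOn ℝ univ Φ) (h0 : Φ 0 = 0)
    {s : ℝ} (hs : 0 ≤ s) (hs1 : s ≤ 1) (x : E N) : Φ (s • x) ≤ s * Φ x := by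
  have := hc.2 (mem_univ x) (mem_univ 0) hs (sub_nonneg.2 hs1) (by ring)
  simpa [h0] using this

theorem smul_le_of_convex_even {N : ℕ} {Φ : E N → ℝ} (hc : ConvexOn ℝ univ Φ) (h0 : Φ 0 = 0)
    (he : ∀ x, Φ (-x) = Φ x)
    {s : ℝ} (hs : |s| ≤ 1) (x : E N) : Φ (s • x) ≤ |s| * Φ x := by
  rcases abs_cases s with ⟨h, h'⟩ | ⟨h, h'⟩
  · rw [h] at hs ⊢
    exact smul_le_of_convex hc h0 h' hs x
  · rw [h] at hs ⊢
    have := smul_le_of_convex hc h0 (by linarith) hs x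
    rwa [neg_smul, he] at this

/-- Iterating the factor 2 reaches some 2^n > |m|; convexity and evenness take care of the ratio m /
2^n. Arbitrary scalings are what makes the Orlicz class a vector space. -/
theorem doubling_of_two {N : ℕ} {Φ : E N → ℝ} (hc : ConvexOn ℝ univ Φ) (h0 : Φ 0 = 0)
    (hn : ∀ x, 0 ≤ Φ x) (he : ∀ x, Φ (-x) = Φ x)
    (h2 : ∃ k C : ℝ, 0 ≤ k ∧ 0 ≤ C ∧ ∀ x, Φ ((2 : ℝ) • x) ≤ k * Φ x + C) (m : ℝ) :
    ∃ k C : ℝ, 0 ≤ k ∧ 0 ≤ C ∧ ∀ x, Φ (m • x) ≤ k * Φ x + C := by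
  obtain ⟨k, C, hk, hC, h⟩ := h2
  have key : ∀ n : ℕ, ∃ k C : ℝ, 0 ≤ k ∧ 0 ≤ C ∧ ∀ x, Φ ((2 : ℝ) ^ n • x) ≤ k * Φ x + C := by
    intro n
    induction n with
    | zero => exact ⟨1, 0, by simp, by simp, by simp⟩
    | succ n ih =>
      obtain ⟨k', C', hk', hC', h'⟩ := ih
      refine ⟨k * k', k * C' + C, by positivity, by positivity, fun x => ?_⟩
      have e : (2 : ℝ) ^ (n + 1) • x = (2 : ℝ) • ((2 : ℝ) ^ n • x) := by
        rw [smul_smul]; ring_nf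
      rw [e]
      have := mul_le_mul_of_nonneg_left (h' x) hk
      linarith [h ((2 : ℝ) ^ n • x)]
  obtain ⟨n, hn'⟩ := pow_unbounded_of_one_lt |m| (one_lt_two (α := ℝ))
  obtain ⟨k', C', hk', hC', h'⟩ := key n
  refine ⟨k', C', hk', hC', fun x => ?_⟩
  have hpos : (0 : ℝ) < 2 ^ n := by positivity
  have e : m • x = (m / 2 ^ n) • ((2 : ℝ) ^ n • x) := by
    rw [smul_smul]; congr 1; field_simp
  have hle : |m / 2 ^ n| ≤ 1 := by
    rw [abs_div, abs_of_pos hpos, div_le_one hpos]; exact hn'.le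
  rw [e]
  have h1 := smul_le_of_convex_even hc h0 he hle ((2 : ℝ) ^ n • x)
  have h3 : |m / 2 ^ n| * Φ ((2 : ℝ) ^ n • x) ≤ 1 * Φ ((2 : ℝ) ^ n • x) :=
    mul_le_mul_of_nonneg_right hle (hn _)
  linarith [h' x]

/-- A continuous function is bounded on balls of `ℝ^N`. -/
theorem exists_bound_on_ball {N : ℕ} {Φ : E N → ℝ} (hc : Continuous Φ) (R : ℝ) :
    ∃ C : ℝ, 0 ≤ C ∧ ∀ x, ‖x‖ ≤ R → Φ x ≤ C := by
  obtain ⟨C, hC⟩ := ((isCompact_closedBall (0 : E N) R).image hc).bddAbove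
  refine ⟨max C 0, le_max_right _ _, fun x hx => le_trans (hC ⟨x, by simpa using hx, rfl⟩)
    (le_max_left _ _)⟩

namespace YoungFn

variable {N : ℕ} {Φ : E N → ℝ} (h : YoungFn Φ)
include h

theorem smul_le {s : ℝ} (hs : |s| ≤ 1) (x : E N) : Φ (s • x) ≤ |s| * Φ x :=
  smul_le_of_convex_even h.convex h.zero h.even hs x

theorem smul_le_self {s : ℝ} (hs : |s| ≤ 1) (x : E N) : Φ (s • x) ≤ Φ x := by
  have := mul_le_mul_of_nonneg_right hs (h.nonneg x)
  linarith [h.smul_le hs x]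

theorem add_le (x y : E N) : Φ (x + y) ≤ 1 / 2 * Φ ((2 : ℝ) • x) + 1 / 2 * Φ ((2 : ℝ) • y) := by
  have := h.convex.2 (mem_univ ((2 : ℝ) • x)) (mem_univ ((2 : ℝ) • y))
    (by norm_num : (0 : ℝ) ≤ 1 / 2) (by norm_num : (0 : ℝ) ≤ 1 / 2) (by norm_num)
  simpa [smul_smul] using this

theorem add_bound (m : ℝ) : ∃ k C : ℝ, 0 ≤ k ∧ 0 ≤ C ∧
    ∀ x y, Φ (m • (x + y)) ≤ k * Φ x + k * Φ y + C := by
  obtain ⟨k, C, hk, hC, hd⟩ := h.doubling (2 * m)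
  refine ⟨k, C, hk, hC, fun x y => ?_⟩
  have h1 := h.add_le (m • x) (m • y)
  rw [smul_smul, smul_smul, ← smul_add] at h1
  have := hd x
  have := hd y
  have := h.nonneg x
  have := h.nonneg y
  nlinarith

theorem sub_bound (m : ℝ) : ∃ k C : ℝ, 0 ≤ k ∧ 0 ≤ C ∧
    ∀ x y, Φ (m • (x - y)) ≤ k * Φ x + k * Φ y + C := by
  obtain ⟨k, C, hk, hC, hd⟩ := h.add_bound m
  refine ⟨k, C, hk, hC, fun x y => ?_⟩
  have := hd x (-y)
  rwa [h.even, ← sub_eq_add_neg] at this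

end YoungFn

/-! ### G-functions and their conjugates. -/

namespace IsGFunction

variable {N : ℕ} {G : E N → ℝ} (hG : IsGFunction G)
include hG

theorem young : YoungFn G where
  nonneg := hG.nonneg
  cont := hG.contDiff.continuous
  convex := hG.convex
  even := hG.even
  zero := hG.zero
  doubling := by
    refine doubling_of_two hG.convex hG.zero hG.nonneg hG.even ?_
    obtain ⟨k, hk, R, hR, h⟩ := hG.delta_two
    have hcont : Continuous (fun x => G ((2 : ℝ) • x)) :=
      hG.contDiff.continuous.comp (continuous_const_smul _)
    -- Δ₂ holds only at infinity; the bound on the remaining ball becomes the additive constant.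
    obtain ⟨C, hC, hb⟩ := exists_bound_on_ball hcont R
    refine ⟨k, C, hk.le, hC, fun x => ?_⟩
    have h0 := hG.nonneg x
    rcases le_total R ‖x‖ with hx | hx
    · linarith [h x hx]
    · have := hb x hx
      have : 0 ≤ k * G x := by positivity
      linarith
  superlinear := by
    intro η hη
    obtain ⟨R, -, hR⟩ := (hasBasis_cobounded_norm.eventually_iff).1
      (hG.superlinear.eventually (eventually_ge_atTop η⁻¹))
    refine ⟨max R 0, le_max_right _ _, fun x => ?_⟩
    have h0 : 0 ≤ η * G x := mul_nonneg hη.le (hG.nonneg x)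
    rcases le_total (max R 0) ‖x‖ with hx | hx
    · rcases (norm_nonneg x).eq_or_lt with h | h
      · rw [← h]; positivity
      · have h1 := hR (x := x) (le_trans (le_max_left _ _) hx)
        rw [le_div_iff₀ h] at h1
        have h2 := mul_le_mul_of_nonneg_left h1 hη.le
        rw [← mul_assoc, mul_inv_cancel₀ hη.ne', one_mul] at h2
        linarith [le_max_right R 0]
    · linarith

/-- Superlinearity with slope (‖y‖ + 1)⁻¹ absorbs the linear term into G. Without boundedness the
real supremum in `conj` would carry no information. -/
theorem bddAbove_conj (y : E N) : BddAbove (range fun x : E N => inner ℝ x y - G x) := by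
  obtain ⟨C, hC, h⟩ := hG.young.superlinear (‖y‖ + 1)⁻¹ (by positivity)
  refine ⟨‖y‖ * C, ?_⟩
  rintro _ ⟨x, rfl⟩
  have h1 := real_inner_le_norm x y
  have h2 := mul_le_mul_of_nonneg_left (h x) (norm_nonneg y)
  have h3 : ‖y‖ * ((‖y‖ + 1)⁻¹ * G x) ≤ G x := by
    rw [← mul_assoc, ← div_eq_mul_inv]
    refine mul_le_of_le_one_left (hG.nonneg x) ?_
    rw [div_le_one (by positivity)]; linarith
  simp only
  nlinarith

/-- The Fenchel-Young inequality. -/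
theorem inner_le (x y : E N) : inner ℝ x y ≤ G x + conj G y := by
  have : inner ℝ x y - G x ≤ conj G y := le_ciSup (hG.bddAbove_conj y) x
  linarith

theorem inner_le' (x y : E N) : inner ℝ y x ≤ conj G y + G x := by
  rw [real_inner_comm, add_comm]; exact hG.inner_le x y

theorem abs_inner_le (x y : E N) : |inner ℝ y x| ≤ conj G y + G x := by
  rw [abs_le]
  constructor
  · have := hG.inner_le' (-x) y
    rw [hG.even, inner_neg_right] at this
    linarith
  · exact hG.inner_le' x y

theorem conj_nonneg (y : E N) : 0 ≤ conj G y := by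
  have := hG.inner_le 0 y
  simpa [hG.zero] using this

/-- Duality exchanges the conditions: ∇₂ for G gives doubling of G*, finiteness of G gives
superlinearity of G*, and a finite convex function on ℝ^N is continuous. All results on Orlicz
classes thus apply to G* as well. -/
theorem conj_young : YoungFn (conj G) := by
  have hconv : ConvexOn ℝ univ (conj G) := by
    refine ⟨convex_univ, fun y₁ _ y₂ _ a b ha hb hab => ciSup_le fun x => ?_⟩
    have h1 := mul_le_mul_of_nonneg_left (hG.inner_le x y₁) ha
    have h2 := mul_le_mul_of_nonneg_left (hG.inner_le x y₂) hb
    have h3 : G x = a * G x + b * G x := by rw [← add_mul, hab, one_mul]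
    simp only [inner_add_right, inner_smul_right, smul_eq_mul]
    linarith
  have heven : ∀ y, conj G (-y) = conj G y := by
    have : ∀ y, conj G (-y) ≤ conj G y := fun y => ciSup_le fun x => by
      have := hG.inner_le (-x) y
      rw [hG.even, inner_neg_left] at this
      rw [inner_neg_right]; linarith
    intro y
    refine le_antisymm (this y) ?_
    simpa using this (-y)
  have hzero : conj G 0 = 0 := by
    refine le_antisymm (ciSup_le fun x => ?_) (hG.conj_nonneg 0)
    simp [hG.nonneg x]
  refine ⟨hG.conj_nonneg, ?_, hconv, heven, hzero, ?_, ?_⟩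
  · rw [← continuousOn_univ]; exact hconv.continuousOn isOpen_univ
  · refine doubling_of_two hconv hzero hG.conj_nonneg heven ?_
    obtain ⟨k, hk, R, hR, h⟩ := hG.nabla_two
    obtain ⟨C, hC, hb⟩ := exists_bound_on_ball hG.contDiff.continuous R
    have hk0 : (0 : ℝ) < k := by linarith
    refine ⟨2 * k, 2 * k * C, by positivity, by positivity, fun y => ciSup_le fun x => ?_⟩
    have h1 : G (k⁻¹ • x) ≤ 1 / (2 * k) * G x + C := by
      have h0 : 0 ≤ 1 / (2 * k) * G x := mul_nonneg (by positivity) (hG.nonneg x)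
      rcases le_total R ‖k⁻¹ • x‖ with hx | hx
      · have := h _ hx
        rw [smul_smul, mul_inv_cancel₀ hk0.ne', one_smul] at this
        linarith
      · linarith [hb _ hx]
    -- Fenchel–Young at `k⁻¹ • x`, later multiplied by 2k: by ∇₂ the value of G there costs only
    -- G(x)/(2k), so exactly one G(x) appears against 2⟨x, y⟩.
    have h2 := hG.inner_le (k⁻¹ • x) y
    rw [inner_smul_left] at h2
    have h3 : k⁻¹ * inner ℝ x y ≤ 1 / (2 * k) * G x + C + conj G y := by
      simp at h2 ⊢; simp at h1; linarith
    have h4 := mul_le_mul_of_nonneg_left h3 (by positivity : (0 : ℝ) ≤ 2 * k)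
    have e1 : 2 * k * (k⁻¹ * inner ℝ x y) = 2 * inner ℝ x y := by field_simp
    have e2 : 2 * k * (1 / (2 * k) * G x + C + conj G y) = G x + 2 * k * C + 2 * k * conj G y := by
      field_simp
    rw [e1, e2] at h4
    rw [inner_smul_right]; linarith
  · intro η hη
    obtain ⟨C, hC, hb⟩ := exists_bound_on_ball hG.contDiff.continuous η⁻¹
    refine ⟨η * C, by positivity, fun y => ?_⟩
    rcases eq_or_ne y 0 with rfl | hy
    · have := hG.conj_nonneg 0
      simp; positivity
    have hy' : 0 < ‖y‖ := norm_pos_iff.2 hy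
    -- A test vector of length η⁻¹ in the direction of y, where G is at most C.
    have h1 := hG.inner_le ((η⁻¹ * ‖y‖⁻¹) • y) y
    have h2 := hb ((η⁻¹ * ‖y‖⁻¹) • y) (by
      rw [norm_smul, norm_mul, norm_inv, norm_inv, norm_norm, mul_assoc,
        inv_mul_cancel₀ hy'.ne', Real.norm_of_nonneg hη.le, mul_one])
    rw [inner_smul_left, real_inner_self_eq_norm_sq] at h1
    have e : (starRingEnd ℝ) (η⁻¹ * ‖y‖⁻¹) * ‖y‖ ^ 2 = η⁻¹ * ‖y‖ := by
      simp; field_simp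
    rw [e] at h1
    have h3 : η⁻¹ * ‖y‖ ≤ C + conj G y := by linarith
    have h4 := mul_le_mul_of_nonneg_left h3 hη.le
    rw [← mul_assoc, mul_inv_cancel₀ hη.ne', one_mul] at h4
    linarith

theorem differentiableAt (v : E N) : DifferentiableAt ℝ G v :=
  hG.contDiff.differentiable one_ne_zero v

/-- The gradient inequality gives G*(∇G(v)) ≤ ⟨∇G(v), v⟩ − G(v), and the same inequality at 2v gives
⟨∇G(v), v⟩ ≤ G(2v) − G(v). This turns the growth bound on F_v into one by G(v). -/
theorem conj_gradient_le : ∃ k C : ℝ, 0 ≤ k ∧ 0 ≤ C ∧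
    ∀ v, conj G (gradient G v) ≤ k * G v + C := by
  obtain ⟨k, C, hk, hC, h⟩ := hG.young.doubling 2
  refine ⟨k, C, hk, hC, fun v => ciSup_le fun x => ?_⟩
  have h1 := gradient_inequality hG.convex (hG.differentiableAt v) x
  have h2 := gradient_inequality hG.convex (hG.differentiableAt v) ((2 : ℝ) • v)
  have h3 := h v
  have h4 := hG.nonneg v
  rw [inner_sub_right, real_inner_comm] at h1
  rw [inner_sub_right, inner_smul_right] at h2
  linarith

theorem continuous_gradient : Continuous (gradient G) := by
  have : Continuous (fderiv ℝ G) := hG.contDiff.continuous_fderiv one_ne_zero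
  exact (InnerProductSpace.toDual ℝ (E N)).symm.continuous.comp this

end IsGFunction

end AnisotropicEL

end
open Set Filter Topology MeasureTheory

noncomputable section

namespace AnisotropicEL

/-! ### Ekeland's variational principle and the mountain pass theorem -/

/-- Ekeland's variational principle. -/
theorem ekeland {X : Type*} [MetricSpace X] [CompleteSpace X] {Ψ : X → ℝ} (hΨ : Continuous Ψ)
    {m : ℝ} (hm : ∀ x, m ≤ Ψ x) {ε : ℝ} (hε : 0 < ε) (x₀ : X) :
    ∃ x, Ψ x ≤ Ψ x₀ ∧ ∀ y, Ψ x ≤ Ψ y + ε * dist x y := by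
  -- The successors of x in Ekeland's order.
  let S : X → Set X := fun x => {y | Ψ y + ε * dist x y ≤ Ψ x}
  have hself : ∀ x, x ∈ S x := fun x => by simp [S]
  have htrans : ∀ {x y z}, y ∈ S x → z ∈ S y → z ∈ S x := by
    intro x y z hy hz
    simp only [S, mem_ofPred_eq] at hy hz ⊢
    have := mul_le_mul_of_nonneg_left (dist_triangle x y z) hε.le
    linarith
  have hstep : ∀ (n : ℕ) (x : X), ∃ y ∈ S x, ∀ z ∈ S x, Ψ y ≤ Ψ z + (1 / 2) ^ n := by
    intro n x
    have hne : (Ψ '' S x).Nonempty := ⟨_, x, hself x, rfl⟩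
    have hbd : BddBelow (Ψ '' S x) := ⟨m, by rintro _ ⟨z, -, rfl⟩; exact hm z⟩
    obtain ⟨_, ⟨y, hy, rfl⟩, hlt⟩ :=
      exists_lt_of_csInf_lt hne (lt_add_of_pos_right (sInf (Ψ '' S x))
        (by positivity : (0 : ℝ) < (1 / 2) ^ n))
    refine ⟨y, hy, fun z hz => ?_⟩
    have := csInf_le hbd ⟨z, hz, rfl⟩
    linarith
  choose next hnext hmin using hstep
  -- Each step moves to a successor whose value is within 2⁻ⁿ of the infimum over all successors.
  -- The decrease of Ψ dominates ε times the distance, so the sequence is Cauchy.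
  let x : ℕ → X := fun n => Nat.rec x₀ (fun n y => next n y) n
  have hx : ∀ n, x (n + 1) = next n (x n) := fun n => rfl
  have hmem : ∀ n k, x (n + k) ∈ S (x n) := by
    intro n k
    induction k with
    | zero => exact hself _
    | succ k ih =>
      refine htrans ih ?_
      rw [← add_assoc, hx]
      exact hnext _ _
  have hmem' : ∀ {n k}, n ≤ k → x k ∈ S (x n) := by
    intro n k hnk
    have := hmem n (k - n)
    rwa [Nat.add_sub_cancel' hnk] at this
  have hanti : Antitone (fun n => Ψ (x n)) := by
    intro n k hnk
    have h1 : Ψ (x k) + ε * dist (x n) (x k) ≤ Ψ (x n) := hmem' hnk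
    have h2 : 0 ≤ ε * dist (x n) (x k) := by positivity
    simp only; linarith
  have hbdd : BddBelow (range fun n => Ψ (x n)) := ⟨m, by rintro _ ⟨n, rfl⟩; exact hm _⟩
  have hcauchyΨ : CauchySeq (fun n => Ψ (x n)) := (tendsto_atTop_ciInf hanti hbdd).cauchySeq
  have hcauchy : CauchySeq x := by
    rw [Metric.cauchySeq_iff'] at hcauchyΨ ⊢
    intro δ hδ
    obtain ⟨n₀, hn₀⟩ := hcauchyΨ (ε * δ) (by positivity)
    refine ⟨n₀, fun n hn => ?_⟩
    have h1 : Ψ (x n) + ε * dist (x n₀) (x n) ≤ Ψ (x n₀) := hmem' hn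
    have h2 := hn₀ n hn
    rw [Real.dist_eq] at h2
    have h3 := (abs_lt.1 h2).1
    rw [dist_comm]
    exact lt_of_mul_lt_mul_left (by linarith) hε.le
  obtain ⟨a, ha⟩ := cauchySeq_tendsto_of_complete hcauchy
  have hclosed : ∀ y, IsClosed (S y) := fun y =>
    isClosed_le (hΨ.add (continuous_const.mul (continuous_const.dist continuous_id)))
      continuous_const
  have haS : ∀ n, a ∈ S (x n) := fun n =>
    (hclosed _).mem_of_tendsto ha (eventually_atTop.2 ⟨n, fun k hk => hmem' hk⟩)
  refine ⟨a, ?_, fun y => ?_⟩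
  · have h1 : Ψ a + ε * dist x₀ a ≤ Ψ x₀ := haS 0
    have : 0 ≤ ε * dist x₀ a := by positivity
    linarith
  -- A successor of the limit succeeds every term of the sequence, so near-minimality leaves it no
  -- room below Ψ a. For any other point the claim is the negated membership.
  · by_cases hy : y ∈ S a
    · have h1 : ∀ n, Ψ (x (n + 1)) ≤ Ψ y + (1 / 2) ^ n := fun n =>
        hmin n (x n) y (htrans (haS n) hy)
      have h2 : Tendsto (fun n => Ψ (x (n + 1))) atTop (𝓝 (Ψ a)) :=
        ((hΨ.tendsto a).comp ha).comp (tendsto_add_atTop_nat 1)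
      have h3 : Tendsto (fun n : ℕ => Ψ y + (1 / 2 : ℝ) ^ n) atTop (𝓝 (Ψ y + 0)) :=
        tendsto_const_nhds.add (tendsto_pow_atTop_nhds_zero_of_lt_one (by norm_num) (by norm_num))
      have h4 := le_of_tendsto_of_tendsto' h2 h3 h1
      have : 0 ≤ ε * dist a y := by positivity
      linarith
    · exact (not_le.1 hy).le

/-- If the derivative of `J` has norm larger than `r` at `x`, it is below `-r` in some direction of
norm at most one. -/
theorem exists_descent_direction {X : Type*} [NormedAddCommGroup X] [NormedSpace ℝ X]
    {l : X →L[ℝ] ℝ} {r : ℝ} (hr : 0 ≤ r) (h : r < ‖l‖) : ∃ v : X, ‖v‖ ≤ 1 ∧ l v < -r := by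
  by_contra! hcon
  refine absurd h (not_lt.2 ?_)
  refine ContinuousLinearMap.opNorm_le_bound _ hr fun v => ?_
  rcases eq_or_ne v 0 with rfl | hv
  · simp
  have hv' : 0 < ‖v‖ := norm_pos_iff.2 hv
  have key : ∀ w : X, ‖w‖ = ‖v‖ → -(r * ‖v‖) ≤ l w := by
    intro w hw
    have h1 := hcon (‖v‖⁻¹ • w) (by rw [norm_smul, hw, norm_inv, norm_norm, inv_mul_cancel₀ hv'.ne'])
    rw [map_smul, smul_eq_mul] at h1
    have h2 := mul_le_mul_of_nonneg_left h1 hv'.le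
    rw [← mul_assoc, mul_inv_cancel₀ hv'.ne', one_mul] at h2
    linarith
  have h1 := key v rfl
  have h2 := key (-v) (norm_neg v)
  rw [map_neg] at h2
  rw [Real.norm_eq_abs, abs_le]
  constructor <;> linarith

/-- The mountain pass theorem: at the mountain pass level `c` there are almost critical points. -/
theorem mountain_pass {X : Type*} [NormedAddCommGroup X] [NormedSpace ℝ X] [CompleteSpace X]
    {J : X → ℝ} {J' : X → X →L[ℝ] ℝ} (hJ : ∀ x, HasFDerivAt J (J' x) x) (hJ' : Continuous J')
    {e : X} {c : ℝ}
    (hc_le : ∀ γ : C(unitInterval, X), γ 0 = 0 → γ 1 = e → ∃ s, c ≤ J (γ s))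
    (hc_inf : ∀ δ > 0, ∃ γ : C(unitInterval, X), γ 0 = 0 ∧ γ 1 = e ∧ ∀ s, J (γ s) < c + δ)
    (h0 : J 0 < c) (he : J e < c) {ε : ℝ} (hε : 0 < ε) :
    ∃ u, |J u - c| ≤ ε ∧ ‖J' u‖ ≤ ε := by
  have hJc : Continuous J := continuous_iff_continuousAt.2 fun x => (hJ x).continuousAt
  -- A margin with 2η below the threshold and both endpoints below c − η, so that the endpoints
  -- never have to move.
  obtain ⟨η, hη, hηε, hη0, hηe⟩ : ∃ η > 0, 2 * η ≤ ε ∧ J 0 < c - η ∧ J e < c - η := by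
    refine ⟨min (ε / 2) (min ((c - J 0) / 2) ((c - J e) / 2)), ?_, ?_, ?_, ?_⟩
    · refine lt_min (by linarith) (lt_min (by linarith) (by linarith))
    · have := min_le_left (ε / 2) (min ((c - J 0) / 2) ((c - J e) / 2)); linarith
    · have := (min_le_right (ε / 2) (min ((c - J 0) / 2) ((c - J e) / 2))).trans (min_le_left _ _)
      linarith
    · have := (min_le_right (ε / 2) (min ((c - J 0) / 2) ((c - J e) / 2))).trans (min_le_right _ _)
      linarith
  let P : Set C(unitInterval, X) := {γ | γ 0 = 0 ∧ γ 1 = e}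
  have hPclosed : IsClosed P :=
    (isClosed_eq (continuous_eval_const (F := C(unitInterval, X)) 0) continuous_const).inter
      (isClosed_eq (continuous_eval_const (F := C(unitInterval, X)) 1) continuous_const)
  have : CompleteSpace P := hPclosed.completeSpace_coe
  let Ψ : P → ℝ := fun γ => sSup ((fun s => J (γ.1 s)) '' univ)
  have hΨ : Continuous Ψ := by
    refine IsCompact.continuous_sSup isCompact_univ ?_
    exact hJc.comp ((continuous_eval (F := C(unitInterval, X))).comp
      ((continuous_subtype_val.comp continuous_fst).prodMk continuous_snd))
  have hΨle : ∀ (γ : P) s, J (γ.1 s) ≤ Ψ γ := fun γ s =>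
    le_csSup (isCompact_univ.image (hJc.comp γ.1.continuous)).bddAbove ⟨s, mem_univ _, rfl⟩
  have hΨmax : ∀ γ : P, ∃ s, J (γ.1 s) = Ψ γ := fun γ => by
    obtain ⟨s, -, hs, -⟩ := isCompact_univ.exists_sSup_image_eq_and_ge (univ_nonempty)
      (hJc.comp γ.1.continuous).continuousOn
    exact ⟨s, hs.symm⟩
  have hΨc : ∀ γ : P, c ≤ Ψ γ := fun γ => by
    obtain ⟨s, hs⟩ := hc_le γ.1 γ.2.1 γ.2.2
    exact hs.trans (hΨle γ s)
  obtain ⟨γ₀, h00, h01, hγ₀⟩ := hc_inf η hη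
  -- Ekeland's principle for the maximum of J along a path: moving this path by h in the sup
  -- distance lowers its maximum by at most η h.
  obtain ⟨γ, hγle, hγ⟩ := ekeland hΨ hΨc hη (⟨γ₀, h00, h01⟩ : P)
  have hγη : ∀ s, J (γ.1 s) ≤ c + η := fun s => by
    obtain ⟨s', hs'⟩ := hΨmax ⟨γ₀, h00, h01⟩
    have := hγ₀ s'
    have := hΨle γ s
    simp only at hs'
    linarith
  by_contra! hcon
  have hcon' : ∀ s, c - η ≤ J (γ.1 s) → 2 * η < ‖J' (γ.1 s)‖ := by
    intro s hs
    refine lt_of_le_of_lt hηε (hcon _ ?_)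
    rw [abs_le]
    constructor <;> linarith [hγη s]
  -- Admissible directions. The constraints are convex and locally met by a constant vector, so a
  -- continuous selection exists. Below the level c − η no descent is demanded, which leaves room to
  -- fix the endpoints.
  let t : unitInterval → Set X := fun s =>
    {v | ‖v‖ ≤ 1 ∧ (c - η ≤ J (γ.1 s) → J' (γ.1 s) v < -(2 * η)) ∧ ((s = 0 ∨ s = 1) → v = 0)}
  have hfield : ∃ v : C(unitInterval, X), ∀ s, v s ∈ t s := by
    refine exists_continuous_forall_mem_convex_of_local_const (fun s => ?_) fun s => ?_
    · intro v hv w hw a b ha hb hab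
      refine ⟨?_, fun hs => ?_, fun hs => by rw [hv.2.2 hs, hw.2.2 hs]; simp⟩
      · have := (convex_closedBall (0 : X) 1) (by simpa using hv.1) (by simpa using hw.1) ha hb hab
        simpa using this
      · have := (convex_Iio (𝕜 := ℝ) (-(2 * η))) (hv.2.1 hs) (hw.2.1 hs) ha hb hab
        simpa using this
    · by_cases hs : c - η ≤ J (γ.1 s)
      · obtain ⟨v, hv1, hv2⟩ := exists_descent_direction (by positivity) (hcon' s hs)
        refine ⟨v, ?_⟩
        have hc1 : Continuous fun y => J' (γ.1 y) v :=
          (hJ'.comp γ.1.continuous).clm_apply continuous_const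
        have h1 : ∀ᶠ y in 𝓝 s, J' (γ.1 y) v < -(2 * η) :=
          hc1.continuousAt.eventually_lt continuousAt_const hv2
        have hs0 : s ≠ 0 := fun h => by rw [h, γ.2.1] at hs; linarith
        have hs1 : s ≠ 1 := fun h => by rw [h, γ.2.2] at hs; linarith
        filter_upwards [h1, isOpen_ne.mem_nhds hs0, isOpen_ne.mem_nhds hs1] with y hy hy0 hy1
        exact ⟨hv1, fun _ => hy, fun h => absurd h (by simp only [not_or]; exact ⟨hy0, hy1⟩)⟩
      · refine ⟨0, ?_⟩
        have h1 : ∀ᶠ y in 𝓝 s, J (γ.1 y) < c - η :=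
          (hJc.comp γ.1.continuous).continuousAt.eventually_lt continuousAt_const (not_le.1 hs)
        filter_upwards [h1] with y hy
        exact ⟨by simp, fun h => absurd h (not_le.2 hy), fun _ => rfl⟩
  obtain ⟨v, hv⟩ := hfield
  have hpc : Continuous fun p : unitInterval × ℝ => γ.1 p.1 + p.2 • v p.1 := by fun_prop
  -- uniform smallness of the perturbation on the compact interval
  have hunif : ∀ φ : unitInterval × ℝ → ℝ, Continuous φ → ∀ δ > 0, ∃ h₀ > 0, ∀ s : unitInterval,
      ∀ h : ℝ, 0 ≤ h → h ≤ h₀ → |φ (s, h) - φ (s, 0)| < δ := by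
    intro φ hφ δ hδ
    have hK : IsCompact ((univ : Set unitInterval) ×ˢ Icc (0 : ℝ) 1) :=
      isCompact_univ.prod isCompact_Icc
    have huc := hK.uniformContinuousOn_of_continuous hφ.continuousOn
    rw [Metric.uniformContinuousOn_iff] at huc
    obtain ⟨d, hd, hh⟩ := huc δ hδ
    refine ⟨min 1 (d / 2), by positivity, fun s h h0 h1 => ?_⟩
    refine hh (s, h) ⟨mem_univ _, h0, h1.trans (min_le_left _ _)⟩ (s, 0)
      ⟨mem_univ _, le_rfl, zero_le_one⟩ ?_
    rw [Prod.dist_eq, dist_self, Real.dist_eq, sub_zero, abs_of_nonneg h0]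
    have := h1.trans (min_le_right _ _)
    exact max_lt hd (by linarith)
  obtain ⟨h₁, hh₁, hu₁⟩ := hunif (fun p => J (γ.1 p.1 + p.2 • v p.1)) (hJc.comp hpc) η hη
  obtain ⟨h₂, hh₂, hu₂⟩ := hunif (fun p => J' (γ.1 p.1 + p.2 • v p.1) (v p.1))
    ((hJ'.comp hpc).clm_apply (v.continuous.comp continuous_fst)) (η / 2) (by positivity)
  obtain ⟨h, hh, hhh₁, hhh₂⟩ : ∃ h > 0, h ≤ h₁ ∧ h ≤ h₂ :=
    ⟨min h₁ h₂, lt_min hh₁ hh₂, min_le_left _ _, min_le_right _ _⟩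
  let γh : P := ⟨γ.1 + h • v, by
    constructor
    · simp [γ.2.1, (hv 0).2.2 (Or.inl rfl)]
    · simp [γ.2.2, (hv 1).2.2 (Or.inr rfl)]⟩
  have hγh : ∀ s, γh.1 s = γ.1 s + h • v s := fun s => rfl
  have hdist : dist γ γh ≤ h := by
    rw [Subtype.dist_eq, ContinuousMap.dist_le hh.le]
    intro s
    rw [hγh, dist_eq_norm, sub_add_cancel_left, norm_neg, norm_smul, Real.norm_of_nonneg hh.le]
    exact mul_le_of_le_one_right hh.le (hv s).1
  obtain ⟨s, hs⟩ := hΨmax γh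
  -- The maximum of the moved path is at least c and J moved by less than η, so descent is
  -- prescribed at the maximizing parameter.
  have hsS : c - η ≤ J (γ.1 s) := by
    have h1 := hu₁ s h hh.le hhh₁
    have h2 := hΨc γh
    simp only [zero_smul, add_zero] at h1
    rw [hγh] at hs
    have := (abs_lt.1 h1).2
    linarith
  have hder : ∀ r, HasDerivAt (fun r : ℝ => J (γ.1 s + r • v s)) (J' (γ.1 s + r • v s) (v s)) r := by
    intro r
    have h1 : HasDerivAt (fun r : ℝ => γ.1 s + r • v s) (v s) r := by
      simpa using ((hasDerivAt_id r).smul_const (v s)).const_add (γ.1 s)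
    exact (hJ _).comp_hasDerivAt r h1
  obtain ⟨r, hr, hr'⟩ := exists_hasDerivAt_eq_slope _ _ hh
    (fun x _ => (hder x).continuousAt.continuousWithinAt) (fun x _ => hder x)
  have h3 := hu₂ s r hr.1.le (hr.2.le.trans hhh₂)
  simp only [zero_smul, add_zero, sub_zero] at h3 hr'
  have h4 := (hv s).2.1 hsS
  have h5 : J' (γ.1 s + r • v s) (v s) < -(3 / 2 * η) := by
    have := (abs_lt.1 h3).2; linarith
  -- A descent of more than (3/2) η h at the maximizer contradicts Ekeland's bound η h.
  rw [hr', div_lt_iff₀ hh, ← hγh, hs] at h5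
  have h6 := hγ γh
  have h7 := mul_le_mul_of_nonneg_left hdist hη.le
  have h8 := hΨle γ s
  nlinarith

end AnisotropicEL

end
open Set Filter Topology MeasureTheory

noncomputable section

namespace AnisotropicEL

/-! ### Orlicz classes on the interval -/

/-- Lebesgue measure on the interval `I`. -/
abbrev mu (T : ℝ) : Measure ℝ := volume.restrict (I T)

instance isFiniteMeasure_mu (T : ℝ) : IsFiniteMeasure (mu T) :=
  ⟨by simp [mu, I, Real.volume_Icc]⟩

theorem mu_real_univ {T : ℝ} (hT : 0 ≤ T) : (mu T).real univ = 2 * T := by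
  simp [mu, I, Measure.real, Real.volume_Icc]; rw [ENNReal.toReal_ofReal] <;> linarith

section Orlicz

variable {N : ℕ} {T : ℝ} {Φ : E N → ℝ}

theorem MemLG.congr {u v : ℝ → E N} (hu : MemLG T Φ u) (h : u =ᵐ[mu T] v) : MemLG T Φ v :=
  ⟨hu.1.congr h, Integrable.congr hu.2 (h.mono fun t ht => by simp [ht])⟩

theorem luxNorm_congr {u v : ℝ → E N} (h : u =ᵐ[mu T] v) : luxNorm T Φ u = luxNorm T Φ v := by
  have : ∀ l : ℝ, ∫⁻ t in I T, ENNReal.ofReal (Φ (l⁻¹ • u t))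
      = ∫⁻ t in I T, ENNReal.ofReal (Φ (l⁻¹ • v t)) := fun l =>
    lintegral_congr_ae (h.mono fun t ht => by simp only [ht])
  simp only [luxNorm, this]

theorem luxNorm_nonneg (w : ℝ → E N) : 0 ≤ luxNorm T Φ w :=
  Real.sInf_nonneg fun _ hl => hl.1.le

namespace YoungFn

variable (h : YoungFn Φ)
include h

theorem comp_aestronglyMeasurable {w : ℝ → E N} {μ : Measure ℝ} (hw : AEStronglyMeasurable w μ) :
    AEStronglyMeasurable (fun t => Φ (w t)) μ :=
  h.cont.comp_aestronglyMeasurable hw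

theorem memLG_smul {w : ℝ → E N} (hw : MemLG T Φ w) (m : ℝ) : MemLG T Φ (fun t => m • w t) := by
  obtain ⟨k, C, hk, hC, hd⟩ := h.doubling m
  refine ⟨hw.1.const_smul m, ?_⟩
  refine Integrable.mono' ((hw.2.const_mul k).add (integrable_const C))
    (h.comp_aestronglyMeasurable (hw.1.const_smul m)) (Eventually.of_forall fun t => ?_)
  simp only [Pi.add_apply, Real.norm_of_nonneg (h.nonneg _)]
  exact hd _

theorem memLG_add {w z : ℝ → E N} (hw : MemLG T Φ w) (hz : MemLG T Φ z) :
    MemLG T Φ (fun t => w t + z t) := by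
  refine ⟨hw.1.add hz.1, ?_⟩
  refine Integrable.mono' (((h.memLG_smul hw 2).2.const_mul (1 / 2)).add
    ((h.memLG_smul hz 2).2.const_mul (1 / 2)))
    (h.comp_aestronglyMeasurable (hw.1.add hz.1)) (Eventually.of_forall fun t => ?_)
  simp only [Pi.add_apply, Real.norm_of_nonneg (h.nonneg _)]
  exact h.add_le _ _

theorem memLG_neg {w : ℝ → E N} (hw : MemLG T Φ w) : MemLG T Φ (fun t => -w t) := by
  simpa using h.memLG_smul hw (-1)

theorem memLG_sub {w z : ℝ → E N} (hw : MemLG T Φ w) (hz : MemLG T Φ z) :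
    MemLG T Φ (fun t => w t - z t) := by
  simpa [sub_eq_add_neg] using h.memLG_add hw (h.memLG_neg hz)

theorem memLG_of_bound {w : ℝ → E N} (hw : AEStronglyMeasurable w (mu T)) {R : ℝ}
    (hb : ∀ᵐ t ∂mu T, ‖w t‖ ≤ R) : MemLG T Φ w := by
  obtain ⟨C, hC, hbd⟩ := exists_bound_on_ball h.cont R
  refine ⟨hw, Integrable.mono' (integrable_const C) (h.comp_aestronglyMeasurable hw) ?_⟩
  filter_upwards [hb] with t ht
  rw [Real.norm_of_nonneg (h.nonneg _)]
  exact hbd _ ht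

theorem memLG_zero : MemLG T Φ (fun _ => (0 : E N)) :=
  h.memLG_of_bound (R := 0) aestronglyMeasurable_const (by simp)

theorem integrable {w : ℝ → E N} (hw : MemLG T Φ w) : Integrable w (mu T) := by
  obtain ⟨C, hC, hs⟩ := h.superlinear 1 one_pos
  refine Integrable.mono' (Integrable.add hw.2 (integrable_const C)) hw.1
    (Eventually.of_forall fun t => ?_)
  simpa using hs (w t)

theorem modular_nonneg (w : ℝ → E N) : 0 ≤ ∫ t, Φ (w t) ∂mu T :=
  integral_nonneg fun _ => h.nonneg _

theorem lintegral_le_one_iff {w : ℝ → E N} (hw : MemLG T Φ w) (l : ℝ) :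
    ∫⁻ t in I T, ENNReal.ofReal (Φ (l⁻¹ • w t)) ≤ 1 ↔ ∫ t, Φ (l⁻¹ • w t) ∂mu T ≤ 1 := by
  rw [← ofReal_integral_eq_lintegral_ofReal (h.memLG_smul hw l⁻¹).2
    (Eventually.of_forall fun t => h.nonneg _), ENNReal.ofReal_le_one]

theorem luxNorm_le {w : ℝ → E N} (hw : MemLG T Φ w) {l : ℝ} (hl : 0 < l)
    (hle : ∫ t, Φ (l⁻¹ • w t) ∂mu T ≤ 1) : luxNorm T Φ w ≤ l :=
  csInf_le ⟨0, fun _ hl => hl.1.le⟩ ⟨hl, (h.lintegral_le_one_iff hw l).2 hle⟩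

theorem modular_smul_le {w : ℝ → E N} (hw : MemLG T Φ w) {s : ℝ} (hs : |s| ≤ 1) :
    ∫ t, Φ (s • w t) ∂mu T ≤ |s| * ∫ t, Φ (w t) ∂mu T := by
  rw [← integral_const_mul]
  exact integral_mono (h.memLG_smul hw s).2 (hw.2.const_mul _) fun t => h.smul_le hs _

/-- The number l = 1 + ∫ Φ(w) is admissible, because Φ(l⁻¹ w) ≤ l⁻¹ Φ(w) for l ≥ 1. -/
theorem luxNorm_le_one_add {w : ℝ → E N} (hw : MemLG T Φ w) :
    luxNorm T Φ w ≤ 1 + ∫ t, Φ (w t) ∂mu T := by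
  have h0 := h.modular_nonneg (T := T) w
  refine h.luxNorm_le hw (by linarith) ?_
  have h1 : |(1 + ∫ t, Φ (w t) ∂mu T)⁻¹| = (1 + ∫ t, Φ (w t) ∂mu T)⁻¹ :=
    abs_of_pos (by positivity)
  refine (h.modular_smul_le hw (by rw [h1]; exact inv_le_one_of_one_le₀ (by linarith))).trans ?_
  rw [h1, inv_mul_le_iff₀ (by linarith)]
  linarith

/-- Some admissible k lies below l, and Φ(l⁻¹ w) ≤ Φ(k⁻¹ w) pointwise. Admissible numbers have to be
exhibited first, since the real infimum of the empty set is 0. -/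
theorem modular_le_of_luxNorm_lt {w : ℝ → E N} (hw : MemLG T Φ w) {l : ℝ}
    (hl : luxNorm T Φ w < l) : ∫ t, Φ (l⁻¹ • w t) ∂mu T ≤ 1 := by
  have hne : {l : ℝ | 0 < l ∧ ∫⁻ t in I T, ENNReal.ofReal (Φ (l⁻¹ • w t)) ≤ 1}.Nonempty := by
    have h0 := h.modular_nonneg (T := T) w
    refine ⟨1 + ∫ t, Φ (w t) ∂mu T, by positivity, ?_⟩
    rw [h.lintegral_le_one_iff hw]
    have h1 : |(1 + ∫ t, Φ (w t) ∂mu T)⁻¹| = (1 + ∫ t, Φ (w t) ∂mu T)⁻¹ :=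
      abs_of_pos (by positivity)
    refine (h.modular_smul_le hw (by rw [h1]; exact inv_le_one_of_one_le₀ (by linarith))).trans ?_
    rw [h1, inv_mul_le_iff₀ (by linarith)]
    linarith
  obtain ⟨k, ⟨hk, hk1⟩, hkl⟩ := exists_lt_of_csInf_lt hne hl
  rw [h.lintegral_le_one_iff hw] at hk1
  refine le_trans (integral_mono (h.memLG_smul hw _).2 (h.memLG_smul hw _).2 fun t => ?_) hk1
  have e : l⁻¹ • w t = (l⁻¹ * k) • (k⁻¹ • w t) := by
    rw [smul_smul, mul_assoc, mul_inv_cancel₀ hk.ne', mul_one]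
  simp only
  rw [e]
  refine h.smul_le_self ?_ _
  have hl0 : 0 < l := hk.trans hkl
  rw [abs_of_pos (by positivity), inv_mul_le_iff₀ hl0]
  linarith

/-- Norm smallness implies smallness of the modular. -/
theorem modular_smul_le_of_luxNorm {w : ℝ → E N} (hw : MemLG T Φ w) {m ε : ℝ} (hε : 0 < ε)
    (hε1 : ε ≤ 1) (hm : 0 < m) (hl : luxNorm T Φ w < ε / m) :
    ∫ t, Φ (m • w t) ∂mu T ≤ ε := by
  have h1 := h.modular_le_of_luxNorm_lt hw hl
  have h2 := h.modular_smul_le (h.memLG_smul hw (ε / m)⁻¹) (s := ε)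
    (by rw [abs_of_pos hε]; exact hε1)
  have e : ∀ t, ε • ((ε / m)⁻¹ • w t) = m • w t := fun t => by
    rw [smul_smul]; congr 1; field_simp
  simp only [e] at h2
  rw [abs_of_pos hε] at h2
  nlinarith

/-- For a and b slightly above the two norms, (w + z)/(a + b) is the convex combination of w/a and
z/b with weights a/(a + b) and b/(a + b). -/
theorem luxNorm_add_le {w z : ℝ → E N} (hw : MemLG T Φ w) (hz : MemLG T Φ z) :
    luxNorm T Φ (fun t => w t + z t) ≤ luxNorm T Φ w + luxNorm T Φ z := by
  refine le_of_forall_pos_le_add fun ε hε => ?_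
  set a := luxNorm T Φ w + ε / 2 with ha
  set b := luxNorm T Φ z + ε / 2 with hb
  have ha0 : 0 < a := by have := luxNorm_nonneg (T := T) (Φ := Φ) w; positivity
  have hb0 : 0 < b := by have := luxNorm_nonneg (T := T) (Φ := Φ) z; positivity
  have h1 := h.modular_le_of_luxNorm_lt hw (l := a) (by linarith)
  have h2 := h.modular_le_of_luxNorm_lt hz (l := b) (by linarith)
  have h3 : luxNorm T Φ (fun t => w t + z t) ≤ a + b := by
    refine h.luxNorm_le (h.memLG_add hw hz) (by positivity) ?_
    have hle : ∫ t, Φ ((a + b)⁻¹ • (w t + z t)) ∂mu T ≤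
        ∫ t, (a / (a + b) * Φ (a⁻¹ • w t) + b / (a + b) * Φ (b⁻¹ • z t)) ∂mu T := by
      refine integral_mono (h.memLG_smul (h.memLG_add hw hz) _).2
        (((h.memLG_smul hw _).2.const_mul _).add ((h.memLG_smul hz _).2.const_mul _)) fun t => ?_
      have := h.convex.2 (mem_univ (a⁻¹ • w t)) (mem_univ (b⁻¹ • z t))
        (by positivity : 0 ≤ a / (a + b)) (by positivity : 0 ≤ b / (a + b)) (by field_simp)
      rw [smul_smul, smul_smul] at this
      have e1 : a / (a + b) * a⁻¹ = (a + b)⁻¹ := by field_simp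
      have e2 : b / (a + b) * b⁻¹ = (a + b)⁻¹ := by field_simp
      rw [e1, e2, ← smul_add] at this
      exact this
    refine hle.trans ?_
    rw [integral_add ((h.memLG_smul hw _).2.const_mul _) ((h.memLG_smul hz _).2.const_mul _),
      integral_const_mul, integral_const_mul]
    have h4 := mul_le_mul_of_nonneg_left h1 (by positivity : 0 ≤ a / (a + b))
    have h5 := mul_le_mul_of_nonneg_left h2 (by positivity : 0 ≤ b / (a + b))
    have h6 : a / (a + b) + b / (a + b) = 1 := by field_simp
    linarith
  linarith

theorem luxNorm_zero : luxNorm T Φ (fun _ => (0 : E N)) = 0 := by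
  refine le_antisymm (le_of_forall_pos_le_add fun ε hε => ?_) (luxNorm_nonneg _)
  rw [zero_add]
  exact h.luxNorm_le h.memLG_zero hε (by simp [h.zero])

theorem luxNorm_smul_le {w : ℝ → E N} (hw : MemLG T Φ w) (c : ℝ) :
    luxNorm T Φ (fun t => c • w t) ≤ |c| * luxNorm T Φ w := by
  rcases eq_or_ne c 0 with rfl | hc
  · simp [h.luxNorm_zero]
  have hc' : 0 < |c| := abs_pos.2 hc
  refine le_of_forall_pos_le_add fun ε hε => ?_
  have h0 := luxNorm_nonneg (T := T) (Φ := Φ) w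
  have h1 := h.modular_le_of_luxNorm_lt hw (l := luxNorm T Φ w + ε / |c|)
    (by have : 0 < ε / |c| := by positivity
        linarith)
  have h2 : luxNorm T Φ (fun t => c • w t) ≤ |c| * (luxNorm T Φ w + ε / |c|) := by
    refine h.luxNorm_le (h.memLG_smul hw c) (by positivity) ?_
    refine le_trans (integral_mono (h.memLG_smul (h.memLG_smul hw _) _).2
      (h.memLG_smul hw _).2 fun t => ?_) h1
    simp only
    have e : (|c| * (luxNorm T Φ w + ε / |c|))⁻¹ • c • w t
        = (|c|⁻¹ * c) • ((luxNorm T Φ w + ε / |c|)⁻¹ • w t) := by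
      rw [smul_smul, smul_smul, mul_inv]; ring_nf
    rw [e]
    refine h.smul_le_self ?_ _
    rw [abs_mul, abs_inv, abs_abs, inv_mul_cancel₀ hc'.ne']
  have e : |c| * (luxNorm T Φ w + ε / |c|) = |c| * luxNorm T Φ w + ε := by field_simp
  linarith

theorem luxNorm_smul {w : ℝ → E N} (hw : MemLG T Φ w) (c : ℝ) :
    luxNorm T Φ (fun t => c • w t) = |c| * luxNorm T Φ w := by
  refine le_antisymm (h.luxNorm_smul_le hw c) ?_
  rcases eq_or_ne c 0 with rfl | hc
  · simp [luxNorm_nonneg]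
  have hc' : 0 < |c| := abs_pos.2 hc
  have h1 := h.luxNorm_smul_le (h.memLG_smul hw c) c⁻¹
  simp only [smul_smul, inv_mul_cancel₀ hc, one_smul, abs_inv] at h1
  rwa [← div_eq_inv_mul, le_div_iff₀ hc', mul_comm] at h1

/-- The Orlicz space embeds continuously into `L¹`. -/
theorem exists_integral_norm_le (T : ℝ) :
    ∃ K : ℝ, 0 < K ∧ ∀ w : ℝ → E N, MemLG T Φ w → ∫ t, ‖w t‖ ∂mu T ≤ K * luxNorm T Φ w := by
  obtain ⟨C, hC, hs⟩ := h.superlinear 1 one_pos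
  refine ⟨1 + (mu T).real univ * C, by positivity, fun w hw => ?_⟩
  have key : ∀ l, luxNorm T Φ w < l → ∫ t, ‖w t‖ ∂mu T ≤ (1 + (mu T).real univ * C) * l := by
    intro l hl
    have hl0 : 0 < l := (luxNorm_nonneg _).trans_lt hl
    have h1 := h.modular_le_of_luxNorm_lt hw hl
    have h2 : ∫ t, ‖l⁻¹ • w t‖ ∂mu T ≤ ∫ t, (Φ (l⁻¹ • w t) + C) ∂mu T :=
      integral_mono (h.integrable (h.memLG_smul hw _)).norm
        (Integrable.add (h.memLG_smul hw _).2 (integrable_const C)) fun t => by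
        simpa using hs (l⁻¹ • w t)
    rw [integral_add (h.memLG_smul hw _).2 (integrable_const C), integral_const] at h2
    simp only [norm_smul, norm_inv, Real.norm_of_nonneg hl0.le, integral_const_mul,
      smul_eq_mul] at h2
    rw [inv_mul_le_iff₀ hl0] at h2
    nlinarith
  refine le_of_forall_pos_le_add fun ε hε => ?_
  have hK : 0 < 1 + (mu T).real univ * C := by positivity
  have h3 := key (luxNorm T Φ w + ε / (1 + (mu T).real univ * C))
    (by have : 0 < ε / (1 + (mu T).real univ * C) := by positivity
        linarith)
  have e : (1 + (mu T).real univ * C) * (luxNorm T Φ w + ε / (1 + (mu T).real univ * C))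
      = (1 + (mu T).real univ * C) * luxNorm T Φ w + ε := by field_simp
  linarith

/-- Bounded functions embed continuously into the Orlicz space. -/
theorem exists_luxNorm_le_of_bound (T : ℝ) :
    ∃ K : ℝ, 0 < K ∧ ∀ (w : ℝ → E N) (R : ℝ), AEStronglyMeasurable w (mu T) → 0 ≤ R →
      (∀ᵐ t ∂mu T, ‖w t‖ ≤ R) → luxNorm T Φ w ≤ K * R := by
  obtain ⟨C, hC, hbd⟩ := exists_bound_on_ball h.cont 1
  -- Since K ≥ 1, convexity gives Φ(w/(K r)) ≤ K⁻¹ C, and the integral of this constant is at most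
  -- 1.
  set K := 1 + (mu T).real univ * C with hK
  have hK1 : 1 ≤ K := by
    have : 0 ≤ (mu T).real univ * C := by positivity
    linarith
  have hK0 : 0 < K := by linarith
  refine ⟨K, hK0, fun w R hw hR hb => ?_⟩
  have key : ∀ r, R < r → luxNorm T Φ w ≤ K * r := by
    intro r hr
    have hr0 : 0 < r := hR.trans_lt hr
    have hw' := h.memLG_of_bound hw hb
    refine h.luxNorm_le hw' (by positivity) ?_
    have h1 : ∫ t, Φ ((K * r)⁻¹ • w t) ∂mu T ≤ ∫ _, K⁻¹ * C ∂mu T := by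
      refine integral_mono_ae (h.memLG_smul hw' _).2 (integrable_const _) ?_
      filter_upwards [hb] with t ht
      have e : (K * r)⁻¹ • w t = K⁻¹ • (r⁻¹ • w t) := by rw [smul_smul, mul_inv]
      rw [e]
      have hK' : |K⁻¹| = K⁻¹ := abs_of_pos (by positivity)
      refine (h.smul_le (by rw [hK']; exact inv_le_one_of_one_le₀ hK1) _).trans ?_
      rw [hK']
      refine mul_le_mul_of_nonneg_left (hbd _ ?_) (by positivity)
      rw [norm_smul, norm_inv, Real.norm_of_nonneg hr0.le, inv_mul_le_iff₀ hr0]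
      linarith
    refine h1.trans ?_
    rw [integral_const, smul_eq_mul, mul_left_comm, inv_mul_le_iff₀ hK0]
    linarith
  refine le_of_forall_pos_le_add fun ε hε => ?_
  have h3 := key (R + ε / K) (by have : 0 < ε / K := by positivity
                                 linarith)
  have e : K * (R + ε / K) = K * R + ε := by field_simp
  linarith

end YoungFn

end Orlicz

/-! ### Absolutely continuous vector functions -/

/-- Absolute continuity involves only sums of increments. The comparison passes from real primitives
to vector primitives, and from a vector curve to its coordinates, where the real theory applies. -/
theorem ac_of_dist_le {X Y : Type*} [PseudoMetricSpace X] [PseudoMetricSpace Y]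
    {f : ℝ → X} {g : ℝ → Y} {a b : ℝ} (hg : AbsolutelyContinuousOnInterval g a b)
    (h : ∀ x ∈ uIcc a b, ∀ y ∈ uIcc a b, dist (f x) (f y) ≤ dist (g x) (g y)) :
    AbsolutelyContinuousOnInterval f a b := by
  rw [absolutelyContinuousOnInterval_iff] at hg ⊢
  intro ε hε
  obtain ⟨δ, hδ, hh⟩ := hg ε hε
  refine ⟨δ, hδ, fun P hP hs => lt_of_le_of_lt (Finset.sum_le_sum fun i hi => ?_) (hh P hP hs)⟩
  exact h _ (hP.1 i hi).1 _ (hP.1 i hi).2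

theorem ac_coord {N : ℕ} {f : ℝ → E N} {a b : ℝ} (hf : AbsolutelyContinuousOnInterval f a b)
    (i : Fin N) : AbsolutelyContinuousOnInterval (fun t => f t i) a b :=
  ac_of_dist_le hf fun x _ y _ => by
    rw [dist_eq_norm, dist_eq_norm]
    exact PiLp.norm_apply_le (f x - f y) i

theorem ac_intervalIntegral {N : ℕ} {f : ℝ → E N} {a b : ℝ} (hf : IntervalIntegrable f volume a b) :
    AbsolutelyContinuousOnInterval (fun x => ∫ t in a..x, f t) a b := by
  refine ac_of_dist_le (hf.norm.absolutelyContinuousOnInterval_intervalIntegral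
    (left_mem_uIcc (a := a) (b := b))) fun x hx y hy => ?_
  have hsub : ∀ {z}, z ∈ uIcc a b → IntervalIntegrable f volume a z := fun hz =>
    hf.mono_set (uIcc_subset_uIcc_left hz)
  rw [dist_eq_norm, Real.dist_eq, intervalIntegral.integral_interval_sub_left (hsub hx) (hsub hy),
    intervalIntegral.integral_interval_sub_left (hsub hx).norm (hsub hy).norm]
  exact intervalIntegral.norm_integral_le_abs_integral_norm

theorem ac_ae_differentiableAt {N : ℕ} {f : ℝ → E N} {a b : ℝ}
    (hf : AbsolutelyContinuousOnInterval f a b) :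
    ∀ᵐ t, t ∈ uIcc a b → DifferentiableAt ℝ f t := by
  have : ∀ᵐ t, ∀ i, t ∈ uIcc a b → DifferentiableAt ℝ (fun t => f t i) t :=
    ae_all_iff.2 fun i => (ac_coord hf i).ae_differentiableAt
  filter_upwards [this] with t ht htI
  exact differentiableAt_euclidean.2 fun i => ht i htI

/-- An absolutely continuous function whose derivative is a.e. `f'` is a primitive of `f'`. -/
theorem ac_eq_integral {N : ℕ} {f f' : ℝ → E N} {a b : ℝ}
    (hf : AbsolutelyContinuousOnInterval f a b) (hf' : IntervalIntegrable f' volume a b)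
    (hd : ∀ᵐ t, t ∈ uIcc a b → HasDerivAt f (f' t) t) {x : ℝ} (hx : x ∈ uIcc a b) :
    f x = f a + ∫ t in a..x, f' t := by
  have hg : AbsolutelyContinuousOnInterval (fun x => f x - ∫ t in a..x, f' t) a b :=
    hf.sub (ac_intervalIntegral hf')
  obtain ⟨C, hC⟩ := hg.const_of_ae_hasDerivAt_zero (by
    filter_upwards [hd, hf'.ae_hasDerivAt_integral] with t h1 h2 ht
    have := (h1 ht).sub (h2 ht a left_mem_uIcc)
    rwa [sub_self] at this)
  have h1 := hC x hx
  have h2 := hC a left_mem_uIcc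
  simp only [intervalIntegral.integral_same, sub_zero] at h2
  rw [h2, ← h1]; abel

end AnisotropicEL

end
open Set Filter Topology MeasureTheory

noncomputable section

namespace AnisotropicEL

/-! ### The Banach space of velocities and initial values -/

/-! ### Integrals over initial segments of I. -/

section Interval

variable {N : ℕ} {T : ℝ}

theorem ae_mu_iff (hT : 0 ≤ T) {P : ℝ → Prop} :
    (∀ᵐ t ∂mu T, P t) ↔ ∀ᵐ t, t ∈ uIcc (-T) T → P t := by
  rw [ae_restrict_iff' measurableSet_Icc, uIcc_of_le (by linarith)]

theorem ae_mem_I : ∀ᵐ t ∂mu T, t ∈ I T := ae_restrict_mem measurableSet_Icc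

theorem intervalIntegrable_of_integrable (hT : 0 ≤ T) {w : ℝ → E N} (hw : Integrable w (mu T)) :
    IntervalIntegrable w volume (-T) T := by
  rw [intervalIntegrable_iff_integrableOn_Icc_of_le (by linarith)]
  exact hw

theorem intervalIntegrable_sub (hT : 0 ≤ T) {w : ℝ → E N} (hw : Integrable w (mu T)) {t : ℝ}
    (ht : t ∈ I T) : IntervalIntegrable w volume (-T) t :=
  (intervalIntegrable_of_integrable hT hw).mono_set
    (uIcc_subset_uIcc_left (by rwa [uIcc_of_le (by linarith)]))

theorem intervalIntegral_eq (hT : 0 ≤ T) {X : Type*} [NormedAddCommGroup X] [NormedSpace ℝ X]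
    (w : ℝ → X) :
    ∫ t in (-T)..T, w t = ∫ t, w t ∂mu T := by
  rw [intervalIntegral.integral_of_le (by linarith), ← integral_Icc_eq_integral_Ioc]

theorem norm_intervalIntegral_le {w : ℝ → E N} (hw : Integrable w (mu T)) {s t : ℝ}
    (hs : s ∈ I T) (ht : t ∈ I T) :
    ‖∫ r in s..t, w r‖ ≤ ∫ r, ‖w r‖ ∂mu T := by
  refine intervalIntegral.norm_integral_le_integral_norm_uIoc.trans ?_
  refine setIntegral_mono_set hw.norm (Eventually.of_forall fun _ => norm_nonneg _) ?_
  refine LE.le.eventuallyLE ?_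
  exact (uIoc_subset_uIcc).trans (uIcc_subset_Icc hs ht)

theorem intervalIntegral_congr_mu {w z : ℝ → E N} (h : w =ᵐ[mu T] z) {t : ℝ}
    (ht : t ∈ I T) : ∫ r in (-T)..t, w r = ∫ r in (-T)..t, z r := by
  rw [intervalIntegral.integral_of_le ht.1, intervalIntegral.integral_of_le ht.1]
  refine integral_congr_ae (ae_restrict_of_ae_restrict_of_subset ?_ h)
  exact fun r hr => ⟨hr.1.le, hr.2.trans ht.2⟩

end Interval

variable {N : ℕ} {T : ℝ} {G : E N → ℝ}

/-- Pairs of an initial value and a velocity of mean zero in the Orlicz class. -/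
def velocitySubmodule (T : ℝ) {G : E N → ℝ} (hG : IsGFunction G) :
    Submodule ℝ (E N × Lp (E N) 1 (mu T)) where
  carrier := {z | MemLG T G z.2 ∧ ∫ t, z.2 t ∂mu T = 0}
  zero_mem' := by
    have h : ((0 : E N × Lp (E N) 1 (mu T)).2 : ℝ → E N) =ᵐ[mu T] fun _ => 0 :=
      Lp.coeFn_zero _ _ _
    exact ⟨hG.young.memLG_zero.congr h.symm, by rw [integral_congr_ae h]; simp⟩
  add_mem' := by
    rintro a b ⟨ha, ha'⟩ ⟨hb, hb'⟩
    have h : ((a + b).2 : ℝ → E N) =ᵐ[mu T] fun t => a.2 t + b.2 t := Lp.coeFn_add _ _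
    refine ⟨(hG.young.memLG_add ha hb).congr h.symm, ?_⟩
    rw [integral_congr_ae h, integral_add (hG.young.integrable ha) (hG.young.integrable hb), ha',
      hb', add_zero]
  smul_mem' := by
    rintro c a ⟨ha, ha'⟩
    have h : ((c • a).2 : ℝ → E N) =ᵐ[mu T] fun t => c • a.2 t := Lp.coeFn_smul _ _
    refine ⟨(hG.young.memLG_smul ha c).congr h.symm, ?_⟩
    rw [integral_congr_ae h, integral_smul, ha', smul_zero]

/-- The model of `W¹_T L^G` as a Banach space: initial values and velocities. -/
def Sob (T : ℝ) {G : E N → ℝ} (hG : IsGFunction G) : Type := velocitySubmodule T hG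

namespace Sob

variable {hG : IsGFunction G}

instance : AddCommGroup (Sob T hG) := inferInstanceAs (AddCommGroup (velocitySubmodule T hG))

instance : Module ℝ (Sob T hG) := inferInstanceAs (Module ℝ (velocitySubmodule T hG))

/-- The value at the left end point. -/
def base (z : Sob T hG) : E N := z.1.1

/-- The velocity, an `L¹` function on `I`. -/
def vel (z : Sob T hG) : ℝ → E N := z.1.2

/-- The curve with given initial value and velocity. -/
def pos (z : Sob T hG) (t : ℝ) : E N := z.base + ∫ r in (-T)..t, z.vel r

theorem memLG_vel (z : Sob T hG) : MemLG T G z.vel := z.2.1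

theorem integral_vel (z : Sob T hG) : ∫ t, z.vel t ∂mu T = 0 := z.2.2

theorem integrable_vel (z : Sob T hG) : Integrable z.vel (mu T) := hG.young.integrable z.memLG_vel

theorem vel_add (y z : Sob T hG) : (y + z).vel =ᵐ[mu T] fun t => y.vel t + z.vel t :=
  Lp.coeFn_add y.1.2 z.1.2

theorem vel_sub (y z : Sob T hG) : (y - z).vel =ᵐ[mu T] fun t => y.vel t - z.vel t :=
  Lp.coeFn_sub y.1.2 z.1.2

theorem vel_smul (c : ℝ) (z : Sob T hG) : (c • z).vel =ᵐ[mu T] fun t => c • z.vel t :=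
  Lp.coeFn_smul c z.1.2

theorem vel_zero : (0 : Sob T hG).vel =ᵐ[mu T] fun _ => 0 := Lp.coeFn_zero _ _ _

theorem base_add (y z : Sob T hG) : (y + z).base = y.base + z.base := rfl

theorem base_sub (y z : Sob T hG) : (y - z).base = y.base - z.base := rfl

theorem base_smul (c : ℝ) (z : Sob T hG) : (c • z).base = c • z.base := rfl

theorem base_zero : (0 : Sob T hG).base = 0 := rfl

theorem ext_ae {y z : Sob T hG} (hb : y.base = z.base) (hv : y.vel =ᵐ[mu T] z.vel) : y = z :=
  Subtype.ext (Prod.ext hb (Lp.ext hv))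

/-- Build an element from a velocity given a.e. -/
def mk (x : E N) (w : ℝ → E N) (hw : MemLG T G w) (h0 : ∫ t, w t ∂mu T = 0) : Sob T hG :=
  ⟨(x, (hG.young.integrable hw).toL1 w), by
    have h := (Integrable.coeFn_toL1 (hG.young.integrable hw)).symm
    exact ⟨hw.congr h, by rw [← h0]; exact (integral_congr_ae h).symm⟩⟩

theorem base_mk (x : E N) (w : ℝ → E N) (hw : MemLG T G w) (h0 : ∫ t, w t ∂mu T = 0) :
    (mk x w hw h0 : Sob T hG).base = x := rfl

theorem vel_mk (x : E N) (w : ℝ → E N) (hw : MemLG T G w) (h0 : ∫ t, w t ∂mu T = 0) :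
    (mk x w hw h0 : Sob T hG).vel =ᵐ[mu T] w :=
  Integrable.coeFn_toL1 (hG.young.integrable hw)

instance : Norm (Sob T hG) := ⟨fun z => ‖z.base‖ + luxNorm T G z.vel⟩

theorem norm_def (z : Sob T hG) : ‖z‖ = ‖z.base‖ + luxNorm T G z.vel := rfl

theorem norm_base_le (z : Sob T hG) : ‖z.base‖ ≤ ‖z‖ := by
  rw [norm_def]; linarith [luxNorm_nonneg (T := T) (Φ := G) z.vel]

theorem luxNorm_vel_le (z : Sob T hG) : luxNorm T G z.vel ≤ ‖z‖ := by
  rw [norm_def]; linarith [norm_nonneg z.base]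

/-- Definiteness comes from the embedding into L¹: a velocity of Luxemburg norm zero vanishes a.e.
-/
theorem core : NormedSpace.Core ℝ (Sob T hG) where
  norm_nonneg z := add_nonneg (norm_nonneg _) (luxNorm_nonneg _)
  norm_smul c z := by
    rw [norm_def, norm_def, base_smul, norm_smul, luxNorm_congr (vel_smul c z),
      hG.young.luxNorm_smul z.memLG_vel, Real.norm_eq_abs]
    ring
  norm_triangle y z := by
    rw [norm_def, norm_def, norm_def, base_add, luxNorm_congr (vel_add y z)]
    linarith [norm_add_le y.base z.base, hG.young.luxNorm_add_le y.memLG_vel z.memLG_vel]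
  norm_eq_zero_iff z := by
    constructor
    · intro h
      rw [norm_def] at h
      have h1 := norm_nonneg z.base
      have h2 := luxNorm_nonneg (T := T) (Φ := G) z.vel
      obtain ⟨K, hK, hle⟩ := hG.young.exists_integral_norm_le T
      have h3 := hle _ z.memLG_vel
      have h4 : luxNorm T G z.vel = 0 := by linarith
      rw [h4, mul_zero] at h3
      have h5 : ∫ t, ‖z.vel t‖ ∂mu T = 0 :=
        le_antisymm h3 (integral_nonneg fun _ => norm_nonneg _)
      rw [integral_eq_zero_iff_of_nonneg (fun _ => norm_nonneg _) z.integrable_vel.norm] at h5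
      refine ext_ae (norm_eq_zero.1 (by linarith)) ?_
      filter_upwards [h5, vel_zero (T := T) (hG := hG)] with t ht ht'
      rw [ht']
      exact norm_eq_zero.1 ht
    · rintro rfl
      rw [norm_def, luxNorm_congr vel_zero, hG.young.luxNorm_zero, base_zero, norm_zero, add_zero]

instance : NormedAddCommGroup (Sob T hG) := NormedAddCommGroup.ofCore core

instance : NormedSpace ℝ (Sob T hG) := NormedSpace.ofCore core

theorem pos_left (z : Sob T hG) : z.pos (-T) = z.base := by simp [pos]

theorem pos_right (hT : 0 ≤ T) (z : Sob T hG) : z.pos T = z.base := by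
  rw [pos, intervalIntegral_eq hT, integral_vel, add_zero]

theorem pos_add (hT : 0 ≤ T) (y z : Sob T hG) {t : ℝ} (ht : t ∈ I T) :
    (y + z).pos t = y.pos t + z.pos t := by
  rw [pos, pos, pos, intervalIntegral_congr_mu (vel_add y z) ht,
    intervalIntegral.integral_add (intervalIntegrable_sub hT y.integrable_vel ht)
      (intervalIntegrable_sub hT z.integrable_vel ht), base_add]
  abel

theorem pos_smul (c : ℝ) (z : Sob T hG) {t : ℝ} (ht : t ∈ I T) :
    (c • z).pos t = c • z.pos t := by
  rw [pos, pos, intervalIntegral_congr_mu (vel_smul c z) ht, intervalIntegral.integral_smul,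
    base_smul, smul_add]

theorem pos_sub (hT : 0 ≤ T) (y z : Sob T hG) {t : ℝ} (ht : t ∈ I T) :
    (y - z).pos t = y.pos t - z.pos t := by
  have h := pos_add hT (y - z) z ht
  rw [sub_add_cancel] at h
  rw [h, add_sub_cancel_right]

theorem pos_zero {t : ℝ} (ht : t ∈ I T) : (0 : Sob T hG).pos t = 0 := by
  rw [pos, intervalIntegral_congr_mu vel_zero ht, base_zero]; simp

theorem ac_pos (hT : 0 ≤ T) (z : Sob T hG) : AbsolutelyContinuousOnInterval z.pos (-T) T :=
  ac_of_dist_le (ac_intervalIntegral (intervalIntegrable_of_integrable hT z.integrable_vel))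
    fun x _ y _ => by simp [pos]

theorem continuousOn_pos (hT : 0 ≤ T) (z : Sob T hG) : ContinuousOn z.pos (I T) := by
  have := (ac_pos hT z).continuousOn
  rwa [uIcc_of_le (by linarith)] at this

theorem aestronglyMeasurable_pos (hT : 0 ≤ T) (z : Sob T hG) :
    AEStronglyMeasurable z.pos (mu T) :=
  (continuousOn_pos hT z).aestronglyMeasurable measurableSet_Icc

theorem hasDerivAt_pos (hT : 0 ≤ T) (z : Sob T hG) :
    ∀ᵐ t ∂mu T, HasDerivAt z.pos (z.vel t) t := by
  rw [ae_mu_iff hT]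
  filter_upwards [(intervalIntegrable_of_integrable hT z.integrable_vel).ae_hasDerivAt_integral]
    with t ht htI
  exact (ht htI _ left_mem_uIcc).const_add z.base

theorem deriv_pos (hT : 0 ≤ T) (z : Sob T hG) : deriv z.pos =ᵐ[mu T] z.vel := by
  filter_upwards [hasDerivAt_pos hT z] with t ht using ht.deriv

theorem norm_pos_le_of_integral {T : ℝ} {hG : IsGFunction G} (z : Sob T hG) {t : ℝ} (ht : t ∈ I T) :
    ‖z.pos t‖ ≤ ‖z.base‖ + ∫ r, ‖z.vel r‖ ∂mu T := by
  have hl : (-T) ∈ I T := ⟨le_rfl, ht.1.trans ht.2⟩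
  exact (norm_add_le _ _).trans
    (add_le_add_right (norm_intervalIntegral_le z.integrable_vel hl ht) _)

theorem exists_norm_pos_le (T : ℝ) (hG : IsGFunction G) :
    ∃ K : ℝ, 0 < K ∧ ∀ (z : Sob T hG), ∀ t ∈ I T, ‖z.pos t‖ ≤ K * ‖z‖ := by
  obtain ⟨K, hK, h⟩ := hG.young.exists_integral_norm_le T
  refine ⟨1 + K, by linarith, fun z t ht => ?_⟩
  have h1 := norm_pos_le_of_integral z ht
  have h2 := h _ z.memLG_vel
  have h3 := norm_base_le z
  have h4 := mul_le_mul_of_nonneg_left (luxNorm_vel_le z) hK.le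
  linarith

theorem memLG_pos (hT : 0 ≤ T) (z : Sob T hG) : MemLG T G z.pos := by
  obtain ⟨K, hK, h⟩ := exists_norm_pos_le T hG
  exact hG.young.memLG_of_bound (aestronglyMeasurable_pos hT z)
    (ae_mem_I.mono fun t ht => h z t ht)

theorem pos_mem_WT (hT : 0 ≤ T) (z : Sob T hG) : z.pos ∈ WT T G :=
  ⟨ac_pos hT z, memLG_pos hT z, z.memLG_vel.congr (deriv_pos hT z).symm, by
    rw [pos_left, pos_right hT]⟩

end Sob

/-! ### Comparison with the space `WT` -/

theorem hasDerivAt_of_mem_WT (hT : 0 ≤ T) {u : ℝ → E N} (hu : u ∈ WT T G) :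
    ∀ᵐ t ∂mu T, HasDerivAt u (deriv u t) t := by
  rw [ae_mu_iff hT]
  filter_upwards [ac_ae_differentiableAt hu.1] with t ht htI using (ht htI).hasDerivAt

theorem eq_integral_of_mem_WT (hT : 0 ≤ T) (hG : IsGFunction G) {u : ℝ → E N} (hu : u ∈ WT T G)
    {t : ℝ} (ht : t ∈ I T) : u t = u (-T) + ∫ r in (-T)..t, deriv u r :=
  ac_eq_integral hu.1
    (intervalIntegrable_of_integrable hT (hG.young.integrable hu.2.2.1))
    ((ae_mu_iff hT).1 (hasDerivAt_of_mem_WT hT hu)) (by rwa [uIcc_of_le (by linarith)])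

theorem integral_deriv_of_mem_WT (hT : 0 ≤ T) (hG : IsGFunction G) {u : ℝ → E N}
    (hu : u ∈ WT T G) : ∫ t, deriv u t ∂mu T = 0 := by
  have h := eq_integral_of_mem_WT hT hG hu (t := T) ⟨by linarith, le_rfl⟩
  rw [intervalIntegral_eq hT, ← hu.2.2.2] at h
  simpa using h

/-- The element of the model space given by a curve. -/
def toSob (hT : 0 ≤ T) (hG : IsGFunction G) {u : ℝ → E N} (hu : u ∈ WT T G) : Sob T hG :=
  Sob.mk (u (-T)) (deriv u) hu.2.2.1 (integral_deriv_of_mem_WT hT hG hu)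

theorem vel_toSob (hT : 0 ≤ T) (hG : IsGFunction G) {u : ℝ → E N} (hu : u ∈ WT T G) :
    (toSob hT hG hu).vel =ᵐ[mu T] deriv u := Sob.vel_mk _ _ _ _

theorem pos_toSob (hT : 0 ≤ T) (hG : IsGFunction G) {u : ℝ → E N} (hu : u ∈ WT T G) {t : ℝ}
    (ht : t ∈ I T) : (toSob hT hG hu).pos t = u t := by
  rw [Sob.pos, intervalIntegral_congr_mu (vel_toSob hT hG hu) ht, eq_integral_of_mem_WT hT hG hu ht]
  rfl

theorem toSob_eq (hT : 0 ≤ T) (hG : IsGFunction G) {u : ℝ → E N} (hu : u ∈ WT T G)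
    {z : Sob T hG} (h : EqOn u z.pos (I T)) : toSob hT hG hu = z := by
  have hl : (-T) ∈ I T := ⟨le_rfl, by linarith⟩
  refine Sob.ext_ae ?_ ?_
  · rw [← Sob.pos_left, pos_toSob hT hG hu hl, h hl, Sob.pos_left]
  -- The curves agree on I only, so `deriv` can be compared only at interior points; the two end
  -- points are negligible.
  · have hIoo : ∀ᵐ t ∂mu T, t ∈ Ioo (-T) T := by
      rw [mu, I, ← restrict_Ioo_eq_restrict_Icc]
      exact ae_restrict_mem measurableSet_Ioo
    filter_upwards [vel_toSob hT hG hu, Sob.deriv_pos hT z, hIoo] with t h1 h2 h3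
    rw [h1, ← h2]
    refine Filter.EventuallyEq.deriv_eq ?_
    filter_upwards [Ioo_mem_nhds h3.1 h3.2] with s hs using h (Ioo_subset_Icc_self hs)

theorem toSob_pos (hT : 0 ≤ T) (z : Sob T hG) :
    toSob hT hG (Sob.pos_mem_WT hT z) = z := toSob_eq hT hG _ fun _ _ => rfl

theorem WT_add (hT : 0 ≤ T) (hG : IsGFunction G) {u v : ℝ → E N} (hu : u ∈ WT T G)
    (hv : v ∈ WT T G) : u + v ∈ WT T G ∧ deriv (u + v) =ᵐ[mu T] fun t => deriv u t + deriv v t := by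
  have hd : deriv (u + v) =ᵐ[mu T] fun t => deriv u t + deriv v t := by
    filter_upwards [hasDerivAt_of_mem_WT hT hu, hasDerivAt_of_mem_WT hT hv] with t h1 h2
    exact (h1.add h2).deriv
  refine ⟨⟨hu.1.add hv.1, hG.young.memLG_add hu.2.1 hv.2.1,
    (hG.young.memLG_add hu.2.2.1 hv.2.2.1).congr hd.symm, ?_⟩, hd⟩
  simp [hu.2.2.2, hv.2.2.2]

theorem WT_sub (hT : 0 ≤ T) (hG : IsGFunction G) {u v : ℝ → E N} (hu : u ∈ WT T G)
    (hv : v ∈ WT T G) : u - v ∈ WT T G ∧ deriv (u - v) =ᵐ[mu T] fun t => deriv u t - deriv v t := by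
  have hd : deriv (u - v) =ᵐ[mu T] fun t => deriv u t - deriv v t := by
    filter_upwards [hasDerivAt_of_mem_WT hT hu, hasDerivAt_of_mem_WT hT hv] with t h1 h2
    exact (h1.sub h2).deriv
  refine ⟨⟨hu.1.sub hv.1, hG.young.memLG_sub hu.2.1 hv.2.1,
    (hG.young.memLG_sub hu.2.2.1 hv.2.2.1).congr hd.symm, ?_⟩, hd⟩
  simp [hu.2.2.2, hv.2.2.2]

theorem toSob_add (hT : 0 ≤ T) (hG : IsGFunction G) {u v : ℝ → E N} (hu : u ∈ WT T G)
    (hv : v ∈ WT T G) (huv : u + v ∈ WT T G) :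
    toSob hT hG huv = toSob hT hG hu + toSob hT hG hv :=
  toSob_eq hT hG _ fun t ht => by
    rw [Sob.pos_add hT _ _ ht, pos_toSob hT hG hu ht, pos_toSob hT hG hv ht]; rfl

theorem toSob_sub (hT : 0 ≤ T) (hG : IsGFunction G) {u v : ℝ → E N} (hu : u ∈ WT T G)
    (hv : v ∈ WT T G) (huv : u - v ∈ WT T G) :
    toSob hT hG huv = toSob hT hG hu - toSob hT hG hv :=
  toSob_eq hT hG _ fun t ht => by
    rw [Sob.pos_sub hT _ _ ht, pos_toSob hT hG hu ht, pos_toSob hT hG hv ht]; rfl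

/-- The Orlicz-Sobolev norm is equivalent to the norm of the model space. -/
theorem exists_sobNorm_le (hT : 0 ≤ T) (hG : IsGFunction G) :
    ∃ K : ℝ, 0 < K ∧ ∀ (u : ℝ → E N) (hu : u ∈ WT T G), sobNorm T G u ≤ K * ‖toSob hT hG hu‖ := by
  obtain ⟨K₁, hK₁, h₁⟩ := Sob.exists_norm_pos_le T hG
  obtain ⟨K₂, hK₂, h₂⟩ := hG.young.exists_luxNorm_le_of_bound T
  refine ⟨K₂ * K₁ + 1, by positivity, fun u hu => ?_⟩
  have h3 : luxNorm T G u ≤ K₂ * (K₁ * ‖toSob hT hG hu‖) := by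
    refine h₂ u _ hu.2.1.1 (by positivity) (ae_mem_I.mono fun t ht => ?_)
    rw [← pos_toSob hT hG hu ht]
    exact h₁ _ t ht
  have h4 := Sob.luxNorm_vel_le (toSob hT hG hu)
  rw [luxNorm_congr (vel_toSob hT hG hu)] at h4
  rw [sobNorm]
  linarith

/-- The initial value equals u(t) minus an integral of u'. Averaging over t bounds it by the L¹
norms of u and u', hence by their Luxemburg norms. -/
theorem exists_norm_toSob_le (hT : 0 < T) (hG : IsGFunction G) :
    ∃ K : ℝ, 0 < K ∧ ∀ (u : ℝ → E N) (hu : u ∈ WT T G),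
      ‖toSob hT.le hG hu‖ ≤ K * sobNorm T G u := by
  obtain ⟨K, hK, h⟩ := hG.young.exists_integral_norm_le T
  refine ⟨K / (2 * T) + K + 1, by positivity, fun u hu => ?_⟩
  set z := toSob hT.le hG hu with hz
  have hu1 := h u hu.2.1
  have hu2 := h _ z.memLG_vel
  have hlux : luxNorm T G z.vel = luxNorm T G (deriv u) := luxNorm_congr (vel_toSob hT.le hG hu)
  have hb : ∀ t ∈ I T, ‖z.base‖ ≤ ‖u t‖ + ∫ r, ‖z.vel r‖ ∂mu T := by
    intro t ht
    have hl : (-T) ∈ I T := ⟨le_rfl, by linarith⟩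
    have e : z.base = u t - ∫ r in (-T)..t, z.vel r := by
      rw [← pos_toSob hT.le hG hu ht, Sob.pos]; abel
    rw [e]
    exact (norm_sub_le _ _).trans
      (add_le_add_right (norm_intervalIntegral_le z.integrable_vel hl ht) _)
  have h3 : ∫ _, ‖z.base‖ ∂mu T ≤ ∫ t, (‖u t‖ + ∫ r, ‖z.vel r‖ ∂mu T) ∂mu T :=
    integral_mono_ae (integrable_const _)
      ((hG.young.integrable hu.2.1).norm.add (integrable_const _)) (ae_mem_I.mono hb)
  rw [integral_add (hG.young.integrable hu.2.1).norm (integrable_const _), integral_const,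
    integral_const, mu_real_univ hT.le, smul_eq_mul, smul_eq_mul] at h3
  have h4 : ‖z.base‖ ≤ K / (2 * T) * luxNorm T G u + K * luxNorm T G (deriv u) := by
    rw [hlux] at hu2
    have h2T : 0 < 2 * T := by positivity
    have h5 := mul_le_mul_of_nonneg_left hu2 h2T.le
    refine le_of_mul_le_mul_left ?_ h2T
    have e : 2 * T * (K / (2 * T) * luxNorm T G u + K * luxNorm T G (deriv u))
      = K * luxNorm T G u + 2 * T * (K * luxNorm T G (deriv u)) := by field_simp
    linarith
  rw [Sob.norm_def, hlux, sobNorm]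
  have h6 := luxNorm_nonneg (T := T) (Φ := G) u
  have h7 := luxNorm_nonneg (T := T) (Φ := G) (deriv u)
  have h8 : 0 ≤ K / (2 * T) * luxNorm T G (deriv u) := by positivity
  have h9 : 0 ≤ K * luxNorm T G u := by positivity
  linarith

end AnisotropicEL

end
open Set Filter Topology MeasureTheory

noncomputable section

namespace AnisotropicEL

variable {N : ℕ} {T : ℝ} {G : E N → ℝ}

/-! ### Completeness, Hölder's inequality and dominated subsequences -/

/-- Fatou's lemma for modulars. -/
theorem YoungFn.lintegral_le_of_tendsto {Φ : E N → ℝ} (h : YoungFn Φ) {w : ℕ → ℝ → E N}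
    {w₀ : ℝ → E N} (hw : ∀ n, AEStronglyMeasurable (w n) (mu T))
    (hlim : ∀ᵐ t ∂mu T, Tendsto (fun n => w n t) atTop (𝓝 (w₀ t))) {C : ENNReal}
    (hC : ∀ n, ∫⁻ t, ENNReal.ofReal (Φ (w n t)) ∂mu T ≤ C) :
    ∫⁻ t, ENNReal.ofReal (Φ (w₀ t)) ∂mu T ≤ C := by
  have h1 : ∫⁻ t, ENNReal.ofReal (Φ (w₀ t)) ∂mu T
      = ∫⁻ t, liminf (fun n => ENNReal.ofReal (Φ (w n t))) atTop ∂mu T := by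
    refine lintegral_congr_ae ?_
    filter_upwards [hlim] with t ht
    exact ((ENNReal.continuous_ofReal.tendsto _).comp ((h.cont.tendsto _).comp ht)).liminf_eq.symm
  rw [h1]
  refine (lintegral_liminf_le' fun n =>
    (h.comp_aestronglyMeasurable (hw n)).aemeasurable.ennreal_ofReal).trans ?_
  exact (liminf_le_liminf (Eventually.of_forall hC)).trans (by simp)

theorem YoungFn.memLG_of_lintegral {Φ : E N → ℝ} (h : YoungFn Φ) {w : ℝ → E N}
    (hw : AEStronglyMeasurable w (mu T))
    (hfin : ∫⁻ t, ENNReal.ofReal (Φ (w t)) ∂mu T ≠ ⊤) : MemLG T Φ w := by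
  refine ⟨hw, h.comp_aestronglyMeasurable hw, ?_⟩
  rw [hasFiniteIntegral_iff_ofReal (Eventually.of_forall fun t => h.nonneg _)]
  exact hfin.lt_top

namespace Sob

variable {hG : IsGFunction G}

/-- The velocity as an element of `L¹`. -/
def velL (z : Sob T hG) : Lp (E N) 1 (mu T) := z.1.2

theorem velL_sub (y z : Sob T hG) : (y - z).velL = y.velL - z.velL := rfl

theorem coe_velL (z : Sob T hG) : (z.velL : ℝ → E N) = z.vel := rfl

theorem exists_norm_velL_le (T : ℝ) (hG : IsGFunction G) :
    ∃ K : ℝ, 0 < K ∧ ∀ z : Sob T hG, ‖z.velL‖ ≤ K * ‖z‖ := by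
  obtain ⟨K, hK, h⟩ := hG.young.exists_integral_norm_le T
  refine ⟨K, hK, fun z => ?_⟩
  rw [L1.norm_eq_integral_norm]
  exact (h _ z.memLG_vel).trans (mul_le_mul_of_nonneg_left (luxNorm_vel_le z) hK.le)

/-- If velocities converge in `L¹`, modular bounds pass to the limit. -/
theorem lintegral_le_of_tendsto_velL {z : ℕ → Sob T hG} {w : Lp (E N) 1 (mu T)}
    (hz : Tendsto (fun n => (z n).velL) atTop (𝓝 w)) {c : ℝ} {C : ENNReal}
    (hC : ∀ᶠ n in atTop, ∫⁻ t, ENNReal.ofReal (G (c • (z n).vel t)) ∂mu T ≤ C) :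
    ∫⁻ t, ENNReal.ofReal (G (c • w t)) ∂mu T ≤ C := by
  obtain ⟨n₀, hn₀⟩ := eventually_atTop.1 hC
  have hz' : Tendsto (fun n => (z (n + n₀)).velL) atTop (𝓝 w) :=
    hz.comp (tendsto_add_atTop_nat n₀)
  obtain ⟨ns, -, hns⟩ := (tendstoInMeasure_of_tendsto_Lp hz').exists_seq_tendsto_ae
  refine hG.young.lintegral_le_of_tendsto (w := fun i t => c • (z (ns i + n₀)).vel t)
    (fun i => (z _).memLG_vel.1.const_smul c) ?_ fun i => hn₀ _ (Nat.le_add_left _ _)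
  filter_upwards [hns] with t ht
  exact ht.const_smul c

/-- Cauchy sequences converge in ℝ^N × L¹. Fatou's lemma for the differences z m − z n as n → ∞ puts
the limit velocity into the Orlicz class and upgrades the convergence to the Luxemburg norm. -/
instance : CompleteSpace (Sob T hG) := by
  refine Metric.complete_of_cauchySeq_tendsto fun z hz => ?_
  obtain ⟨K, hK, hKle⟩ := exists_norm_velL_le T hG
  have lb : LipschitzWith 1 (base : Sob T hG → E N) := LipschitzWith.of_dist_le_mul fun y z => by
    rw [dist_eq_norm, dist_eq_norm, NNReal.coe_one, one_mul]
    exact norm_base_le (y - z)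
  have lv : LipschitzWith ⟨K, hK.le⟩ (velL : Sob T hG → Lp (E N) 1 (mu T)) :=
    LipschitzWith.of_dist_le_mul fun y z => by
      rw [dist_eq_norm, dist_eq_norm]
      exact hKle (y - z)
  have hb : CauchySeq fun n => (z n).base := lb.cauchySeq_comp hz
  have hv : CauchySeq fun n => (z n).velL := lv.cauchySeq_comp hz
  obtain ⟨x, hx⟩ := cauchySeq_tendsto_of_complete hb
  obtain ⟨w, hw⟩ := cauchySeq_tendsto_of_complete hv
  have key : ∀ ε > (0 : ℝ), ∃ n₀, ∀ m ≥ n₀,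
      ∫⁻ t, ENNReal.ofReal (G (ε⁻¹ • ((z m).velL - w) t)) ∂mu T ≤ 1 := by
    intro ε hε
    obtain ⟨n₀, hn₀⟩ := Metric.cauchySeq_iff.1 hz ε hε
    refine ⟨n₀, fun m hm => ?_⟩
    refine lintegral_le_of_tendsto_velL (z := fun n => z m - z n) ?_ ?_
    · simp only [velL_sub]; exact tendsto_const_nhds.sub hw
    · filter_upwards [eventually_ge_atTop n₀] with n hn
      rw [hG.young.lintegral_le_one_iff (memLG_vel _)]
      refine hG.young.modular_le_of_luxNorm_lt (memLG_vel _) ?_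
      have := hn₀ m hm n hn
      rw [dist_eq_norm] at this
      exact (luxNorm_vel_le _).trans_lt this
  have hmemsub : ∀ ε > (0 : ℝ), ∃ n₀, ∀ m ≥ n₀, MemLG T G ((z m).velL - w : Lp (E N) 1 (mu T)) ∧
      luxNorm T G ((z m).velL - w : Lp (E N) 1 (mu T)) ≤ ε := by
    intro ε hε
    obtain ⟨n₀, hn₀⟩ := key ε hε
    refine ⟨n₀, fun m hm => ?_⟩
    have h1 := hn₀ m hm
    have h2 : MemLG T G (fun t => ε⁻¹ • ((z m).velL - w : Lp (E N) 1 (mu T)) t) :=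
      hG.young.memLG_of_lintegral ((Lp.aestronglyMeasurable ((z m).velL - w)).const_smul ε⁻¹)
        (ne_top_of_le_ne_top ENNReal.one_ne_top h1)
    have h3 := hG.young.memLG_smul h2 ε
    simp only [smul_smul, mul_inv_cancel₀ hε.ne', one_smul] at h3
    exact ⟨h3, hG.young.luxNorm_le h3 hε ((hG.young.lintegral_le_one_iff h3 ε).1 h1)⟩
  have hcoe : ∀ m, ((z m).velL - w : Lp (E N) 1 (mu T)) =ᵐ[mu T] fun t => (z m).vel t - w t :=
    fun m => Lp.coeFn_sub _ _
  have hwmem : MemLG T G w := by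
    obtain ⟨n₀, hn₀⟩ := hmemsub 1 one_pos
    have h1 := (hn₀ n₀ le_rfl).1.congr (hcoe n₀)
    simpa using hG.young.memLG_sub (z n₀).memLG_vel h1
  have hwint : ∫ t, w t ∂mu T = 0 := by
    have h1 : Tendsto (fun n => ∫ t, (z n).velL t ∂mu T) atTop (𝓝 (∫ t, w t ∂mu T)) :=
      (continuous_integral.tendsto w).comp hw
    have h2 : (fun n => ∫ t, (z n).velL t ∂mu T) = fun _ => 0 := funext fun n => (z n).integral_vel
    rw [h2] at h1
    exact tendsto_nhds_unique h1 tendsto_const_nhds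
  obtain ⟨z₀, hz₀b, hz₀v⟩ : ∃ z₀ : Sob T hG, z₀.base = x ∧ z₀.velL = w :=
    ⟨⟨(x, w), hwmem, hwint⟩, rfl, rfl⟩
  refine ⟨z₀, ?_⟩
  rw [Metric.tendsto_atTop]
  intro ε hε
  obtain ⟨n₁, hn₁⟩ := hmemsub (ε / 3) (by positivity)
  obtain ⟨n₂, hn₂⟩ := Metric.tendsto_atTop.1 hx (ε / 3) (by positivity)
  refine ⟨max n₁ n₂, fun n hn => ?_⟩
  have h1 := (hn₁ n ((le_max_left _ _).trans hn)).2
  have h2 := hn₂ n ((le_max_right _ _).trans hn)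
  rw [dist_eq_norm] at h2
  rw [dist_eq_norm, norm_def]
  rw [← hz₀v, ← velL_sub, coe_velL] at h1
  rw [← hz₀b, ← base_sub] at h2
  linarith

end Sob

/-- A scaled Hölder inequality in Orlicz spaces. -/
theorem holder (hG : IsGFunction G) {ψ w : ℝ → E N} (hψ : MemLG T (conj G) ψ) (hw : MemLG T G w)
    {δ : ℝ} (hδ : 0 < δ) :
    ∫ t, |inner ℝ (ψ t) (w t)| ∂mu T ≤ δ * ((∫ t, conj G (δ⁻¹ • ψ t) ∂mu T) + 1) * luxNorm T G w := by
  set A := δ * ((∫ t, conj G (δ⁻¹ • ψ t) ∂mu T) + 1) with hA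
  have hc0 : 0 ≤ ∫ t, conj G (δ⁻¹ • ψ t) ∂mu T := integral_nonneg fun _ => hG.conj_nonneg _
  have hA0 : 0 < A := by positivity
  have key : ∀ l, luxNorm T G w < l → ∫ t, |inner ℝ (ψ t) (w t)| ∂mu T ≤ A * l := by
    intro l hl
    have hl0 : 0 < l := (luxNorm_nonneg _).trans_lt hl
    have h1 := hG.young.modular_le_of_luxNorm_lt hw hl
    have i1 := (hG.conj_young.memLG_smul hψ δ⁻¹).2
    have i2 := (hG.young.memLG_smul hw l⁻¹).2
    -- Fenchel–Young for δ⁻¹ψ and l⁻¹w, multiplied back by δ l.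
    have h2 : ∫ t, |inner ℝ (ψ t) (w t)| ∂mu T
        ≤ ∫ t, (δ * l) * (conj G (δ⁻¹ • ψ t) + G (l⁻¹ • w t)) ∂mu T := by
      refine integral_mono_of_nonneg (Eventually.of_forall fun _ => abs_nonneg _)
        ((Integrable.add i1 i2).const_mul _) (Eventually.of_forall fun t => ?_)
      have h3 := hG.abs_inner_le (l⁻¹ • w t) (δ⁻¹ • ψ t)
      rw [inner_smul_left, inner_smul_right, conj_trivial, abs_mul, abs_mul,
        abs_of_pos (inv_pos.2 hδ), abs_of_pos (inv_pos.2 hl0)] at h3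
      have h4 := mul_le_mul_of_nonneg_left h3 (by positivity : 0 ≤ δ * l)
      have e : δ * l * (δ⁻¹ * (l⁻¹ * |inner ℝ (ψ t) (w t)|)) = |inner ℝ (ψ t) (w t)| := by
        field_simp
      rw [e] at h4
      exact h4
    rw [integral_const_mul, integral_add i1 i2] at h2
    refine h2.trans ?_
    have : δ * l * ((∫ t, conj G (δ⁻¹ • ψ t) ∂mu T) + ∫ t, G (l⁻¹ • w t) ∂mu T)
        ≤ δ * l * ((∫ t, conj G (δ⁻¹ • ψ t) ∂mu T) + 1) :=
      mul_le_mul_of_nonneg_left (by linarith) (by positivity)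
    rw [hA]; linarith
  refine le_of_forall_pos_le_add fun ε hε => ?_
  have h3 := key (luxNorm T G w + ε / A) (by have : 0 < ε / A := by positivity
                                             linarith)
  have e : A * (luxNorm T G w + ε / A) = A * luxNorm T G w + ε := by field_simp
  linarith

theorem integrable_inner (hG : IsGFunction G) {ψ w : ℝ → E N} (hψ : MemLG T (conj G) ψ)
    (hw : MemLG T G w) : Integrable (fun t => inner ℝ (ψ t) (w t)) (mu T) :=
  Integrable.mono' (Integrable.add hψ.2 hw.2) (hψ.1.inner hw.1)
    (Eventually.of_forall fun _ => hG.abs_inner_le _ _)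

/-- Sequences tending to zero in `L¹` have dominated a.e. convergent subsequences. -/
theorem exists_dominated_subseq {a : ℕ → ℝ → ℝ} (ha : ∀ n t, 0 ≤ a n t)
    (hi : ∀ n, Integrable (a n) (mu T))
    (hlim : Tendsto (fun n => ∫ t, a n t ∂mu T) atTop (𝓝 0)) :
    ∃ ns : ℕ → ℕ, StrictMono ns ∧ ∃ H : ℝ → ℝ, Integrable H (mu T) ∧
      (∀ᵐ t ∂mu T, ∀ k, a (ns k) t ≤ H t) ∧
      ∀ᵐ t ∂mu T, Tendsto (fun k => a (ns k) t) atTop (𝓝 0) := by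
  -- With integrals below 2⁻ᵏ the sum of all selected terms is integrable. It serves as the
  -- dominating function, and its finiteness a.e. sends the terms to zero.
  obtain ⟨ns, hns, hle⟩ := extraction_forall_of_eventually
    (P := fun k n => ∫ t, a n t ∂mu T < (1 / 2) ^ k)
    fun k => hlim.eventually (gt_mem_nhds (by positivity))
  have hm : ∀ k, AEMeasurable (fun t => ENNReal.ofReal (a (ns k) t)) (mu T) := fun k =>
    (hi _).1.aemeasurable.ennreal_ofReal
  have hfin : ∫⁻ t, ∑' k, ENNReal.ofReal (a (ns k) t) ∂mu T ≠ ⊤ := by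
    rw [lintegral_tsum hm]
    have h1 : ∀ k, ∫⁻ t, ENNReal.ofReal (a (ns k) t) ∂mu T ≤ ENNReal.ofReal ((1 / 2) ^ k) := by
      intro k
      rw [← ofReal_integral_eq_lintegral_ofReal (hi _) (Eventually.of_forall fun t => ha _ t)]
      exact ENNReal.ofReal_le_ofReal (hle k).le
    refine ne_top_of_le_ne_top ?_ (ENNReal.tsum_le_tsum h1)
    exact (summable_geometric_of_lt_one (by norm_num) (by norm_num)).tsum_ofReal_ne_top
  have hmS : AEMeasurable (fun t => ∑' k, ENNReal.ofReal (a (ns k) t)) (mu T) :=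
    AEMeasurable.tsum hm
  refine ⟨ns, hns, fun t => (∑' k, ENNReal.ofReal (a (ns k) t)).toReal,
    integrable_toReal_of_lintegral_ne_top hmS hfin, ?_, ?_⟩
  · filter_upwards [ae_lt_top' hmS hfin] with t ht k
    rw [← ENNReal.toReal_ofReal (ha (ns k) t)]
    exact ENNReal.toReal_mono ht.ne (ENNReal.le_tsum k)
  · filter_upwards [ae_lt_top' hmS hfin] with t ht
    have h1 := ENNReal.tendsto_cofinite_zero_of_tsum_ne_top ht.ne
    rw [Nat.cofinite_eq_atTop] at h1
    have h2 := (ENNReal.tendsto_toReal ENNReal.zero_ne_top).comp h1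
    simpa [Function.comp_def, ENNReal.toReal_ofReal (ha _ _)] using h2

namespace Sob

variable {hG : IsGFunction G}

theorem tendsto_modular {z : ℕ → Sob T hG} {z₀ : Sob T hG} (hz : Tendsto z atTop (𝓝 z₀)) (m : ℝ) :
    Tendsto (fun n => ∫ t, G (m • (z n - z₀).vel t) ∂mu T) atTop (𝓝 0) := by
  rw [tendsto_iff_norm_sub_tendsto_zero] at hz
  rw [Metric.tendsto_atTop]
  intro ε hε
  have hm : 0 < |m| + 1 := by positivity
  set ε' := min (ε / 2) 1 with hε'
  have hε'0 : 0 < ε' := lt_min (by positivity) one_pos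
  obtain ⟨n₀, hn₀⟩ := eventually_atTop.1 (hz.eventually (gt_mem_nhds (div_pos hε'0 hm)))
  refine ⟨n₀, fun n hn => ?_⟩
  rw [Real.dist_eq, sub_zero, abs_of_nonneg (hG.young.modular_nonneg _)]
  have h1 := hG.young.modular_smul_le_of_luxNorm (z n - z₀).memLG_vel hε'0 (min_le_right _ _) hm
    ((luxNorm_vel_le _).trans_lt (hn₀ n hn))
  have h2 : ∫ t, G (m • (z n - z₀).vel t) ∂mu T
      ≤ ∫ t, G ((|m| + 1) • (z n - z₀).vel t) ∂mu T := by
    refine integral_mono (hG.young.memLG_smul (memLG_vel _) _).2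
      (hG.young.memLG_smul (memLG_vel _) _).2 fun t => ?_
    have e : m • (z n - z₀).vel t = (m / (|m| + 1)) • ((|m| + 1) • (z n - z₀).vel t) := by
      rw [smul_smul, div_mul_cancel₀ _ hm.ne']
    simp only
    rw [e]
    refine hG.young.smul_le_self ?_ _
    rw [abs_div, abs_of_pos hm, div_le_one hm]; linarith
  have := min_le_left (ε / 2) 1
  linarith

/-- A convergent sequence has a subsequence whose velocities converge a.e. with dominated
modulars. -/
theorem exists_subseq {z : ℕ → Sob T hG} {z₀ : Sob T hG} (hz : Tendsto z atTop (𝓝 z₀)) :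
    ∃ ns : ℕ → ℕ, StrictMono ns ∧ ∃ H : ℝ → ℝ, Integrable H (mu T) ∧
      (∀ᵐ t ∂mu T, ∀ k, G ((z (ns k)).vel t) ≤ H t) ∧
      ∀ᵐ t ∂mu T, Tendsto (fun k => (z (ns k)).vel t) atTop (𝓝 (z₀.vel t)) := by
  have hi1 : ∀ n, Integrable (fun t => ‖(z n - z₀).vel t‖) (mu T) := fun n =>
    (integrable_vel _).norm
  have hi2 : ∀ n, Integrable (fun t => G ((2 : ℝ) • (z n - z₀).vel t)) (mu T) := fun n =>
    (hG.young.memLG_smul (memLG_vel _) _).2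
  obtain ⟨K, hK, hKle⟩ := exists_norm_velL_le T hG
  -- The norm yields convergence a.e.; the term with the factor 2 yields domination, through G(a +
  -- b) ≤ ½ G(2a) + ½ G(2b).
  have hlim : Tendsto (fun n => ∫ t, (‖(z n - z₀).vel t‖ + G ((2 : ℝ) • (z n - z₀).vel t)) ∂mu T)
      atTop (𝓝 0) := by
    simp_rw [fun n => integral_add (hi1 n) (hi2 n)]
    rw [← add_zero (0 : ℝ)]
    refine Tendsto.add ?_ (tendsto_modular hz 2)
    have h1 : Tendsto (fun n => K * ‖z n - z₀‖) atTop (𝓝 0) := by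
      simpa using (tendsto_iff_norm_sub_tendsto_zero.1 hz).const_mul K
    refine squeeze_zero (fun n => integral_nonneg fun _ => norm_nonneg _) (fun n => ?_) h1
    have := hKle (z n - z₀)
    rwa [L1.norm_eq_integral_norm] at this
  obtain ⟨ns, hns, H, hH, hle, ht0⟩ := exists_dominated_subseq
    (fun n t => add_nonneg (norm_nonneg _) (hG.nonneg _)) (fun n => (hi1 n).add (hi2 n)) hlim
  have hsub : ∀ᵐ t ∂mu T, ∀ n, (z n - z₀).vel t = (z n).vel t - z₀.vel t :=
    ae_all_iff.2 fun n => vel_sub _ _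
  refine ⟨ns, hns, fun t => 1 / 2 * G ((2 : ℝ) • z₀.vel t) + 1 / 2 * H t,
    ((hG.young.memLG_smul z₀.memLG_vel 2).2.const_mul _).add (hH.const_mul _), ?_, ?_⟩
  · filter_upwards [hle, hsub] with t h1 h2 k
    have h3 := h1 k
    have h4 := hG.young.add_le (z₀.vel t) ((z (ns k) - z₀).vel t)
    rw [h2, add_sub_cancel] at h4
    rw [h2] at h3
    linarith [norm_nonneg ((z (ns k)).vel t - z₀.vel t)]
  · filter_upwards [ht0, hsub] with t h1 h2
    rw [tendsto_iff_norm_sub_tendsto_zero]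
    refine squeeze_zero (fun _ => norm_nonneg _) (fun k => ?_) h1
    rw [← h2]
    linarith [hG.nonneg ((2 : ℝ) • (z (ns k) - z₀).vel t)]

theorem tendsto_pos (hT : 0 ≤ T) {z : ℕ → Sob T hG} {z₀ : Sob T hG} (hz : Tendsto z atTop (𝓝 z₀))
    {t : ℝ} (ht : t ∈ I T) : Tendsto (fun n => (z n).pos t) atTop (𝓝 (z₀.pos t)) := by
  obtain ⟨K, hK, hKle⟩ := exists_norm_pos_le T hG
  rw [tendsto_iff_norm_sub_tendsto_zero] at hz ⊢
  have h1 : Tendsto (fun n => K * ‖z n - z₀‖) atTop (𝓝 0) := by simpa using hz.const_mul K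
  refine squeeze_zero (fun _ => norm_nonneg _) (fun n => ?_) h1
  rw [← pos_sub hT _ _ ht]
  exact hKle _ t ht

end Sob

end AnisotropicEL

end
open Set Filter Topology MeasureTheory

noncomputable section

namespace AnisotropicEL

variable {N : ℕ} {T : ℝ} {G : E N → ℝ}

/-! ### Lagrangians of Carathéodory type -/

/-- The gradient of a Lagrangian in the position variable. -/
def gradX (L : ℝ → E N → E N → ℝ) (t : ℝ) (x v : E N) : E N := gradient (fun y => L t y v) x

/-- The gradient of a Lagrangian in the velocity variable. -/
def gradV (L : ℝ → E N → E N → ℝ) (t : ℝ) (x v : E N) : E N := gradient (L t x) v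

/-- Lagrangians that are `C¹` and convex in the velocity, measurable in time, and whose growth and
coercivity are governed by the G-function `G`. -/
structure Lagr (T : ℝ) (G : E N → ℝ) (L : ℝ → E N → E N → ℝ) : Prop where
  contDiff : ∀ t ∈ I T, ContDiff ℝ 1 (fun p : E N × E N => L t p.1 p.2)
  convex : ∀ t ∈ I T, ∀ x, ConvexOn ℝ univ (L t x)
  meas : ∀ u w : ℝ → E N, AEStronglyMeasurable u (mu T) → AEStronglyMeasurable w (mu T) →
    AEStronglyMeasurable (fun t => L t (u t) (w t)) (mu T)
  meas_gradX : ∀ u w : ℝ → E N, AEStronglyMeasurable u (mu T) → AEStronglyMeasurable w (mu T) →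
    AEStronglyMeasurable (fun t => gradX L t (u t) (w t)) (mu T)
  meas_gradV : ∀ u w : ℝ → E N, AEStronglyMeasurable u (mu T) → AEStronglyMeasurable w (mu T) →
    AEStronglyMeasurable (fun t => gradV L t (u t) (w t)) (mu T)
  growth : ∀ R : ℝ, ∃ (B : ℝ → ℝ) (A : ℝ), Integrable B (mu T) ∧ 0 ≤ A ∧
    ∀ t ∈ I T, ∀ x v, ‖x‖ ≤ R → |L t x v| ≤ B t + A * G v ∧ ‖gradX L t x v‖ ≤ B t + A * G v ∧
      conj G (gradV L t x v) ≤ B t + A * G v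
  coercive : ∀ R : ℝ, ∃ (B : ℝ → ℝ) (Λ : ℝ), Integrable B (mu T) ∧ 0 < Λ ∧
    ∀ t ∈ I T, ∀ x v, ‖x‖ ≤ R → Λ * G v ≤ L t x v + B t

/-- Partial gradients of a `C¹` function of two variables. -/
theorem partial_gradients {f : E N → E N → ℝ} (hf : ContDiff ℝ 1 fun p : E N × E N => f p.1 p.2) :
    (∀ x v, HasFDerivAt (fun p : E N × E N => f p.1 p.2)
      ((innerSL ℝ (gradient (fun y => f y v) x)).comp (ContinuousLinearMap.fst ℝ (E N) (E N)) +
        (innerSL ℝ (gradient (f x) v)).comp (ContinuousLinearMap.snd ℝ (E N) (E N))) (x, v)) ∧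
    (Continuous fun p : E N × E N => gradient (fun y => f y p.2) p.1) ∧
    (Continuous fun p : E N × E N => gradient (f p.1) p.2) ∧
    (∀ x v, DifferentiableAt ℝ (f x) v) := by
  set F : E N × E N → ℝ := fun p => f p.1 p.2 with hF
  have hd : ∀ p, HasFDerivAt F (fderiv ℝ F p) p := fun p =>
    (hf.differentiable one_ne_zero p).hasFDerivAt
  have h1 : ∀ x v, HasFDerivAt (fun y => f y v)
      ((fderiv ℝ F (x, v)).comp (ContinuousLinearMap.inl ℝ (E N) (E N))) x := fun x v =>
    HasFDerivAt.comp (g := F) (f := fun y => (y, v)) x (hd (x, v)) (hasFDerivAt_prodMk_left x v)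
  have h2 : ∀ x v, HasFDerivAt (f x)
      ((fderiv ℝ F (x, v)).comp (ContinuousLinearMap.inr ℝ (E N) (E N))) v := fun x v =>
    HasFDerivAt.comp (g := F) (f := fun y => (x, y)) v (hd (x, v)) (hasFDerivAt_prodMk_right x v)
  have hc : Continuous (fderiv ℝ F) := hf.continuous_fderiv one_ne_zero
  have e1 : (fun p : E N × E N => gradient (fun y => f y p.2) p.1) = fun p : E N × E N =>
      (InnerProductSpace.toDual ℝ (E N)).symm
        ((fderiv ℝ F p).comp (ContinuousLinearMap.inl ℝ (E N) (E N))) :=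
    funext fun p => by rw [gradient, (h1 p.1 p.2).fderiv]
  have e2 : (fun p : E N × E N => gradient (f p.1) p.2) = fun p : E N × E N =>
      (InnerProductSpace.toDual ℝ (E N)).symm
        ((fderiv ℝ F p).comp (ContinuousLinearMap.inr ℝ (E N) (E N))) :=
    funext fun p => by rw [gradient, (h2 p.1 p.2).fderiv]
  refine ⟨fun x v => ?_, ?_, ?_, fun x v => (h2 x v).differentiableAt⟩
  · convert! hd (x, v) using 1
    refine ContinuousLinearMap.ext fun p => ?_
    simp only [add_apply, ContinuousLinearMap.comp_apply,
      ContinuousLinearMap.coe_fst', ContinuousLinearMap.coe_snd', innerSL_apply_apply]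
    rw [← fderiv_apply_eq_inner (h1 x v).differentiableAt,
      ← fderiv_apply_eq_inner (h2 x v).differentiableAt, (h1 x v).fderiv, (h2 x v).fderiv]
    simp [← map_add]
  · rw [e1]
    exact (InnerProductSpace.toDual ℝ (E N)).symm.continuous.comp (hc.clm_comp continuous_const)
  · rw [e2]
    exact (InnerProductSpace.toDual ℝ (E N)).symm.continuous.comp (hc.clm_comp continuous_const)

namespace Lagr

variable {L : ℝ → E N → E N → ℝ}

theorem hasFDerivAt (hL : Lagr T G L) {t : ℝ} (ht : t ∈ I T) (x v : E N) :
    HasFDerivAt (fun p : E N × E N => L t p.1 p.2)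
      ((innerSL ℝ (gradX L t x v)).comp (ContinuousLinearMap.fst ℝ (E N) (E N)) +
        (innerSL ℝ (gradV L t x v)).comp (ContinuousLinearMap.snd ℝ (E N) (E N))) (x, v) :=
  (partial_gradients (hL.contDiff t ht)).1 x v

theorem continuous_gradX (hL : Lagr T G L) {t : ℝ} (ht : t ∈ I T) :
    Continuous fun p : E N × E N => gradX L t p.1 p.2 :=
  (partial_gradients (hL.contDiff t ht)).2.1

theorem continuous_gradV (hL : Lagr T G L) {t : ℝ} (ht : t ∈ I T) :
    Continuous fun p : E N × E N => gradV L t p.1 p.2 :=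
  (partial_gradients (hL.contDiff t ht)).2.2.1

theorem continuous_apply (hL : Lagr T G L) {t : ℝ} (ht : t ∈ I T) :
    Continuous fun p : E N × E N => L t p.1 p.2 :=
  (hL.contDiff t ht).continuous

/-- The gradient inequality in the velocity variable. -/
theorem add_inner_gradV_le (hL : Lagr T G L) {t : ℝ} (ht : t ∈ I T) (x v w : E N) :
    L t x v + inner ℝ (gradV L t x v) (w - v) ≤ L t x w :=
  gradient_inequality (hL.convex t ht x) ((partial_gradients (hL.contDiff t ht)).2.2.2 x v) w

theorem hasDerivAt_line (hL : Lagr T G L) {t : ℝ} (ht : t ∈ I T) (x v h k : E N) (s : ℝ) :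
    HasDerivAt (fun s : ℝ => L t (x + s • h) (v + s • k))
      (inner ℝ (gradX L t (x + s • h) (v + s • k)) h +
        inner ℝ (gradV L t (x + s • h) (v + s • k)) k) s := by
  have h1 : HasDerivAt (fun s : ℝ => (x + s • h, v + s • k)) (h, k) s := by
    have a : HasDerivAt (fun s : ℝ => x + s • h) h s := by
      simpa using ((hasDerivAt_id s).smul_const h).const_add x
    have b : HasDerivAt (fun s : ℝ => v + s • k) k s := by
      simpa using ((hasDerivAt_id s).smul_const k).const_add v
    exact a.prodMk b
  exact (hL.hasFDerivAt ht (x + s • h) (v + s • k)).comp_hasDerivAt s h1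

variable {u w : ℝ → E N}

theorem integrable_comp (hL : Lagr T G L) {R : ℝ} (hu : AEStronglyMeasurable u (mu T))
    (hb : ∀ᵐ t ∂mu T, ‖u t‖ ≤ R) (hw : MemLG T G w) :
    Integrable (fun t => L t (u t) (w t)) (mu T) := by
  obtain ⟨B, A, hB, hA, h⟩ := hL.growth R
  refine Integrable.mono' (hB.add (hw.2.const_mul A)) (hL.meas u w hu hw.1) ?_
  filter_upwards [hb, ae_mem_I] with t h1 h2 using (h t h2 _ _ h1).1

theorem integrable_gradX (hL : Lagr T G L) {R : ℝ} (hu : AEStronglyMeasurable u (mu T))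
    (hb : ∀ᵐ t ∂mu T, ‖u t‖ ≤ R) (hw : MemLG T G w) :
    Integrable (fun t => gradX L t (u t) (w t)) (mu T) := by
  obtain ⟨B, A, hB, hA, h⟩ := hL.growth R
  refine Integrable.mono' (hB.add (hw.2.const_mul A)) (hL.meas_gradX u w hu hw.1) ?_
  filter_upwards [hb, ae_mem_I] with t h1 h2 using (h t h2 _ _ h1).2.1

theorem memLG_gradV (hG : IsGFunction G) (hL : Lagr T G L) {R : ℝ}
    (hu : AEStronglyMeasurable u (mu T)) (hb : ∀ᵐ t ∂mu T, ‖u t‖ ≤ R) (hw : MemLG T G w) :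
    MemLG T (conj G) (fun t => gradV L t (u t) (w t)) := by
  obtain ⟨B, A, hB, hA, h⟩ := hL.growth R
  refine ⟨hL.meas_gradV u w hu hw.1, Integrable.mono' (hB.add (hw.2.const_mul A))
    (hG.conj_young.comp_aestronglyMeasurable (hL.meas_gradV u w hu hw.1)) ?_⟩
  filter_upwards [hb, ae_mem_I] with t h1 h2
  rw [Real.norm_of_nonneg (hG.conj_nonneg _)]
  exact (h t h2 _ _ h1).2.2

/-- Convergence of the superposition operators along dominated a.e. convergent sequences. -/
theorem tendsto_of_dominated (hG : IsGFunction G) (hL : Lagr T G L) {un wn : ℕ → ℝ → E N}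
    {R : ℝ} {H : ℝ → ℝ} (hun : ∀ n, AEStronglyMeasurable (un n) (mu T))
    (hwn : ∀ n, MemLG T G (wn n)) (hu : AEStronglyMeasurable u (mu T)) (hw : MemLG T G w)
    (hunR : ∀ᵐ t ∂mu T, ∀ n, ‖un n t‖ ≤ R)
    (hulim : ∀ᵐ t ∂mu T, Tendsto (fun n => un n t) atTop (𝓝 (u t)))
    (hH : Integrable H (mu T)) (hwH : ∀ᵐ t ∂mu T, ∀ n, G (wn n t) ≤ H t)
    (hwlim : ∀ᵐ t ∂mu T, Tendsto (fun n => wn n t) atTop (𝓝 (w t))) :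
    Tendsto (fun n => ∫ t, L t (un n t) (wn n t) ∂mu T) atTop (𝓝 (∫ t, L t (u t) (w t) ∂mu T)) ∧
    Tendsto (fun n => ∫ t, ‖gradX L t (un n t) (wn n t) - gradX L t (u t) (w t)‖ ∂mu T) atTop
      (𝓝 0) ∧
    ∀ m : ℝ, Tendsto (fun n => ∫ t, conj G (m • (gradV L t (un n t) (wn n t)
      - gradV L t (u t) (w t))) ∂mu T) atTop (𝓝 0) := by
  obtain ⟨B, A, hB, hA, h⟩ := hL.growth R
  have hbound : Integrable (fun t => B t + A * H t) (mu T) := hB.add (hH.const_mul A)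
  have huR : ∀ᵐ t ∂mu T, ‖u t‖ ≤ R := by
    filter_upwards [hunR, hulim] with t h1 h2
    exact le_of_tendsto' h2.norm h1
  have hwH0 : ∀ᵐ t ∂mu T, G (w t) ≤ H t := by
    filter_upwards [hwH, hwlim] with t h1 h2
    exact le_of_tendsto' ((hG.young.cont.tendsto _).comp h2) h1
  have hlim : ∀ᵐ t ∂mu T, Tendsto (fun n => (un n t, wn n t)) atTop (𝓝 (u t, w t)) := by
    filter_upwards [hulim, hwlim] with t h1 h2 using h1.prodMk_nhds h2
  refine ⟨?_, ?_, fun m => ?_⟩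
  · refine tendsto_integral_of_dominated_convergence (fun t => B t + A * H t)
      (fun n => hL.meas _ _ (hun n) (hwn n).1) hbound (fun n => ?_) ?_
    · filter_upwards [hunR, hwH, ae_mem_I] with t h1 h2 h3
      have h4 := (h t h3 _ (wn n t) (h1 n)).1
      have := mul_le_mul_of_nonneg_left (h2 n) hA
      rw [Real.norm_eq_abs]; linarith
    · filter_upwards [hlim, ae_mem_I] with t h1 h2
      exact ((hL.continuous_apply h2).tendsto _).comp h1
  · have : (0 : ℝ) = ∫ t : ℝ, (0 : ℝ) ∂mu T := by simp
    rw [this]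
    refine tendsto_integral_of_dominated_convergence (fun t => 2 * (B t + A * H t))
      (fun n => ((hL.meas_gradX _ _ (hun n) (hwn n).1).sub (hL.meas_gradX _ _ hu hw.1)).norm)
      (hbound.const_mul 2) (fun n => ?_) ?_
    · filter_upwards [hunR, hwH, ae_mem_I, huR, hwH0] with t h1 h2 h3 h4 h5
      have h6 := (h t h3 _ (wn n t) (h1 n)).2.1
      have h7 := (h t h3 _ (w t) h4).2.1
      have := mul_le_mul_of_nonneg_left (h2 n) hA
      have := mul_le_mul_of_nonneg_left h5 hA
      rw [norm_norm]
      linarith [norm_sub_le (gradX L t (un n t) (wn n t)) (gradX L t (u t) (w t))]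
    · filter_upwards [hlim, ae_mem_I] with t h1 h2
      rw [← tendsto_iff_norm_sub_tendsto_zero]
      exact ((hL.continuous_gradX h2).tendsto _).comp h1
  -- Doubling of G* dominates the modular at every scaling m, which is the form used to get
  -- convergence of functionals in operator norm.
  · obtain ⟨k, C, hk, hC, hkC⟩ := hG.conj_young.sub_bound m
    have : (0 : ℝ) = ∫ t : ℝ, (0 : ℝ) ∂mu T := by simp
    rw [this]
    refine tendsto_integral_of_dominated_convergence (fun t => 2 * k * (B t + A * H t) + C)
      (fun n => hG.conj_young.comp_aestronglyMeasurable
        (((hL.meas_gradV _ _ (hun n) (hwn n).1).sub (hL.meas_gradV _ _ hu hw.1)).const_smul m))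
      ((hbound.const_mul (2 * k)).add (integrable_const C)) (fun n => ?_) ?_
    · filter_upwards [hunR, hwH, ae_mem_I, huR, hwH0] with t h1 h2 h3 h4 h5
      have h6 := (h t h3 _ (wn n t) (h1 n)).2.2
      have h7 := (h t h3 _ (w t) h4).2.2
      have h8 := mul_le_mul_of_nonneg_left (h2 n) hA
      have h9 := mul_le_mul_of_nonneg_left h5 hA
      rw [Real.norm_of_nonneg (hG.conj_nonneg _)]
      have h10 := hkC (gradV L t (un n t) (wn n t)) (gradV L t (u t) (w t))
      have h11 := mul_le_mul_of_nonneg_left (h6.trans (add_le_add_right h8 _)) hk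
      have h12 := mul_le_mul_of_nonneg_left (h7.trans (add_le_add_right h9 _)) hk
      linarith
    · filter_upwards [hlim, ae_mem_I] with t h1 h2
      have h3 := ((hL.continuous_gradV h2).tendsto _).comp h1
      have h4 : Tendsto (fun n => m • (gradV L t (un n t) (wn n t) - gradV L t (u t) (w t)))
          atTop (𝓝 (m • (gradV L t (u t) (w t) - gradV L t (u t) (w t)))) :=
        (h3.sub tendsto_const_nhds).const_smul m
      rw [sub_self, smul_zero] at h4
      have h5 := (hG.conj_young.cont.tendsto 0).comp h4
      rwa [hG.conj_young.zero] at h5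

end Lagr

end AnisotropicEL

end
open Set Filter Topology MeasureTheory

noncomputable section

namespace AnisotropicEL

variable {N : ℕ} {T : ℝ} {G : E N → ℝ} {hG : IsGFunction G}

/-! ### The action functional is continuously differentiable -/

namespace Sob

/-- A bound for all values of the curve. -/
theorem exists_bound (z : Sob T hG) : ∃ R : ℝ, 0 ≤ R ∧ ∀ t ∈ I T, ‖z.pos t‖ ≤ R := by
  obtain ⟨K, hK, h⟩ := exists_norm_pos_le T hG
  exact ⟨K * ‖z‖, by positivity, h z⟩

theorem integrable_inner_pos (hT : 0 ≤ T) {a : ℝ → E N} (ha : Integrable a (mu T))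
    (φ : Sob T hG) : Integrable (fun t => inner ℝ (a t) (φ.pos t)) (mu T) := by
  obtain ⟨R, hR, h⟩ := φ.exists_bound
  refine Integrable.mono' (ha.norm.mul_const R) (ha.1.inner (aestronglyMeasurable_pos hT φ)) ?_
  filter_upwards [ae_mem_I] with t ht
  exact (norm_inner_le_norm _ _).trans (mul_le_mul_of_nonneg_left (h t ht) (norm_nonneg _))

theorem integrable_pairing (hT : 0 ≤ T) {a ψ : ℝ → E N} (ha : Integrable a (mu T))
    (hψ : MemLG T (conj G) ψ) (φ : Sob T hG) :
    Integrable (fun t => inner ℝ (a t) (φ.pos t) + inner ℝ (ψ t) (φ.vel t)) (mu T) :=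
  (integrable_inner_pos hT ha φ).add (integrable_inner hG hψ φ.memLG_vel)

/-- The linear functional `φ ↦ ∫ ⟨a, φ⟩ + ⟨ψ, φ'⟩`. -/
def pairingLin (hT : 0 ≤ T) {a ψ : ℝ → E N} (ha : Integrable a (mu T))
    (hψ : MemLG T (conj G) ψ) : Sob T hG →ₗ[ℝ] ℝ where
  toFun φ := ∫ t, (inner ℝ (a t) (φ.pos t) + inner ℝ (ψ t) (φ.vel t)) ∂mu T
  map_add' φ χ := by
    rw [← integral_add (integrable_pairing hT ha hψ φ) (integrable_pairing hT ha hψ χ)]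
    refine integral_congr_ae ?_
    filter_upwards [ae_mem_I, vel_add φ χ] with t ht h1
    rw [pos_add hT φ χ ht, h1, inner_add_right, inner_add_right]
    ring
  map_smul' c φ := by
    rw [RingHom.id_apply, smul_eq_mul, ← integral_const_mul]
    refine integral_congr_ae ?_
    filter_upwards [ae_mem_I, vel_smul c φ] with t ht h1
    rw [pos_smul c φ ht, h1, inner_smul_right, inner_smul_right]
    ring

/-- The sup bound for curves handles a, Hölder's inequality handles ψ. The parameter δ is kept free:
once the modular of δ⁻¹ψ is at most 1, the second term is at most 2δ, so modular convergence gives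
norm convergence. -/
theorem exists_pairing_le (T : ℝ) (hG : IsGFunction G) : ∃ K : ℝ, 0 < K ∧
    ∀ (a ψ : ℝ → E N), Integrable a (mu T) → MemLG T (conj G) ψ → ∀ δ > 0, ∀ φ : Sob T hG,
    |∫ t, (inner ℝ (a t) (φ.pos t) + inner ℝ (ψ t) (φ.vel t)) ∂mu T| ≤
      (K * (∫ t, ‖a t‖ ∂mu T) + δ * ((∫ t, conj G (δ⁻¹ • ψ t) ∂mu T) + 1)) * ‖φ‖ := by
  obtain ⟨K, hK, h⟩ := exists_norm_pos_le T hG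
  refine ⟨K, hK, fun a ψ ha hψ δ hδ φ => ?_⟩
  have h1 : ∀ᵐ t ∂mu T, |inner ℝ (a t) (φ.pos t) + inner ℝ (ψ t) (φ.vel t)| ≤
      ‖a t‖ * (K * ‖φ‖) + |inner ℝ (ψ t) (φ.vel t)| := by
    filter_upwards [ae_mem_I] with t ht
    refine (abs_add_le _ _).trans (add_le_add_left ?_ _)
    exact (abs_real_inner_le_norm _ _).trans
      (mul_le_mul_of_nonneg_left (h φ t ht) (norm_nonneg _))
  have hi1 : Integrable (fun t => ‖a t‖ * (K * ‖φ‖)) (mu T) := ha.norm.mul_const _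
  have hi2 : Integrable (fun t => |inner ℝ (ψ t) (φ.vel t)|) (mu T) :=
    (integrable_inner hG hψ φ.memLG_vel).norm
  have h2 : |∫ t, (inner ℝ (a t) (φ.pos t) + inner ℝ (ψ t) (φ.vel t)) ∂mu T| ≤
      ∫ t, (‖a t‖ * (K * ‖φ‖) + |inner ℝ (ψ t) (φ.vel t)|) ∂mu T := by
    rw [← Real.norm_eq_abs]
    exact norm_integral_le_of_norm_le
      (g := fun t => ‖a t‖ * (K * ‖φ‖) + |inner ℝ (ψ t) (φ.vel t)|) (hi1.add hi2) h1
  rw [integral_add hi1 hi2, integral_mul_const] at h2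
  have h3 := holder hG hψ φ.memLG_vel hδ
  have h0 : 0 ≤ ∫ t, conj G (δ⁻¹ • ψ t) ∂mu T := integral_nonneg fun _ => hG.conj_nonneg _
  have h4 := mul_le_mul_of_nonneg_left (luxNorm_vel_le φ)
    (by positivity : 0 ≤ δ * ((∫ t, conj G (δ⁻¹ • ψ t) ∂mu T) + 1))
  linarith

/-- The continuous linear functional `φ ↦ ∫ ⟨a, φ⟩ + ⟨ψ, φ'⟩`. -/
def pairing (hT : 0 ≤ T) {a ψ : ℝ → E N} (ha : Integrable a (mu T))
    (hψ : MemLG T (conj G) ψ) : Sob T hG →L[ℝ] ℝ :=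
  (pairingLin hT ha hψ).mkContinuousOfExistsBound <| by
    obtain ⟨K, -, h⟩ := exists_pairing_le T hG
    exact ⟨_, fun φ => h a ψ ha hψ 1 one_pos φ⟩

theorem pairing_apply (hT : 0 ≤ T) {a ψ : ℝ → E N} (ha : Integrable a (mu T))
    (hψ : MemLG T (conj G) ψ) (φ : Sob T hG) : pairing hT ha hψ φ =
      ∫ t, (inner ℝ (a t) (φ.pos t) + inner ℝ (ψ t) (φ.vel t)) ∂mu T := rfl

theorem pairing_sub_apply (hT : 0 ≤ T) {a a' ψ ψ' : ℝ → E N} (ha : Integrable a (mu T))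
    (ha' : Integrable a' (mu T)) (hψ : MemLG T (conj G) ψ) (hψ' : MemLG T (conj G) ψ')
    (φ : Sob T hG) : (pairing hT ha hψ - pairing hT ha' hψ') φ =
      ∫ t, (inner ℝ (a t - a' t) (φ.pos t) + inner ℝ (ψ t - ψ' t) (φ.vel t)) ∂mu T := by
  rw [sub_apply, pairing_apply, pairing_apply,
    ← integral_sub (integrable_pairing hT ha hψ φ) (integrable_pairing hT ha' hψ' φ)]
  refine integral_congr_ae (Eventually.of_forall fun t => ?_)
  simp only [inner_sub_left]
  ring

/-- Convergence of the coefficients implies convergence of the functionals. -/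
theorem tendsto_pairing (hT : 0 ≤ T) {a ψ : ℕ → ℝ → E N} {a' ψ' : ℝ → E N}
    (ha : ∀ n, Integrable (a n) (mu T)) (hψ : ∀ n, MemLG T (conj G) (ψ n))
    (ha' : Integrable a' (mu T)) (hψ' : MemLG T (conj G) ψ')
    (h1 : Tendsto (fun n => ∫ t, ‖a n t - a' t‖ ∂mu T) atTop (𝓝 0))
    (h2 : ∀ m : ℝ, Tendsto (fun n => ∫ t, conj G (m • (ψ n t - ψ' t)) ∂mu T) atTop (𝓝 0)) :
    Tendsto (fun n => (pairing hT (ha n) (hψ n) : Sob T hG →L[ℝ] ℝ)) atTop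
      (𝓝 (pairing hT ha' hψ')) := by
  obtain ⟨K, hK, h⟩ := exists_pairing_le T hG
  rw [tendsto_iff_norm_sub_tendsto_zero, Metric.tendsto_atTop]
  intro ε hε
  set δ := ε / 4 with hδ
  have hδ0 : 0 < δ := by positivity
  have e1 : ∀ᶠ n in atTop, ∫ t, ‖a n t - a' t‖ ∂mu T < δ / K :=
    h1.eventually (gt_mem_nhds (by positivity))
  have e2 : ∀ᶠ n in atTop, ∫ t, conj G (δ⁻¹ • (ψ n t - ψ' t)) ∂mu T < 1 :=
    (h2 δ⁻¹).eventually (gt_mem_nhds one_pos)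
  obtain ⟨n₀, hn₀⟩ := eventually_atTop.1 (e1.and e2)
  refine ⟨n₀, fun n hn => ?_⟩
  obtain ⟨h3, h4⟩ := hn₀ n hn
  rw [Real.dist_eq, sub_zero, abs_norm]
  have h5 : ‖(pairing hT (ha n) (hψ n) : Sob T hG →L[ℝ] ℝ) - pairing hT ha' hψ'‖ ≤
      K * (∫ t, ‖a n t - a' t‖ ∂mu T) +
        δ * ((∫ t, conj G (δ⁻¹ • (ψ n t - ψ' t)) ∂mu T) + 1) := by
    refine ContinuousLinearMap.opNorm_le_bound _ ?_ fun φ => ?_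
    · have : 0 ≤ ∫ t, ‖a n t - a' t‖ ∂mu T := integral_nonneg fun _ => norm_nonneg _
      have : 0 ≤ ∫ t, conj G (δ⁻¹ • (ψ n t - ψ' t)) ∂mu T :=
        integral_nonneg fun _ => hG.conj_nonneg _
      positivity
    · rw [pairing_sub_apply, Real.norm_eq_abs]
      exact h (fun t => a n t - a' t) (fun t => ψ n t - ψ' t) ((ha n).sub ha')
        (hG.conj_young.memLG_sub (hψ n) hψ') δ hδ0 φ
  rw [lt_div_iff₀ hK] at h3
  have h6 := mul_lt_mul_of_pos_left h4 hδ0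
  linarith

end Sob

/-- The action on the model space. -/
def actionS (L : ℝ → E N → E N → ℝ) (z : Sob T hG) : ℝ := ∫ t, L t (z.pos t) (z.vel t) ∂mu T

namespace Lagr

variable {L : ℝ → E N → E N → ℝ} (hL : Lagr T G L)
include hL

theorem integrable_sob (hT : 0 ≤ T) (z : Sob T hG) :
    Integrable (fun t => L t (z.pos t) (z.vel t)) (mu T) := by
  obtain ⟨R, hR, h⟩ := z.exists_bound
  exact hL.integrable_comp (z.aestronglyMeasurable_pos hT) (ae_mem_I.mono h) z.memLG_vel

theorem integrable_gradX_sob (hT : 0 ≤ T) (z : Sob T hG) :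
    Integrable (fun t => gradX L t (z.pos t) (z.vel t)) (mu T) := by
  obtain ⟨R, hR, h⟩ := z.exists_bound
  exact hL.integrable_gradX (z.aestronglyMeasurable_pos hT) (ae_mem_I.mono h) z.memLG_vel

theorem memLG_gradV_sob (hT : 0 ≤ T) (z : Sob T hG) :
    MemLG T (conj G) (fun t => gradV L t (z.pos t) (z.vel t)) := by
  obtain ⟨R, hR, h⟩ := z.exists_bound
  exact hL.memLG_gradV hG (z.aestronglyMeasurable_pos hT) (ae_mem_I.mono h) z.memLG_vel

/-- The derivative of the action. -/
def dAction (hT : 0 ≤ T) (z : Sob T hG) : Sob T hG →L[ℝ] ℝ :=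
  Sob.pairing hT (hL.integrable_gradX_sob hT z) (hL.memLG_gradV_sob hT z)

theorem dAction_apply (hT : 0 ≤ T) (z φ : Sob T hG) : hL.dAction hT z φ =
    ∫ t, (inner ℝ (gradX L t (z.pos t) (z.vel t)) (φ.pos t) +
      inner ℝ (gradV L t (z.pos t) (z.vel t)) (φ.vel t)) ∂mu T := rfl

/-- Every subsequence of a convergent sequence has a further one with dominated velocities, along
which dominated convergence applies; this suffices for sequential continuity. -/
theorem continuous_dAction (hT : 0 ≤ T) :
    Continuous (hL.dAction hT : Sob T hG → Sob T hG →L[ℝ] ℝ) := by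
  refine continuous_iff_seqContinuous.2 fun z z₀ hz => ?_
  refine tendsto_of_subseq_tendsto fun ns hns => ?_
  obtain ⟨ms, hms, H, hH, hle, hlim⟩ := Sob.exists_subseq (hz.comp hns)
  refine ⟨ms, ?_⟩
  have hz' : Tendsto (fun k => z (ns (ms k))) atTop (𝓝 z₀) :=
    hz.comp (hns.comp hms.tendsto_atTop)
  obtain ⟨K, hK, hKle⟩ := Sob.exists_norm_pos_le T hG
  obtain ⟨C, hC⟩ := hz'.norm.bddAbove_range
  have hR : ∀ k, ∀ t ∈ I T, ‖(z (ns (ms k))).pos t‖ ≤ K * C := fun k t ht =>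
    (hKle _ t ht).trans (mul_le_mul_of_nonneg_left (hC ⟨k, rfl⟩) hK.le)
  obtain ⟨-, h1, h2⟩ := hL.tendsto_of_dominated hG (un := fun k => (z (ns (ms k))).pos)
    (wn := fun k => (z (ns (ms k))).vel) (fun k => Sob.aestronglyMeasurable_pos hT _)
    (fun k => Sob.memLG_vel _) (z₀.aestronglyMeasurable_pos hT) z₀.memLG_vel
    (ae_mem_I.mono fun t ht k => hR k t ht)
    (ae_mem_I.mono fun t ht => Sob.tendsto_pos hT hz' ht) hH hle hlim
  exact Sob.tendsto_pairing hT _ _ _ _ h1 h2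

/-- The Gateaux derivative of the action. -/
theorem hasDerivAt_actionS (hT : 0 ≤ T) (z φ : Sob T hG) :
    HasDerivAt (fun s : ℝ => actionS L (z + s • φ)) (hL.dAction hT z φ) 0 := by
  have hev : ∀ s : ℝ, actionS L (z + s • φ)
      = ∫ t, L t (z.pos t + s • φ.pos t) (z.vel t + s • φ.vel t) ∂mu T := by
    intro s
    refine integral_congr_ae ?_
    filter_upwards [ae_mem_I, Sob.vel_add z (s • φ), Sob.vel_smul s φ] with t ht h1 h2
    rw [Sob.pos_add hT _ _ ht, Sob.pos_smul _ _ ht, h1, h2]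
  rw [funext hev]
  obtain ⟨R, hR, hzR⟩ := z.exists_bound
  obtain ⟨R', hR', hφR⟩ := φ.exists_bound
  obtain ⟨B, A, hB, hA, hgr⟩ := hL.growth (R + R')
  have hposm : ∀ s : ℝ, AEStronglyMeasurable (fun t => z.pos t + s • φ.pos t) (mu T) := fun s =>
    (z.aestronglyMeasurable_pos hT).add ((φ.aestronglyMeasurable_pos hT).const_smul s)
  have hvelm : ∀ s : ℝ, MemLG T G (fun t => z.vel t + s • φ.vel t) := fun s =>
    hG.young.memLG_add z.memLG_vel (hG.young.memLG_smul φ.memLG_vel s)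
  have hposb : ∀ s : ℝ, |s| ≤ 1 → ∀ t ∈ I T, ‖z.pos t + s • φ.pos t‖ ≤ R + R' := by
    intro s hs t ht
    refine (norm_add_le _ _).trans (add_le_add (hzR t ht) ?_)
    rw [norm_smul, Real.norm_eq_abs]
    exact (mul_le_of_le_one_left (norm_nonneg _) hs).trans (hφR t ht)
  set D : ℝ → ℝ := fun t => B t + A * (1 / 2 * G ((2 : ℝ) • z.vel t) + 1 / 2 * G ((2 : ℝ) • φ.vel t))
    with hD
  have hDi : Integrable D (mu T) := hB.add ((((hG.young.memLG_smul z.memLG_vel 2).2.const_mul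
    (1 / 2)).add ((hG.young.memLG_smul φ.memLG_vel 2).2.const_mul (1 / 2))).const_mul A)
  have hDle : ∀ s : ℝ, |s| ≤ 1 → ∀ t, B t + A * G (z.vel t + s • φ.vel t) ≤ D t := by
    intro s hs t
    have h1 := hG.young.add_le (z.vel t) (s • φ.vel t)
    have h2 := hG.young.smul_le_self hs ((2 : ℝ) • φ.vel t)
    rw [smul_comm] at h2
    have h3 := mul_le_mul_of_nonneg_left
      (h1.trans (add_le_add_right (mul_le_mul_of_nonneg_left h2 (by norm_num)) _)) hA
    simp only [hD]
    linarith
  -- Differentiation under the integral for |s| < 1: `D` dominates the growth terms uniformly in s,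
  -- and Fenchel–Young handles the velocity pairing.
  have key := hasDerivAt_integral_of_dominated_loc_of_deriv_le (μ := mu T) (𝕜 := ℝ)
    (F := fun s t => L t (z.pos t + s • φ.pos t) (z.vel t + s • φ.vel t))
    (F' := fun s t => inner ℝ (gradX L t (z.pos t + s • φ.pos t) (z.vel t + s • φ.vel t)) (φ.pos t)
      + inner ℝ (gradV L t (z.pos t + s • φ.pos t) (z.vel t + s • φ.vel t)) (φ.vel t))
    (x₀ := (0 : ℝ)) (s := Metric.ball 0 1) (bound := fun t => D t * R' + (D t + G (φ.vel t)))
    (Metric.ball_mem_nhds _ one_pos)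
    (Eventually.of_forall fun s => hL.meas _ _ (hposm s) (hvelm s).1) ?_ ?_ ?_ ?_ ?_
  · have h2 := key.2
    simp only [zero_smul, add_zero] at h2
    exact h2
  · simpa using hL.integrable_sob hT z
  · simpa using (Sob.integrable_pairing hT (hL.integrable_gradX_sob hT z)
      (hL.memLG_gradV_sob hT z) φ).1
  · filter_upwards [ae_mem_I] with t ht s hs
    have hs' : |s| ≤ 1 := by
      rw [Metric.mem_ball, Real.dist_eq, sub_zero] at hs; exact hs.le
    obtain ⟨-, h1, h2⟩ := hgr t ht _ (z.vel t + s • φ.vel t) (hposb s hs' t ht)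
    have h3 := hDle s hs' t
    refine (norm_add_le _ _).trans (add_le_add ?_ ?_)
    · refine (norm_inner_le_norm _ _).trans (mul_le_mul (h1.trans h3) (hφR t ht) (norm_nonneg _) ?_)
      exact (norm_nonneg _).trans (h1.trans h3)
    · exact (hG.abs_inner_le _ _).trans (by linarith)
  · exact (hDi.mul_const R').add (hDi.add φ.memLG_vel.2)
  · filter_upwards [ae_mem_I] with t ht s _
    exact hL.hasDerivAt_line ht _ _ _ _ s

theorem hasDerivAt_actionS_line (hT : 0 ≤ T) (z φ : Sob T hG) (s : ℝ) :
    HasDerivAt (fun s : ℝ => actionS L (z + s • φ)) (hL.dAction hT (z + s • φ) φ) s := by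
  have h1 := hL.hasDerivAt_actionS hT (z + s • φ) φ
  have h2 : HasDerivAt (fun r : ℝ => r - s) 1 s := (hasDerivAt_id s).sub_const s
  have h3 := HasDerivAt.comp (h₂ := fun r : ℝ => actionS L (z + s • φ + r • φ))
    (h := fun r : ℝ => r - s) s (by rw [sub_self]; exact h1) h2
  rw [mul_one] at h3
  refine h3.congr_of_eventuallyEq (Eventually.of_forall fun r => ?_)
  simp only [Function.comp]
  congr 1
  rw [add_assoc, ← add_smul]
  congr 2; ring

/-- The mean value theorem on a segment. With continuity of the derivative it upgrades Gateaux to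
Fréchet differentiability; it also expresses the difference quotients along Palais–Smale sequences.
-/
theorem actionS_sub_eq (hT : 0 ≤ T) (z φ : Sob T hG) : ∃ s ∈ Ioo (0 : ℝ) 1,
    actionS L (z + φ) - actionS L z = hL.dAction hT (z + s • φ) φ := by
  obtain ⟨s, hs, h⟩ := exists_hasDerivAt_eq_slope _ _ (zero_lt_one (α := ℝ))
    (fun s _ => (hL.hasDerivAt_actionS_line hT z φ s).continuousAt.continuousWithinAt)
    (fun s _ => hL.hasDerivAt_actionS_line hT z φ s)
  refine ⟨s, hs, ?_⟩
  simp only [one_smul, zero_smul, add_zero, sub_zero, div_one] at h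
  exact h.symm

/-- The action is Fréchet differentiable. -/
theorem hasFDerivAt_actionS (hT : 0 ≤ T) (z : Sob T hG) :
    HasFDerivAt (actionS L) (hL.dAction hT z) z := by
  rw [hasFDerivAt_iff_isLittleO_nhds_zero, Asymptotics.isLittleO_iff]
  intro ε hε
  have hc := (hL.continuous_dAction (hG := hG) hT).continuousAt (x := z)
  obtain ⟨δ, hδ, h⟩ := Metric.continuousAt_iff.1 hc ε hε
  filter_upwards [Metric.ball_mem_nhds (0 : Sob T hG) hδ] with φ hφ
  rw [mem_ball_zero_iff] at hφ
  obtain ⟨s, hs, h1⟩ := hL.actionS_sub_eq hT z φ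
  rw [h1, ← sub_apply]
  refine (ContinuousLinearMap.le_opNorm _ _).trans (mul_le_mul_of_nonneg_right ?_ (norm_nonneg _))
  rw [← dist_eq_norm]
  refine (h ?_).le
  rw [dist_eq_norm, add_sub_cancel_left, norm_smul, Real.norm_of_nonneg hs.1.le]
  exact (mul_le_of_le_one_left (norm_nonneg _) hs.2.le).trans_lt hφ

end Lagr

end AnisotropicEL

end
open Set Filter Topology MeasureTheory

noncomputable section

namespace AnisotropicEL

variable {N : ℕ} {T : ℝ} {G : E N → ℝ}

/-! ### Weak compactness -/

theorem ac_integrable_deriv (hT : 0 ≤ T) {u : ℝ → E N}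
    (hu : AbsolutelyContinuousOnInterval u (-T) T) : Integrable (deriv u) (mu T) := by
  refine Integrable.of_eval_piLp fun i => ?_
  have h1 : Integrable (deriv fun t => u t i) (mu T) := by
    have := (ac_coord hu i).intervalIntegrable_deriv
    rwa [intervalIntegrable_iff_integrableOn_Icc_of_le (by linarith)] at this
  refine h1.congr ?_
  rw [EventuallyEq, ae_mu_iff hT]
  filter_upwards [ac_ae_differentiableAt hu] with t ht htI
  have h2 : HasDerivAt (fun t => u t i) (deriv u t i) t :=
    (EuclideanSpace.proj (𝕜 := ℝ) i).hasFDerivAt.comp_hasDerivAt t (ht htI).hasDerivAt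
  exact h2.deriv

/-- Uniform integrability from a modular bound. -/
theorem YoungFn.setIntegral_norm_le {Φ : E N → ℝ} (h : YoungFn Φ) {η C : ℝ}
    (hs : ∀ x, ‖x‖ ≤ η * Φ x + C) {w : ℝ → E N} (hw : MemLG T Φ w) (B : Set ℝ) :
    ∫ t in B, ‖w t‖ ∂mu T ≤ η * (∫ t in B, Φ (w t) ∂mu T) + C * (mu T).real B := by
  have hi : IntegrableOn (fun t => Φ (w t)) B (mu T) := Integrable.integrableOn hw.2
  have h1 : ∫ t in B, ‖w t‖ ∂mu T ≤ ∫ t in B, (η * Φ (w t) + C) ∂mu T :=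
    setIntegral_mono (h.integrable hw).norm.integrableOn
      (Integrable.add (hi.const_mul η) (integrable_const C)) fun t => hs _
  rw [integral_add (hi.const_mul η) (integrable_const C), integral_const_mul, integral_const,
    smul_eq_mul, measureReal_restrict_apply_univ] at h1
  linarith

theorem YoungFn.setIntegral_norm_le' {Φ : E N → ℝ} (h : YoungFn Φ) {η C : ℝ} (hη : 0 ≤ η)
    (hs : ∀ x, ‖x‖ ≤ η * Φ x + C) {w : ℝ → E N} (hw : MemLG T Φ w) (B : Set ℝ) :
    ∫ t in B, ‖w t‖ ∂mu T ≤ η * (∫ t, Φ (w t) ∂mu T) + C * (mu T).real B := by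
  have h1 := h.setIntegral_norm_le hs hw B
  have h2 : ∫ t in B, Φ (w t) ∂mu T ≤ ∫ t, Φ (w t) ∂mu T :=
    setIntegral_le_integral hw.2 (Eventually.of_forall fun _ => h.nonneg _)
  have := mul_le_mul_of_nonneg_left h2 hη
  linarith

/-- The oscillation of curves on families of disjoint intervals is controlled by the modular. -/
theorem Sob.sum_dist_pos_le {hG : IsGFunction G} (hT : 0 ≤ T) (z : Sob T hG) {η C : ℝ}
    (hη : 0 ≤ η) (hs : ∀ x, ‖x‖ ≤ η * G x + C) {P : ℕ × (ℕ → ℝ × ℝ)}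
    (hP : P ∈ AbsolutelyContinuousOnInterval.disjWithin (-T) T) :
    ∑ i ∈ Finset.range P.1, dist (z.pos (P.2 i).1) (z.pos (P.2 i).2) ≤
      η * (∫ t, G (z.vel t) ∂mu T) + C * ∑ i ∈ Finset.range P.1, dist (P.2 i).1 (P.2 i).2 := by
  have hI : ∀ {t}, t ∈ uIcc (-T) T ↔ t ∈ I T := fun {t} => by rw [uIcc_of_le (by linarith)]
  have hsub : ∀ i ∈ Finset.range P.1, uIoc (P.2 i).1 (P.2 i).2 ⊆ I T := fun i hi =>
    uIoc_subset_uIcc.trans (uIcc_subset_Icc (hI.1 (hP.1 i hi).1) (hI.1 (hP.1 i hi).2))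
  have h1 : ∀ i ∈ Finset.range P.1, dist (z.pos (P.2 i).1) (z.pos (P.2 i).2) ≤
      η * (∫ t in uIoc (P.2 i).1 (P.2 i).2, G (z.vel t) ∂mu T) +
        C * dist (P.2 i).1 (P.2 i).2 := by
    intro i hi
    have e1 : dist (z.pos (P.2 i).1) (z.pos (P.2 i).2)
        = ‖∫ t in (P.2 i).2..(P.2 i).1, z.vel t‖ := by
      rw [dist_eq_norm, Sob.pos, Sob.pos, add_sub_add_left_eq_sub,
        intervalIntegral.integral_interval_sub_left
          (intervalIntegrable_sub hT z.integrable_vel (hI.1 (hP.1 i hi).1))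
          (intervalIntegrable_sub hT z.integrable_vel (hI.1 (hP.1 i hi).2))]
    have e2 : (mu T).restrict (uIoc (P.2 i).1 (P.2 i).2)
        = volume.restrict (uIoc (P.2 i).1 (P.2 i).2) :=
      Measure.restrict_restrict_of_subset (hsub i hi)
    have h2 := hG.young.setIntegral_norm_le hs z.memLG_vel (uIoc (P.2 i).1 (P.2 i).2)
    have e3 : (mu T).real (uIoc (P.2 i).1 (P.2 i).2) = dist (P.2 i).1 (P.2 i).2 := by
      rw [← measureReal_restrict_apply_univ, e2, measureReal_restrict_apply_univ, Measure.real,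
        uIoc, Real.volume_Ioc, ENNReal.toReal_ofReal (sub_nonneg.2 min_le_max), Real.dist_eq,
        max_sub_min_eq_abs]
      exact abs_sub_comm _ _
    rw [e3] at h2
    refine le_trans ?_ h2
    rw [e1, e2, uIoc_comm]
    exact intervalIntegral.norm_integral_le_integral_norm_uIoc
  refine (Finset.sum_le_sum h1).trans ?_
  rw [Finset.sum_add_distrib, ← Finset.mul_sum, ← Finset.mul_sum]
  refine add_le_add_left (mul_le_mul_of_nonneg_left ?_ hη) _
  rw [← integral_biUnion_finset _ (fun i _ => measurableSet_uIoc) hP.2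
    (fun i _ => Integrable.integrableOn z.memLG_vel.2)]
  exact setIntegral_le_integral z.memLG_vel.2 (Eventually.of_forall fun _ => hG.nonneg _)

/-- Convergence of integrals over initial intervals and uniform integrability imply convergence of
integrals over all measurable sets. -/
theorem tendsto_setIntegral_of_intervals {w : ℕ → ℝ → E N} {w₀ : ℝ → E N}
    (hw : ∀ n, Integrable (w n) (mu T)) (hw₀ : Integrable w₀ (mu T))
    (hUI : ∀ ε > 0, ∃ δ > 0, ∀ B, MeasurableSet B → (mu T).real B < δ →
      ∀ n, ∫ t in B, ‖w n t‖ ∂mu T ≤ ε)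
    (hint : ∀ a, Tendsto (fun n => ∫ t in Iic a, w n t ∂mu T) atTop
      (𝓝 (∫ t in Iic a, w₀ t ∂mu T)))
    (htot : Tendsto (fun n => ∫ t, w n t ∂mu T) atTop (𝓝 (∫ t, w₀ t ∂mu T)))
    {B : Set ℝ} (hB : MeasurableSet B) :
    Tendsto (fun n => ∫ t in B, w n t ∂mu T) atTop (𝓝 (∫ t in B, w₀ t ∂mu T)) := by
  -- A Dynkin argument on the π-system of rays. Complements use the total integral; countable
  -- disjoint unions use uniform integrability to discard the tail.
  induction B, hB using MeasurableSpace.induction_on_inter (borel_eq_generateFrom_Iic ℝ)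
    isPiSystem_Iic with
  | empty => simp
  | basic B hB =>
    obtain ⟨a, rfl⟩ := hB
    exact hint a
  | compl B hB ih =>
    simp_rw [setIntegral_compl hB (hw _)]
    rw [setIntegral_compl hB hw₀]
    exact htot.sub ih
  | iUnion f hd hm ih =>
    let S : ℕ → Set ℝ := fun k => ⋃ i ∈ Finset.range k, f i
    have hSm : ∀ k, MeasurableSet (S k) := fun k => Finset.measurableSet_biUnion _ fun i _ => hm i
    have hSmono : Monotone S := fun k l hkl => biUnion_mono
      (fun i hi => Finset.mem_range.2 ((Finset.mem_range.1 hi).trans_le hkl)) fun _ _ => le_rfl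
    have hSU : ⋃ k, S k = ⋃ i, f i := by
      ext t
      simp only [S, mem_iUnion, Finset.mem_range]
      exact ⟨fun ⟨_, i, _, h⟩ => ⟨i, h⟩, fun ⟨i, h⟩ => ⟨i + 1, i, Nat.lt_succ_self i, h⟩⟩
    have hSsub : ∀ k, S k ⊆ ⋃ i, f i := fun k => hSU ▸ subset_iUnion S k
    have hSt : ∀ k, Tendsto (fun n => ∫ t in S k, w n t ∂mu T) atTop
        (𝓝 (∫ t in S k, w₀ t ∂mu T)) := by
      intro k
      have e : ∀ v : ℝ → E N, Integrable v (mu T) →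
          ∫ t in S k, v t ∂mu T = ∑ i ∈ Finset.range k, ∫ t in f i, v t ∂mu T := fun v hv =>
        integral_biUnion_finset _ (fun i _ => hm i) (fun i _ j _ hij => hd hij)
          fun i _ => hv.integrableOn
      simp_rw [e _ (hw _)]
      rw [e _ hw₀]
      exact tendsto_finsetSum _ fun i _ => ih i
    have hU : MeasurableSet (⋃ i, f i) := MeasurableSet.iUnion hm
    have hmeas : Tendsto (fun k => (mu T).real ((⋃ i, f i) \ S k)) atTop (𝓝 0) := by
      have h1 : Tendsto (fun k => ∫ _ in S k, (1 : ℝ) ∂mu T) atTop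
          (𝓝 (∫ _ in ⋃ k, S k, (1 : ℝ) ∂mu T)) :=
        tendsto_setIntegral_of_monotone hSm hSmono (integrable_const _).integrableOn
      simp only [integral_const, measureReal_restrict_apply_univ, smul_eq_mul, mul_one, hSU] at h1
      have h2 : ∀ k, (mu T).real ((⋃ i, f i) \ S k) = (mu T).real (⋃ i, f i) - (mu T).real (S k) :=
        fun k => measureReal_sdiff (hSsub k) (hSm k)
      simp_rw [h2]
      simpa using h1.const_sub ((mu T).real (⋃ i, f i))
    have hlim₀ : Tendsto (fun k => ∫ t in S k, w₀ t ∂mu T) atTop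
        (𝓝 (∫ t in ⋃ i, f i, w₀ t ∂mu T)) := by
      have := tendsto_setIntegral_of_monotone (μ := mu T) (f := w₀) hSm hSmono hw₀.integrableOn
      rwa [hSU] at this
    rw [Metric.tendsto_atTop]
    intro ε hε
    obtain ⟨δ, hδ, hδ'⟩ := hUI (ε / 4) (by positivity)
    obtain ⟨k, hk1, hk2⟩ := ((hmeas.eventually (gt_mem_nhds hδ)).and
      (Metric.tendsto_nhds.1 hlim₀ (ε / 4) (by positivity))).exists
    obtain ⟨n₀, hn₀⟩ := Metric.tendsto_atTop.1 (hSt k) (ε / 4) (by positivity)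
    refine ⟨n₀, fun n hn => ?_⟩
    have h1 := hn₀ n hn
    have h2 := hδ' _ (hU.diff (hSm k)) hk1 n
    have h3 : dist (∫ t in ⋃ i, f i, w n t ∂mu T) (∫ t in S k, w n t ∂mu T) ≤ ε / 4 := by
      rw [dist_eq_norm, ← setIntegral_sdiff (hSm k) (hw n).integrableOn (hSsub k)]
      exact (norm_integral_le_integral_norm _).trans h2
    calc dist (∫ t in ⋃ i, f i, w n t ∂mu T) (∫ t in ⋃ i, f i, w₀ t ∂mu T)
        ≤ dist (∫ t in ⋃ i, f i, w n t ∂mu T) (∫ t in S k, w n t ∂mu T) +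
          dist (∫ t in S k, w n t ∂mu T) (∫ t in S k, w₀ t ∂mu T) +
          dist (∫ t in S k, w₀ t ∂mu T) (∫ t in ⋃ i, f i, w₀ t ∂mu T) := dist_triangle4 _ _ _ _
      _ < ε := by linarith

/-- Linearity reduces the claim to multiples of indicators. Integrability is carried through the
induction so that the integrals can be added. -/
theorem tendsto_integral_simpleFunc {w : ℕ → ℝ → E N} {w₀ : ℝ → E N}
    (hw : ∀ n, Integrable (w n) (mu T)) (hw₀ : Integrable w₀ (mu T))
    (hset : ∀ B, MeasurableSet B →
      Tendsto (fun n => ∫ t in B, w n t ∂mu T) atTop (𝓝 (∫ t in B, w₀ t ∂mu T)))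
    (σ : SimpleFunc ℝ (E N)) :
    Tendsto (fun n => ∫ t, inner ℝ (σ t) (w n t) ∂mu T) atTop
      (𝓝 (∫ t, inner ℝ (σ t) (w₀ t) ∂mu T)) ∧
      (∀ v : ℝ → E N, Integrable v (mu T) → Integrable (fun t => inner ℝ (σ t) (v t)) (mu T)) := by
  induction σ using SimpleFunc.induction with
  | @const c s hs =>
    have e : ∀ v : ℝ → E N, (fun t => inner ℝ ((SimpleFunc.piecewise s hs (SimpleFunc.const _ c)
        (SimpleFunc.const _ 0)) t) (v t)) = s.indicator fun t => inner ℝ c (v t) := by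
      intro v
      funext t
      by_cases ht : t ∈ s <;> simp [ht]
    have hi : ∀ v : ℝ → E N, Integrable v (mu T) →
        Integrable (fun t => inner ℝ c (v t)) (mu T) := fun v hv => hv.const_inner c
    refine ⟨?_, fun v hv => by rw [e]; exact (hi v hv).indicator hs⟩
    have e2 : ∀ v : ℝ → E N, Integrable v (mu T) →
        ∫ t, s.indicator (fun t => inner ℝ c (v t)) t ∂mu T = inner ℝ c (∫ t in s, v t ∂mu T) := by
      intro v hv
      rw [integral_indicator hs, integral_inner hv.integrableOn]
    simp only [e]
    simp_rw [e2 _ (hw _)]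
    rw [e2 _ hw₀]
    exact tendsto_const_nhds.inner (hset s hs)
  | @add σ τ _ h1 h2 =>
    have e : ∀ v : ℝ → E N, (fun t => inner ℝ ((σ + τ) t) (v t))
        = fun t => inner ℝ (σ t) (v t) + inner ℝ (τ t) (v t) := fun v => by
      funext t
      rw [SimpleFunc.coe_add, Pi.add_apply, inner_add_left]
    refine ⟨?_, fun v hv => by rw [e]; exact (h1.2 v hv).add (h2.2 v hv)⟩
    simp only [e]
    simp_rw [fun n => integral_add (h1.2 _ (hw n)) (h2.2 _ (hw n))]
    rw [integral_add (h1.2 _ hw₀) (h2.2 _ hw₀)]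
    exact h1.1.add h2.1

/-- Bounded measurable functions are limits of simple functions in the Orlicz class. -/
theorem YoungFn.exists_simpleFunc_of_bound {Φ : E N → ℝ} (h : YoungFn Φ) {ψ : ℝ → E N}
    (hψ : AEStronglyMeasurable ψ (mu T)) {R : ℝ} (hR : ∀ᵐ t ∂mu T, ‖ψ t‖ ≤ R) :
    ∃ σ : ℕ → SimpleFunc ℝ (E N), (∀ n, MemLG T Φ (σ n)) ∧
      (∀ᵐ t ∂mu T, Tendsto (fun n => σ n t) atTop (𝓝 (ψ t))) ∧
      (∀ᵐ t ∂mu T, ∀ n, ‖ψ t - σ n t‖ ≤ 3 * R) ∧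
      ∀ m : ℝ, Tendsto (fun n => ∫ t, Φ (m • (ψ t - σ n t)) ∂mu T) atTop (𝓝 0) := by
  have hmeas : Measurable (hψ.mk ψ) := hψ.stronglyMeasurable_mk.measurable
  have hae := hψ.ae_eq_mk
  let σ : ℕ → SimpleFunc ℝ (E N) := fun n =>
    SimpleFunc.approxOn (hψ.mk ψ) hmeas univ 0 (mem_univ _) n
  have hlim : ∀ᵐ t ∂mu T, Tendsto (fun n => σ n t) atTop (𝓝 (ψ t)) := by
    filter_upwards [hae] with t ht
    rw [ht]
    exact SimpleFunc.tendsto_approxOn hmeas (mem_univ _) (by simp)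
  have hle : ∀ᵐ t ∂mu T, ∀ n, ‖ψ t - σ n t‖ ≤ 3 * R := by
    filter_upwards [hae, hR] with t ht htR n
    have h1 : ‖σ n t‖ ≤ ‖hψ.mk ψ t‖ + ‖hψ.mk ψ t‖ :=
      SimpleFunc.norm_approxOn_zero_le hmeas (mem_univ _) t n
    rw [← ht] at h1
    linarith [norm_sub_le (ψ t) (σ n t)]
  have hmem : ∀ n, MemLG T Φ (σ n) := fun n => by
    obtain ⟨C, hC⟩ := (σ n).exists_forall_norm_le
    exact h.memLG_of_bound (σ n).aestronglyMeasurable (Eventually.of_forall hC)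
  refine ⟨σ, hmem, hlim, hle, fun m => ?_⟩
  obtain ⟨C, hC, hCb⟩ := exists_bound_on_ball h.cont (|m| * (3 * R))
  have e : (0 : ℝ) = ∫ t : ℝ, (0 : ℝ) ∂mu T := by simp
  rw [e]
  refine tendsto_integral_of_dominated_convergence (fun _ => C)
    (fun n => h.comp_aestronglyMeasurable ((hψ.sub (σ n).aestronglyMeasurable).const_smul m))
    (integrable_const C) (fun n => ?_) ?_
  · filter_upwards [hle] with t ht
    rw [Real.norm_of_nonneg (h.nonneg _)]
    refine hCb _ ?_
    rw [norm_smul, Real.norm_eq_abs]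
    exact mul_le_mul_of_nonneg_left (ht n) (abs_nonneg m)
  · filter_upwards [hlim] with t ht
    have h1 : Tendsto (fun n => m • (ψ t - σ n t)) atTop (𝓝 (m • (ψ t - ψ t))) :=
      (tendsto_const_nhds.sub ht).const_smul m
    rw [sub_self, smul_zero] at h1
    have h2 := (h.cont.tendsto 0).comp h1
    rwa [h.zero] at h2

/-- Simple functions are dense in the Orlicz class. -/
theorem YoungFn.exists_simpleFunc {Φ : E N → ℝ} (h : YoungFn Φ) {ψ : ℝ → E N}
    (hψ : MemLG T Φ ψ) (m : ℝ) {ε : ℝ} (hε : 0 < ε) : ∃ σ : SimpleFunc ℝ (E N), MemLG T Φ σ ∧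
      ∫ t, Φ (m • (ψ t - σ t)) ∂mu T < ε := by
  have hmeas : Measurable (hψ.1.mk ψ) := hψ.1.stronglyMeasurable_mk.measurable
  have hae := hψ.1.ae_eq_mk
  let A : ℕ → Set ℝ := fun k => {t | ‖hψ.1.mk ψ t‖ ≤ k}
  have hA : ∀ k, MeasurableSet (A k) := fun k => measurableSet_le hmeas.norm measurable_const
  let ψk : ℕ → ℝ → E N := fun k => (A k).indicator ψ
  have hψk : ∀ k, AEStronglyMeasurable (ψk k) (mu T) := fun k => hψ.1.indicator (hA k)
  have hψkR : ∀ k, ∀ᵐ t ∂mu T, ‖ψk k t‖ ≤ k := fun k => by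
    filter_upwards [hae] with t ht
    by_cases htA : t ∈ A k
    · simp only [ψk, indicator_of_mem htA, ht]; exact htA
    · simp [ψk, indicator_of_notMem htA]
  have hψkm : ∀ k, MemLG T Φ (ψk k) := fun k => h.memLG_of_bound (hψk k) (hψkR k)
  -- Truncation comes first, simple approximation second. Both errors are measured at the scale 2m,
  -- because splitting m(a + b) by convexity doubles the argument.
  have hlim : Tendsto (fun k => ∫ t, Φ ((2 * m) • (ψ t - ψk k t)) ∂mu T) atTop (𝓝 0) := by
    have e : (0 : ℝ) = ∫ t : ℝ, (0 : ℝ) ∂mu T := by simp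
    rw [e]
    refine tendsto_integral_of_dominated_convergence (fun t => Φ ((2 * m) • ψ t))
      (fun n => h.comp_aestronglyMeasurable ((hψ.1.sub (hψk n)).const_smul (2 * m)))
      (h.memLG_smul hψ (2 * m)).2 (fun k => Eventually.of_forall fun t => ?_)
      (Eventually.of_forall fun t => ?_)
    · rw [Real.norm_of_nonneg (h.nonneg _)]
      by_cases htA : t ∈ A k
      · simp [ψk, indicator_of_mem htA, h.zero, h.nonneg]
      · simp [ψk, indicator_of_notMem htA]
    · refine tendsto_const_nhds.congr' ?_
      filter_upwards [eventually_ge_atTop ⌈‖hψ.1.mk ψ t‖⌉₊] with k hk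
      have htA : t ∈ A k := Nat.ceil_le.1 hk
      simp [ψk, indicator_of_mem htA, h.zero]
  obtain ⟨k, hk⟩ := (hlim.eventually (gt_mem_nhds hε)).exists
  obtain ⟨σ, hσ, -, -, hσlim⟩ := h.exists_simpleFunc_of_bound (hψk k) (hψkR k)
  obtain ⟨n, hn⟩ := ((hσlim (2 * m)).eventually (gt_mem_nhds hε)).exists
  refine ⟨σ n, hσ n, ?_⟩
  have i1 := (h.memLG_smul (h.memLG_sub hψ (hψkm k)) (2 * m)).2.const_mul (1 / 2)
  have i2 := (h.memLG_smul (h.memLG_sub (hψkm k) (hσ n)) (2 * m)).2.const_mul (1 / 2)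
  have h1 : ∫ t, Φ (m • (ψ t - σ n t)) ∂mu T ≤
      ∫ t, (1 / 2 * Φ ((2 * m) • (ψ t - ψk k t)) + 1 / 2 * Φ ((2 * m) • (ψk k t - σ n t))) ∂mu T := by
    refine integral_mono (h.memLG_smul (h.memLG_sub hψ (hσ n)) m).2 (Integrable.add i1 i2)
      fun t => ?_
    have := h.add_le (m • (ψ t - ψk k t)) (m • (ψk k t - σ n t))
    rwa [← smul_add, sub_add_sub_cancel, smul_smul, smul_smul] at this
  rw [integral_add i1 i2, integral_const_mul, integral_const_mul] at h1
  linarith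

theorem abs_integral_inner_le (hG : IsGFunction G) {ψ w : ℝ → E N} (hψ : MemLG T (conj G) ψ)
    (hw : MemLG T G w) {δ : ℝ} (hδ : 0 < δ) : |∫ t, inner ℝ (ψ t) (w t) ∂mu T| ≤
      δ * ((∫ t, conj G (δ⁻¹ • ψ t) ∂mu T) + ∫ t, G (w t) ∂mu T) := by
  have i1 := (hG.conj_young.memLG_smul hψ δ⁻¹).2
  rw [← integral_add i1 hw.2, ← integral_const_mul, ← Real.norm_eq_abs]
  refine norm_integral_le_of_norm_le ((Integrable.add i1 hw.2).const_mul δ)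
    (Eventually.of_forall fun t => ?_)
  have h1 := hG.abs_inner_le (w t) (δ⁻¹ • ψ t)
  rw [inner_smul_left, conj_trivial, abs_mul, abs_of_pos (inv_pos.2 hδ),
    inv_mul_le_iff₀ hδ] at h1
  exact h1

/-- Weak convergence can be tested on simple functions. -/
theorem tendsto_integral_inner_of_simpleFunc (hG : IsGFunction G) {w : ℕ → ℝ → E N} {w₀ ψ : ℝ → E N}
    (hw : ∀ n, MemLG T G (w n)) (hw₀ : Integrable w₀ (mu T)) {C : ℝ}
    (hC : ∀ n, ∫ t, G (w n t) ∂mu T ≤ C)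
    (hset : ∀ B, MeasurableSet B →
      Tendsto (fun n => ∫ t in B, w n t ∂mu T) atTop (𝓝 (∫ t in B, w₀ t ∂mu T)))
    (hψ : MemLG T (conj G) ψ) (hψw : Integrable (fun t => inner ℝ (ψ t) (w₀ t)) (mu T))
    (happ : ∀ ε > 0, ∀ m : ℝ, ∃ σ : SimpleFunc ℝ (E N), MemLG T (conj G) σ ∧
      ∫ t, conj G (m • (ψ t - σ t)) ∂mu T ≤ 1 ∧
      |∫ t, inner ℝ (ψ t - σ t) (w₀ t) ∂mu T| ≤ ε) :
    Tendsto (fun n => ∫ t, inner ℝ (ψ t) (w n t) ∂mu T) atTop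
      (𝓝 (∫ t, inner ℝ (ψ t) (w₀ t) ∂mu T)) := by
  have hC0 : 0 ≤ C := (hG.young.modular_nonneg (w 0)).trans (hC 0)
  rw [Metric.tendsto_atTop]
  intro ε hε
  -- The scaled approximation error has modular at most 1 and the velocities at most C, so the error
  -- term is at most δ(1 + C) = ε/4.
  set δ := ε / (4 * (1 + C)) with hδ
  have hδ0 : 0 < δ := by positivity
  obtain ⟨σ, hσ, hσ1, hσ2⟩ := happ (ε / 4) (by positivity) δ⁻¹
  obtain ⟨ht, hσi⟩ := tendsto_integral_simpleFunc (fun n => hG.young.integrable (hw n)) hw₀ hset σ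
  obtain ⟨n₀, hn₀⟩ := Metric.tendsto_atTop.1 ht (ε / 4) (by positivity)
  refine ⟨n₀, fun n hn => ?_⟩
  have h1 := hn₀ n hn
  have h2 := abs_integral_inner_le hG (hG.conj_young.memLG_sub hψ hσ) (hw n) hδ0
  have h3 : δ * ((∫ t, conj G (δ⁻¹ • (ψ t - σ t)) ∂mu T) + ∫ t, G (w n t) ∂mu T) ≤ ε / 4 := by
    have : δ * (1 + C) = ε / 4 := by rw [hδ]; field_simp
    rw [← this]
    exact mul_le_mul_of_nonneg_left (add_le_add hσ1 (hC n)) hδ0.le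
  have e1 : ∫ t, inner ℝ (ψ t - σ t) (w n t) ∂mu T
      = ∫ t, inner ℝ (ψ t) (w n t) ∂mu T - ∫ t, inner ℝ (σ t) (w n t) ∂mu T := by
    simp_rw [inner_sub_left]
    exact integral_sub (integrable_inner hG hψ (hw n)) (hσi _ (hG.young.integrable (hw n)))
  have e2 : ∫ t, inner ℝ (ψ t - σ t) (w₀ t) ∂mu T
      = ∫ t, inner ℝ (ψ t) (w₀ t) ∂mu T - ∫ t, inner ℝ (σ t) (w₀ t) ∂mu T := by
    simp_rw [inner_sub_left]
    exact integral_sub hψw (hσi _ hw₀)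
  rw [e1] at h2
  rw [e2] at hσ2
  rw [Real.dist_eq] at h1 ⊢
  rw [abs_le] at h2 hσ2
  rw [abs_lt] at h1 ⊢
  constructor <;> linarith

/-- Here w₀ is merely integrable: boundedness of ψ replaces Orlicz membership of the limit, which
`memLG_of_weak_limit` derives from this case. -/
theorem tendsto_integral_inner_bounded (hG : IsGFunction G) {w : ℕ → ℝ → E N} {w₀ ψ : ℝ → E N}
    (hw : ∀ n, MemLG T G (w n)) (hw₀ : Integrable w₀ (mu T)) {C : ℝ}
    (hC : ∀ n, ∫ t, G (w n t) ∂mu T ≤ C)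
    (hset : ∀ B, MeasurableSet B →
      Tendsto (fun n => ∫ t in B, w n t ∂mu T) atTop (𝓝 (∫ t in B, w₀ t ∂mu T)))
    (hψ : AEStronglyMeasurable ψ (mu T)) {R : ℝ} (hR : ∀ᵐ t ∂mu T, ‖ψ t‖ ≤ R) :
    Tendsto (fun n => ∫ t, inner ℝ (ψ t) (w n t) ∂mu T) atTop
      (𝓝 (∫ t, inner ℝ (ψ t) (w₀ t) ∂mu T)) := by
  refine tendsto_integral_inner_of_simpleFunc hG hw hw₀ hC hset
    (hG.conj_young.memLG_of_bound hψ hR) ?_ fun ε hε m => ?_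
  · refine Integrable.mono' (hw₀.norm.const_mul R) (hψ.inner hw₀.1) ?_
    filter_upwards [hR] with t ht
    exact (norm_inner_le_norm _ _).trans (mul_le_mul_of_nonneg_right ht (norm_nonneg _))
  · obtain ⟨σ, hσ, hlim, hb, hmod⟩ := hG.conj_young.exists_simpleFunc_of_bound hψ hR
    have h1 : Tendsto (fun n => ∫ t, inner ℝ (ψ t - σ n t) (w₀ t) ∂mu T) atTop (𝓝 0) := by
      have e : (0 : ℝ) = ∫ t : ℝ, (0 : ℝ) ∂mu T := by simp
      rw [e]
      refine tendsto_integral_of_dominated_convergence (fun t => 3 * R * ‖w₀ t‖)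
        (fun n => (hψ.sub (σ n).aestronglyMeasurable).inner hw₀.1) (hw₀.norm.const_mul _)
        (fun n => ?_) ?_
      · filter_upwards [hb] with t ht
        exact (norm_inner_le_norm _ _).trans (mul_le_mul_of_nonneg_right (ht n) (norm_nonneg _))
      · filter_upwards [hlim] with t ht
        have h2 : Tendsto (fun n => inner ℝ (ψ t - σ n t) (w₀ t)) atTop
            (𝓝 (inner ℝ (ψ t - ψ t) (w₀ t))) :=
          (tendsto_const_nhds.sub ht).inner tendsto_const_nhds
        simpa using h2
    obtain ⟨n, hn1, hn2⟩ := (((hmod m).eventually (gt_mem_nhds one_pos)).and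
      (Metric.tendsto_nhds.1 h1 ε hε)).exists
    rw [Real.dist_eq, sub_zero] at hn2
    exact ⟨σ n, hσ n, hn1.le, hn2.le⟩

/-- With w₀ in the Orlicz class, ψ may be unbounded. The scale `M`, the larger of |m| and δ⁻¹, lets
one simple function serve for the sequence and for its limit. -/
theorem tendsto_integral_inner (hG : IsGFunction G) {w : ℕ → ℝ → E N} {w₀ ψ : ℝ → E N}
    (hw : ∀ n, MemLG T G (w n)) (hw₀ : MemLG T G w₀) {C : ℝ}
    (hC : ∀ n, ∫ t, G (w n t) ∂mu T ≤ C)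
    (hset : ∀ B, MeasurableSet B →
      Tendsto (fun n => ∫ t in B, w n t ∂mu T) atTop (𝓝 (∫ t in B, w₀ t ∂mu T)))
    (hψ : MemLG T (conj G) ψ) :
    Tendsto (fun n => ∫ t, inner ℝ (ψ t) (w n t) ∂mu T) atTop
      (𝓝 (∫ t, inner ℝ (ψ t) (w₀ t) ∂mu T)) := by
  refine tendsto_integral_inner_of_simpleFunc hG hw (hG.young.integrable hw₀) hC hset hψ
    (integrable_inner hG hψ hw₀) fun ε hε m => ?_
  have hC0 := hG.young.modular_nonneg (T := T) w₀
  set C₀ := ∫ t, G (w₀ t) ∂mu T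
  set δ := ε / (1 + C₀) with hδ
  have hδ0 : 0 < δ := by positivity
  set M := max |m| δ⁻¹ with hM
  have hM0 : 0 < M := lt_of_lt_of_le (inv_pos.2 hδ0) (le_max_right _ _)
  obtain ⟨σ, hσ, h1⟩ := hG.conj_young.exists_simpleFunc hψ M one_pos
  have hmono : ∀ r : ℝ, |r| ≤ M → ∫ t, conj G (r • (ψ t - σ t)) ∂mu T ≤ 1 := by
    intro r hr
    refine le_trans (integral_mono (hG.conj_young.memLG_smul (hG.conj_young.memLG_sub hψ hσ) r).2
      (hG.conj_young.memLG_smul (hG.conj_young.memLG_sub hψ hσ) M).2 fun t => ?_) h1.le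
    have e : r • (ψ t - σ t) = (r / M) • (M • (ψ t - σ t)) := by
      rw [smul_smul, div_mul_cancel₀ _ hM0.ne']
    simp only
    rw [e]
    refine hG.conj_young.smul_le_self ?_ _
    rw [abs_div, abs_of_pos hM0, div_le_one hM0]; exact hr
  refine ⟨σ, hσ, hmono m (le_max_left _ _), ?_⟩
  refine (abs_integral_inner_le hG (hG.conj_young.memLG_sub hψ hσ) hw₀ hδ0).trans ?_
  have h2 := hmono δ⁻¹ (by rw [abs_of_pos (inv_pos.2 hδ0)]; exact le_max_right _ _)
  have e : δ * (1 + C₀) = ε := by rw [hδ]; field_simp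
  rw [← e]
  exact mul_le_mul_of_nonneg_left (add_le_add_left h2 _) hδ0.le

/-- Weak limits of velocities stay in the Orlicz class. -/
theorem memLG_of_weak_limit (hG : IsGFunction G) {w : ℕ → ℝ → E N} {w₀ : ℝ → E N}
    (hw : ∀ n, MemLG T G (w n)) (hw₀ : Integrable w₀ (mu T)) {C : ℝ}
    (hC : ∀ n, ∫ t, G (w n t) ∂mu T ≤ C)
    (hset : ∀ B, MeasurableSet B →
      Tendsto (fun n => ∫ t in B, w n t ∂mu T) atTop (𝓝 (∫ t in B, w₀ t ∂mu T))) :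
    MemLG T G w₀ := by
  have hmeas : Measurable (hw₀.1.mk w₀) := hw₀.1.stronglyMeasurable_mk.measurable
  have hae := hw₀.1.ae_eq_mk
  let A : ℕ → Set ℝ := fun k => {t | ‖hw₀.1.mk w₀ t‖ ≤ k}
  have hA : ∀ k, MeasurableSet (A k) := fun k => measurableSet_le hmeas.norm measurable_const
  let wk : ℕ → ℝ → E N := fun k => (A k).indicator w₀
  have hwk : ∀ k, AEStronglyMeasurable (wk k) (mu T) := fun k => hw₀.1.indicator (hA k)
  have hwkR : ∀ k, ∀ᵐ t ∂mu T, ‖wk k t‖ ≤ k := fun k => by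
    filter_upwards [hae] with t ht
    by_cases htA : t ∈ A k
    · simp only [wk, indicator_of_mem htA, ht]; exact htA
    · simp [wk, indicator_of_notMem htA]
  have hwkm : ∀ k, MemLG T G (wk k) := fun k => hG.young.memLG_of_bound (hwk k) (hwkR k)
  have key : ∀ k, ∫ t, G (wk k t) ∂mu T ≤ C := by
    intro k
    obtain ⟨D, hD, hDb⟩ := exists_bound_on_ball hG.continuous_gradient.norm (k : ℝ)
    -- The inequality G(wₙ) ≥ G(w₀) + ⟨∇G(w₀), wₙ − w₀⟩ is integrated over the set where |w₀| ≤ k.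
    -- There the gradient is bounded, so the linear term tends to zero; Fatou's lemma then removes
    -- the truncation.
    let ψ : ℝ → E N := (A k).indicator fun t => gradient G (wk k t)
    have hψm : AEStronglyMeasurable ψ (mu T) :=
      (hG.continuous_gradient.comp_aestronglyMeasurable (hwk k)).indicator (hA k)
    have hψb : ∀ᵐ t ∂mu T, ‖ψ t‖ ≤ D := by
      filter_upwards [hwkR k] with t ht
      exact (norm_indicator_le_norm_self _ _).trans (hDb _ ht)
    have hψi : ∀ v : ℝ → E N, Integrable v (mu T) →
        Integrable (fun t => inner ℝ (ψ t) (v t)) (mu T) := fun v hv => by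
      refine Integrable.mono' (hv.norm.const_mul D) (hψm.inner hv.1) ?_
      filter_upwards [hψb] with t ht
      exact (norm_inner_le_norm _ _).trans (mul_le_mul_of_nonneg_right ht (norm_nonneg _))
    have h1 := tendsto_integral_inner_bounded hG hw hw₀ hC hset hψm hψb
    have h2 : ∀ n, ∫ t, G (wk k t) ∂mu T + (∫ t, inner ℝ (ψ t) (w n t) ∂mu T -
        ∫ t, inner ℝ (ψ t) (w₀ t) ∂mu T) ≤ C := by
      intro n
      have i1 := hψi _ (hG.young.integrable (hw n))
      have i2 := hψi _ hw₀
      have i3 : Integrable (fun t => inner ℝ (ψ t) (w n t) - inner ℝ (ψ t) (w₀ t)) (mu T) :=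
        i1.sub i2
      rw [← integral_sub i1 i2, ← integral_add (hwkm k).2 i3]
      refine le_trans (integral_mono (Integrable.add (hwkm k).2 i3) (hw n).2 fun t => ?_)
        (hC n)
      simp only
      by_cases htA : t ∈ A k
      · have := gradient_inequality hG.convex (hG.differentiableAt (w₀ t)) (w n t)
        simp only [wk, ψ, indicator_of_mem htA]
        rwa [← inner_sub_right]
      · simp [wk, ψ, indicator_of_notMem htA, hG.zero, hG.nonneg]
    have h3 : Tendsto (fun n => ∫ t, G (wk k t) ∂mu T + (∫ t, inner ℝ (ψ t) (w n t) ∂mu T -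
        ∫ t, inner ℝ (ψ t) (w₀ t) ∂mu T)) atTop (𝓝 (∫ t, G (wk k t) ∂mu T + 0)) := by
      refine tendsto_const_nhds.add ?_
      simpa using h1.sub_const (∫ t, inner ℝ (ψ t) (w₀ t) ∂mu T)
    rw [add_zero] at h3
    exact le_of_tendsto' h3 h2
  refine hG.young.memLG_of_lintegral hw₀.1 (ne_top_of_le_ne_top (b := ENNReal.ofReal C)
    ENNReal.ofReal_ne_top (hG.young.lintegral_le_of_tendsto (w := wk) hwk ?_ fun k => ?_))
  · refine Eventually.of_forall fun t => tendsto_const_nhds.congr' ?_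
    filter_upwards [eventually_ge_atTop ⌈‖hw₀.1.mk w₀ t‖⌉₊] with k hk
    have htA : t ∈ A k := Nat.ceil_le.1 hk
    simp [wk, indicator_of_mem htA]
  · rw [← ofReal_integral_eq_lintegral_ofReal (hwkm k).2
      (Eventually.of_forall fun t => hG.nonneg _)]
    exact ENNReal.ofReal_le_ofReal (key k)

/-- Weak convergence in the model space: uniform convergence of the curves, weak convergence and
modular boundedness of the velocities. -/
structure WeakConv {hG : IsGFunction G} (z : ℕ → Sob T hG) (z₀ : Sob T hG) : Prop where
  unif : ∀ ε > 0, ∀ᶠ n in atTop, ∀ t ∈ I T, ‖(z n).pos t - z₀.pos t‖ ≤ ε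
  weak : ∀ ψ : ℝ → E N, MemLG T (conj G) ψ →
    Tendsto (fun n => ∫ t, inner ℝ (ψ t) ((z n).vel t) ∂mu T) atTop
      (𝓝 (∫ t, inner ℝ (ψ t) (z₀.vel t) ∂mu T))
  bound : ∃ C : ℝ, ∀ n, ∫ t, G ((z n).vel t) ∂mu T ≤ C

theorem Sob.dist_pos_le {hG : IsGFunction G} (hT : 0 ≤ T) (z : Sob T hG) {η C : ℝ}
    (hη : 0 ≤ η) (hs : ∀ x, ‖x‖ ≤ η * G x + C) {s t : ℝ} (hs' : s ∈ I T) (ht : t ∈ I T) :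
    dist (z.pos s) (z.pos t) ≤ η * (∫ t, G (z.vel t) ∂mu T) + C * dist s t := by
  have hI : uIcc (-T) T = I T := uIcc_of_le (by linarith)
  have h := z.sum_dist_pos_le hT hη hs (P := (1, fun _ => (s, t)))
    ⟨fun i _ => by rw [hI]; exact ⟨hs', ht⟩, by simp⟩
  simpa using h

theorem integral_Iic_eq {w : ℝ → E N} (hT : 0 ≤ T) (a : ℝ) :
    ∫ t in Iic a, w t ∂mu T = if a < -T then 0 else ∫ t in (-T)..(min a T), w t := by
  rw [Measure.restrict_restrict measurableSet_Iic]
  have e : Iic a ∩ I T = Icc (-T) (min a T) := by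
    ext t; simp only [mem_inter_iff, mem_Iic, mem_Icc, le_min_iff]; tauto
  rw [e]
  split_ifs with h
  · rw [Icc_eq_empty (by rw [not_le]; exact (min_le_left _ _).trans_lt h)]; simp
  · rw [intervalIntegral.integral_of_le (le_min (not_lt.1 h) (by linarith)),
      integral_Icc_eq_integral_Ioc]

/-- Bounded sequences have weakly convergent subsequences. -/
theorem Sob.exists_weakConv {hG : IsGFunction G} (hT : 0 ≤ T) {z : ℕ → Sob T hG} {C : ℝ}
    (hb : ∀ n, ‖(z n).base‖ ≤ C) (hm : ∀ n, ∫ t, G ((z n).vel t) ∂mu T ≤ C) :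
    ∃ ns : ℕ → ℕ, StrictMono ns ∧ ∃ z₀ : Sob T hG, WeakConv (fun k => z (ns k)) z₀ := by
  have hC0 : 0 ≤ C := (norm_nonneg _).trans (hb 0)
  have hTI : T ∈ I T := ⟨by linarith, le_rfl⟩
  have hTI' : -T ∈ I T := ⟨le_rfl, by linarith⟩
  have hI : uIcc (-T) T = I T := uIcc_of_le (by linarith)
  -- uniform bounds
  obtain ⟨C₁, hC₁, hs₁⟩ := hG.young.superlinear 1 one_pos
  have hbd : ∀ n, ∀ t ∈ I T, ‖(z n).pos t‖ ≤ C + (C + C₁ * (2 * T)) := by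
    intro n t ht
    have h1 := (z n).dist_pos_le hT zero_le_one hs₁ ht hTI'
    rw [pos_left, dist_eq_norm, Real.dist_eq] at h1
    have h2 : |t - -T| ≤ 2 * T := by rw [abs_of_nonneg] <;> linarith [ht.1, ht.2]
    have h3 := mul_le_mul_of_nonneg_left h2 hC₁
    have h4 := norm_sub_norm_le ((z n).pos t) (z n).base
    linarith [hm n, hb n]
  -- equi-absolute continuity
  have hAC : ∀ ε > 0, ∃ δ > 0, ∀ n, ∀ P ∈ AbsolutelyContinuousOnInterval.disjWithin (-T) T,
      ∑ i ∈ Finset.range P.1, dist (P.2 i).1 (P.2 i).2 < δ →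
      ∑ i ∈ Finset.range P.1, dist ((z n).pos (P.2 i).1) ((z n).pos (P.2 i).2) ≤ ε := by
    intro ε hε
    have hη : 0 < ε / (2 * (C + 1)) := by positivity
    obtain ⟨C₂, hC₂, hs₂⟩ := hG.young.superlinear _ hη
    refine ⟨ε / (2 * (C₂ + 1)), by positivity, fun n P hP hlt => ?_⟩
    have h1 := (z n).sum_dist_pos_le hT hη.le hs₂ hP
    have h2 := mul_le_mul_of_nonneg_left (hm n) hη.le
    have h3 : ε / (2 * (C + 1)) * C ≤ ε / 2 := by
      rw [div_mul_eq_mul_div, div_le_div_iff₀ (by positivity) (by positivity)]; nlinarith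
    have h4 := mul_le_mul_of_nonneg_left hlt.le hC₂
    have h5 : C₂ * (ε / (2 * (C₂ + 1))) ≤ ε / 2 := by
      rw [mul_div_assoc', div_le_div_iff₀ (by positivity) (by positivity)]; nlinarith
    linarith
  -- Arzelà–Ascoli produces the limit curve, and the weak limit of the velocities is found as its
  -- derivative. No weak compactness theorem for Orlicz spaces enters.
  let f : ℕ → BoundedContinuousFunction (I T) (E N) := fun n =>
    BoundedContinuousFunction.mkOfCompact ⟨(I T).domRestrict (z n).pos,
      ((z n).continuousOn_pos hT).domRestrict⟩
  have hf : ∀ n (t : I T), f n t = (z n).pos t := fun n t => rfl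
  have hequi : Equicontinuous ((↑) : range f → I T → E N) := by
    refine UniformEquicontinuous.equicontinuous (Metric.uniformEquicontinuous_iff.2 fun ε hε => ?_)
    obtain ⟨δ, hδ, h⟩ := hAC (ε / 2) (by positivity)
    refine ⟨δ, hδ, ?_⟩
    rintro s t hst ⟨_, n, rfl⟩
    have := h n (1, fun _ => ((s : ℝ), (t : ℝ)))
      ⟨fun i _ => by rw [hI]; exact ⟨s.2, t.2⟩, by simp⟩ (by simpa [Subtype.dist_eq] using hst)
    simp only [Finset.range_one, Finset.sum_singleton] at this
    rw [← hf, ← hf] at this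
    exact this.trans_lt (by linarith)
  have hcomp := BoundedContinuousFunction.arzela_ascoli _
    (isCompact_closedBall (0 : E N) (C + (C + C₁ * (2 * T)))) (range f)
    (by rintro _ t ⟨n, rfl⟩; simpa [hf] using hbd n t t.2) hequi
  obtain ⟨u₀, -, ns, hns, hlim⟩ := hcomp.tendsto_subseq
    (fun n => subset_closure (mem_range_self n) : ∀ n, f n ∈ closure (range f))
  let u : ℝ → E N := fun t => u₀ (projIcc (-T) T (by linarith) t)
  have hu : ∀ t (ht : t ∈ I T), u t = u₀ ⟨t, ht⟩ := fun t ht => by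
    simp only [u, projIcc_of_mem _ ht]
  have hunif : ∀ ε > 0, ∀ᶠ k in atTop, ∀ t ∈ I T, ‖(z (ns k)).pos t - u t‖ ≤ ε := by
    intro ε hε
    filter_upwards [Metric.tendsto_nhds.1 hlim ε hε] with k hk t ht
    rw [hu t ht, ← dist_eq_norm, ← hf (ns k) ⟨t, ht⟩]
    exact (BoundedContinuousFunction.dist_coe_le_dist _).trans hk.le
  have hptw : ∀ t ∈ I T, Tendsto (fun k => (z (ns k)).pos t) atTop (𝓝 (u t)) := by
    intro t ht
    rw [Metric.tendsto_atTop']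
    intro ε hε
    obtain ⟨k₀, hk₀⟩ := eventually_atTop.1 (hunif (ε / 2) (by positivity))
    refine ⟨k₀, fun k hk => ?_⟩
    rw [dist_eq_norm]
    exact (hk₀ k hk.le t ht).trans_lt (by linarith)
  -- the limit is absolutely continuous
  have huAC : AbsolutelyContinuousOnInterval u (-T) T := by
    rw [absolutelyContinuousOnInterval_iff]
    intro ε hε
    obtain ⟨δ, hδ, h⟩ := hAC (ε / 2) (by positivity)
    refine ⟨δ, hδ, fun P hP hlt => ?_⟩
    have h1 : Tendsto (fun k => ∑ i ∈ Finset.range P.1,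
        dist ((z (ns k)).pos (P.2 i).1) ((z (ns k)).pos (P.2 i).2)) atTop
        (𝓝 (∑ i ∈ Finset.range P.1, dist (u (P.2 i).1) (u (P.2 i).2))) :=
      tendsto_finsetSum _ fun i hi => (hptw _ (hI ▸ (hP.1 i hi).1)).dist
        (hptw _ (hI ▸ (hP.1 i hi).2))
    have h2 := le_of_tendsto' h1 fun k => h (ns k) P hP hlt
    linarith
  have hui := ac_integrable_deriv hT huAC
  have hderiv : ∀ᵐ t, t ∈ uIcc (-T) T → HasDerivAt u (deriv u t) t := by
    filter_upwards [ac_ae_differentiableAt huAC] with t ht htI using (ht htI).hasDerivAt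
  have hueq : ∀ t ∈ I T, u t = u (-T) + ∫ r in (-T)..t, deriv u r := fun t ht =>
    ac_eq_integral huAC (intervalIntegrable_of_integrable hT hui) hderiv (by rw [hI]; exact ht)
  have hint : ∀ t ∈ I T, Tendsto (fun k => ∫ r in (-T)..t, (z (ns k)).vel r) atTop
      (𝓝 (∫ r in (-T)..t, deriv u r)) := by
    intro t ht
    have h1 := (hptw t ht).sub (hptw (-T) hTI')
    have e : ∀ k, (z (ns k)).pos t - (z (ns k)).pos (-T) = ∫ r in (-T)..t, (z (ns k)).vel r :=
      fun k => by rw [pos_left, pos]; abel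
    have e' : u t - u (-T) = ∫ r in (-T)..t, deriv u r := by rw [hueq t ht]; abel
    simpa only [e, e'] using h1
  have htot : Tendsto (fun k => ∫ t, (z (ns k)).vel t ∂mu T) atTop
      (𝓝 (∫ t, deriv u t ∂mu T)) := by
    simp only [← intervalIntegral_eq hT]
    exact hint T hTI
  -- Over initial intervals this is pointwise convergence of the curves; the modular bound supplies
  -- the uniform integrability.
  have hset : ∀ B, MeasurableSet B → Tendsto (fun k => ∫ t in B, (z (ns k)).vel t ∂mu T) atTop
      (𝓝 (∫ t in B, deriv u t ∂mu T)) := by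
    intro B hB
    refine tendsto_setIntegral_of_intervals (fun k => (z (ns k)).integrable_vel) hui ?_ ?_ htot hB
    · intro ε hε
      have hη : 0 < ε / (2 * (C + 1)) := by positivity
      obtain ⟨C₂, hC₂, hs₂⟩ := hG.young.superlinear _ hη
      refine ⟨ε / (2 * (C₂ + 1)), by positivity, fun B _ hlt k => ?_⟩
      have h1 := hG.young.setIntegral_norm_le' hη.le hs₂ (z (ns k)).memLG_vel B
      have h2 := mul_le_mul_of_nonneg_left (hm (ns k)) hη.le
      have h3 : ε / (2 * (C + 1)) * C ≤ ε / 2 := by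
        rw [div_mul_eq_mul_div, div_le_div_iff₀ (by positivity) (by positivity)]; nlinarith
      have h4 := mul_le_mul_of_nonneg_left hlt.le hC₂
      have h5 : C₂ * (ε / (2 * (C₂ + 1))) ≤ ε / 2 := by
        rw [mul_div_assoc', div_le_div_iff₀ (by positivity) (by positivity)]; nlinarith
      linarith
    · intro a
      simp only [integral_Iic_eq hT a]
      split_ifs with h
      · exact tendsto_const_nhds
      · exact hint _ ⟨le_min (not_lt.1 h) (by linarith), min_le_right _ _⟩
  have humem : MemLG T G (deriv u) :=
    memLG_of_weak_limit hG (fun k => (z (ns k)).memLG_vel) hui (fun k => hm (ns k)) hset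
  have hu0 : ∫ t, deriv u t ∂mu T = 0 :=
    tendsto_nhds_unique htot (by simp only [integral_vel]; exact tendsto_const_nhds)
  let z₀ : Sob T hG := Sob.mk (u (-T)) (deriv u) humem hu0
  have hz₀ : ∀ t ∈ I T, z₀.pos t = u t := fun t ht => by
    rw [pos, intervalIntegral_congr_mu (vel_mk _ _ _ _) ht, hueq t ht]; rfl
  refine ⟨ns, hns, z₀, ⟨fun ε hε => ?_, fun ψ hψ => ?_, C, fun k => hm (ns k)⟩⟩
  · filter_upwards [hunif ε hε] with k hk t ht
    rw [hz₀ t ht]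
    exact hk t ht
  · have e : ∫ t, inner ℝ (ψ t) (z₀.vel t) ∂mu T = ∫ t, inner ℝ (ψ t) (deriv u t) ∂mu T := by
      refine integral_congr_ae ?_
      filter_upwards [vel_mk (hG := hG) (u (-T)) (deriv u) humem hu0] with t ht
      simp only [z₀, ht]
    rw [e]
    exact tendsto_integral_inner hG (fun k => (z (ns k)).memLG_vel) humem (fun k => hm (ns k))
      hset hψ

end AnisotropicEL

end
open Set Filter Topology MeasureTheory

noncomputable section

namespace AnisotropicEL

variable {N : ℕ} {T : ℝ} {G : E N → ℝ} {hG : IsGFunction G}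

/-! ### Weak lower semicontinuity and limits of Palais-Smale sequences -/

namespace WeakConv

variable {z : ℕ → Sob T hG} {z₀ : Sob T hG}

theorem exists_bound (h : WeakConv z z₀) :
    ∃ R : ℝ, 0 ≤ R ∧ (∀ n, ∀ t ∈ I T, ‖(z n).pos t‖ ≤ R) ∧ ∀ t ∈ I T, ‖z₀.pos t‖ ≤ R := by
  choose r hr0 hr using fun n => (z n).exists_bound
  obtain ⟨R₀, hR₀, h₀⟩ := z₀.exists_bound
  obtain ⟨n₀, hn₀⟩ := eventually_atTop.1 (h.unif 1 one_pos)
  have hs : 0 ≤ ∑ i ∈ Finset.range n₀, r i := Finset.sum_nonneg fun i _ => hr0 i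
  refine ⟨R₀ + 1 + ∑ i ∈ Finset.range n₀, r i, by linarith, fun n t ht => ?_,
    fun t ht => by linarith [h₀ t ht]⟩
  rcases lt_or_ge n n₀ with hn | hn
  · have := Finset.single_le_sum (f := r) (fun i _ => hr0 i) (Finset.mem_range.2 hn)
    linarith [hr n t ht]
  · have h1 := norm_le_norm_add_norm_sub' ((z n).pos t) (z₀.pos t)
    linarith [hn₀ n hn t ht, h₀ t ht]

theorem tendsto_pos (h : WeakConv z z₀) {t : ℝ} (ht : t ∈ I T) :
    Tendsto (fun n => (z n).pos t) atTop (𝓝 (z₀.pos t)) := by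
  rw [Metric.tendsto_nhds]
  intro ε hε
  filter_upwards [h.unif (ε / 2) (by positivity)] with n hn
  rw [dist_eq_norm]
  linarith [hn t ht]

theorem add_const (hT : 0 ≤ T) (h : WeakConv z z₀) (φ : Sob T hG) :
    WeakConv (fun n => z n + φ) (z₀ + φ) where
  unif ε hε := by
    filter_upwards [h.unif ε hε] with n hn t ht
    rw [Sob.pos_add hT _ _ ht, Sob.pos_add hT _ _ ht, add_sub_add_right_eq_sub]
    exact hn t ht
  weak ψ hψ := by
    have e : ∀ y : Sob T hG, ∫ t, inner ℝ (ψ t) ((y + φ).vel t) ∂mu T =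
        (∫ t, inner ℝ (ψ t) (y.vel t) ∂mu T) + ∫ t, inner ℝ (ψ t) (φ.vel t) ∂mu T := by
      intro y
      rw [← integral_add (integrable_inner hG hψ y.memLG_vel) (integrable_inner hG hψ φ.memLG_vel)]
      refine integral_congr_ae ?_
      filter_upwards [Sob.vel_add y φ] with t h1
      rw [h1, inner_add_right]
    simp only [e]
    exact (h.weak ψ hψ).add_const _
  bound := by
    obtain ⟨C, hC⟩ := h.bound
    obtain ⟨k, C', hk, hC', hle⟩ := hG.young.add_bound 1
    refine ⟨∫ t, (k * G (φ.vel t) + C') ∂mu T + k * C, fun n => ?_⟩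
    have i1 : Integrable (fun t => k * G (φ.vel t) + C') (mu T) :=
      (φ.memLG_vel.2.const_mul k).add (integrable_const C')
    have i2 : Integrable (fun t => k * G ((z n).vel t)) (mu T) := (z n).memLG_vel.2.const_mul k
    have h1 : ∫ t, G ((z n + φ).vel t) ∂mu T ≤
        ∫ t, ((k * G (φ.vel t) + C') + k * G ((z n).vel t)) ∂mu T := by
      refine integral_mono_ae (Sob.memLG_vel _).2 (i1.add i2) ?_
      filter_upwards [Sob.vel_add (z n) φ] with t h2
      have h3 := hle ((z n).vel t) (φ.vel t)
      rw [one_smul] at h3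
      simp only [h2]
      linarith
    rw [integral_add i1 i2, integral_const_mul] at h1
    linarith [mul_le_mul_of_nonneg_left (hC n) hk]

end WeakConv

/-- Uniform continuity on a closed ball. Neither sequence has to converge, which is the situation of
the velocities of a Palais–Smale sequence at a fixed time. -/
theorem tendsto_sub_of_bounded {X Y : Type*} [NormedAddCommGroup X] [ProperSpace X]
    [NormedAddCommGroup Y] {g : X → Y} (hg : Continuous g) {a b : ℕ → X} {R : ℝ}
    (ha : ∀ n, ‖a n‖ ≤ R) (hb : ∀ n, ‖b n‖ ≤ R) (hab : Tendsto (fun n => a n - b n) atTop (𝓝 0)) :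
    Tendsto (fun n => g (a n) - g (b n)) atTop (𝓝 0) := by
  have hu := (isCompact_closedBall (0 : X) R).uniformContinuousOn_of_continuous hg.continuousOn
  rw [Metric.uniformContinuousOn_iff] at hu
  rw [Metric.tendsto_nhds] at hab ⊢
  intro ε hε
  obtain ⟨δ, hδ, h⟩ := hu ε hε
  filter_upwards [hab δ hδ] with n hn
  rw [dist_zero_right, ← dist_eq_norm] at hn ⊢
  exact h _ (by simpa using ha n) _ (by simpa using hb n) hn

namespace Lagr

variable {L : ℝ → E N → E N → ℝ} (hL : Lagr T G L)
include hL

/-- The velocity linearization of the action at a weak limit is weakly continuous. -/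
theorem tendsto_linearized (hT : 0 ≤ T) {z : ℕ → Sob T hG} {z₀ : Sob T hG} (h : WeakConv z z₀) :
    (∀ n, Integrable (fun t => L t ((z n).pos t) (z₀.vel t)) (mu T)) ∧
    (∀ n, Integrable (fun t => inner ℝ (gradV L t ((z n).pos t) (z₀.vel t))
      ((z n).vel t - z₀.vel t)) (mu T)) ∧
    Tendsto (fun n => ∫ t, L t ((z n).pos t) (z₀.vel t) ∂mu T) atTop (𝓝 (actionS L z₀)) ∧
    Tendsto (fun n => ∫ t, inner ℝ (gradV L t ((z n).pos t) (z₀.vel t))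
      ((z n).vel t - z₀.vel t) ∂mu T) atTop (𝓝 0) := by
  obtain ⟨R, hR, hb, hb₀⟩ := h.exists_bound
  have hm := fun n => (z n).aestronglyMeasurable_pos hT
  have hV : ∀ n, MemLG T (conj G) (fun t => gradV L t ((z n).pos t) (z₀.vel t)) := fun n =>
    hL.memLG_gradV hG (hm n) (ae_mem_I.mono (hb n)) z₀.memLG_vel
  have hW : ∀ n, MemLG T G (fun t => (z n).vel t - z₀.vel t) := fun n =>
    hG.young.memLG_sub (z n).memLG_vel z₀.memLG_vel
  have hV₀ := hL.memLG_gradV_sob (hG := hG) hT z₀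
  obtain ⟨h1, -, h3⟩ := hL.tendsto_of_dominated hG (un := fun n => (z n).pos)
    (wn := fun _ => z₀.vel) hm (fun _ => z₀.memLG_vel) (z₀.aestronglyMeasurable_pos hT)
    z₀.memLG_vel (ae_mem_I.mono fun t ht n => hb n t ht)
    (ae_mem_I.mono fun t ht => h.tendsto_pos ht) z₀.memLG_vel.2
    (Eventually.of_forall fun t n => le_rfl) (Eventually.of_forall fun t => tendsto_const_nhds)
  refine ⟨fun n => hL.integrable_comp (hm n) (ae_mem_I.mono (hb n)) z₀.memLG_vel,
    fun n => integrable_inner hG (hV n) (hW n), h1, ?_⟩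
  -- The coefficient is split into its value along the limit curve, to which weak convergence
  -- applies, and a remainder whose G*-modular tends to zero at every scaling.
  have e : ∀ n, ∫ t, inner ℝ (gradV L t ((z n).pos t) (z₀.vel t)) ((z n).vel t - z₀.vel t) ∂mu T =
      (∫ t, inner ℝ (gradV L t ((z n).pos t) (z₀.vel t) - gradV L t (z₀.pos t) (z₀.vel t))
        ((z n).vel t - z₀.vel t) ∂mu T) +
      ((∫ t, inner ℝ (gradV L t (z₀.pos t) (z₀.vel t)) ((z n).vel t) ∂mu T) -
        ∫ t, inner ℝ (gradV L t (z₀.pos t) (z₀.vel t)) (z₀.vel t) ∂mu T) := by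
    intro n
    have j1 := integrable_inner hG hV₀ (z n).memLG_vel
    have j2 := integrable_inner hG hV₀ z₀.memLG_vel
    have j3 : Integrable (fun t => inner ℝ (gradV L t (z₀.pos t) (z₀.vel t)) ((z n).vel t) -
        inner ℝ (gradV L t (z₀.pos t) (z₀.vel t)) (z₀.vel t)) (mu T) := j1.sub j2
    rw [← integral_sub j1 j2,
      ← integral_add (integrable_inner hG (hG.conj_young.memLG_sub (hV n) hV₀) (hW n)) j3]
    refine integral_congr_ae (Eventually.of_forall fun t => ?_)
    simp only [inner_sub_left, inner_sub_right]
    ring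
  simp only [e]
  have hweak := (h.weak _ hV₀).sub_const
    (∫ t, inner ℝ (gradV L t (z₀.pos t) (z₀.vel t)) (z₀.vel t) ∂mu T)
  rw [sub_self] at hweak
  rw [← add_zero (0 : ℝ)]
  refine Tendsto.add ?_ hweak
  obtain ⟨C, hC⟩ := h.bound
  obtain ⟨k, C', hk, hC', hle⟩ := hG.young.sub_bound 1
  set M := k * C + ∫ t, (k * G (z₀.vel t) + C') ∂mu T with hM
  have hbd : ∀ n, ∫ t, G ((z n).vel t - z₀.vel t) ∂mu T ≤ M := by
    intro n
    have i1 : Integrable (fun t => k * G (z₀.vel t) + C') (mu T) :=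
      (z₀.memLG_vel.2.const_mul k).add (integrable_const C')
    have i2 : Integrable (fun t => k * G ((z n).vel t)) (mu T) := (z n).memLG_vel.2.const_mul k
    have h1 : ∫ t, G ((z n).vel t - z₀.vel t) ∂mu T ≤
        ∫ t, (k * G ((z n).vel t) + (k * G (z₀.vel t) + C')) ∂mu T := by
      refine integral_mono (hW n).2 (i2.add i1) fun t => ?_
      have h3 := hle ((z n).vel t) (z₀.vel t)
      rw [one_smul] at h3
      simp only
      linarith
    rw [integral_add i2 i1, integral_const_mul] at h1
    linarith [mul_le_mul_of_nonneg_left (hC n) hk]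
  have hM0 : 0 ≤ M := (integral_nonneg fun t => hG.nonneg _).trans (hbd 0)
  rw [Metric.tendsto_nhds]
  intro ε hε
  have hδ : 0 < ε / (2 * (M + 1)) := by positivity
  filter_upwards [(h3 (ε / (2 * (M + 1)))⁻¹).eventually (gt_mem_nhds one_pos)] with n hn
  rw [Real.dist_eq, sub_zero]
  have h4 := abs_integral_inner_le hG (hG.conj_young.memLG_sub (hV n) hV₀) (hW n) hδ
  refine h4.trans_lt ?_
  rw [div_mul_eq_mul_div, div_lt_iff₀ (by positivity)]
  have := hbd n
  nlinarith

/-- Weak lower semicontinuity of the action. -/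
theorem actionS_le_of_weakConv (hT : 0 ≤ T) {z : ℕ → Sob T hG} {z₀ : Sob T hG}
    (h : WeakConv z z₀) {ε : ℝ} (hε : 0 < ε) :
    ∀ᶠ n in atTop, actionS L z₀ ≤ actionS L (z n) + ε := by
  obtain ⟨i1, i2, h1, h2⟩ := hL.tendsto_linearized hT h
  have h3 := h1.add h2
  rw [add_zero] at h3
  filter_upwards [h3.eventually (lt_mem_nhds (sub_lt_self _ hε))] with n hn
  rw [← integral_add (i1 n) (i2 n)] at hn
  -- By convexity the action lies above its velocity linearization at z₀', and the latter converges
  -- to the action of z₀.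
  have h4 : ∫ t, (L t ((z n).pos t) (z₀.vel t) + inner ℝ (gradV L t ((z n).pos t) (z₀.vel t))
      ((z n).vel t - z₀.vel t)) ∂mu T ≤ actionS L (z n) := by
    refine integral_mono_ae ((i1 n).add (i2 n)) (hL.integrable_sob hT (z n)) ?_
    filter_upwards [ae_mem_I] with t ht
    exact hL.add_inner_gradV_le ht _ _ _
  linarith

/-- Small translations of bounded curves with dominated velocities change the derivative of the
action little. -/
theorem tendsto_dAction_sub (hT : 0 ≤ T) {y : ℕ → Sob T hG} {R : ℝ} {H : ℝ → ℝ}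
    (hR : ∀ k, ∀ t ∈ I T, ‖(y k).pos t‖ ≤ R) (hH : Integrable H (mu T))
    (hle : ∀ᵐ t ∂mu T, ∀ k, G ((y k).vel t) ≤ H t) {r : ℕ → ℝ} (hr : Tendsto r atTop (𝓝 0))
    (hr1 : ∀ k, |r k| ≤ 1) (φ : Sob T hG) :
    Tendsto (fun k => hL.dAction hT (y k + r k • φ) φ - hL.dAction hT (y k) φ) atTop (𝓝 0) := by
  obtain ⟨R', hR', hφR⟩ := φ.exists_bound
  obtain ⟨B, A, hB, hA, hgr⟩ := hL.growth (R + R')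
  obtain ⟨k₂, C₂, hk₂, hC₂, hd₂⟩ := hG.young.doubling 2
  obtain ⟨C₁, hC₁, hs₁⟩ := hG.young.superlinear 1 one_pos
  have hposb : ∀ k, ∀ t ∈ I T, ‖(y k + r k • φ).pos t‖ ≤ R + R' := by
    intro k t ht
    rw [Sob.pos_add hT _ _ ht, Sob.pos_smul _ _ ht]
    refine (norm_add_le _ _).trans (add_le_add (hR k t ht) ?_)
    rw [norm_smul, Real.norm_eq_abs]
    exact (mul_le_of_le_one_left (norm_nonneg _) (hr1 k)).trans (hφR t ht)
  have hveq : ∀ᵐ t ∂mu T, ∀ k, (y k + r k • φ).vel t = (y k).vel t + r k • φ.vel t := by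
    refine ae_all_iff.2 fun k => ?_
    filter_upwards [Sob.vel_add (y k) (r k • φ), Sob.vel_smul (r k) φ] with t h1 h2
    rw [h1, h2]
  set D : ℝ → ℝ := fun t => B t + A * (H t + 1 / 2 * (k₂ * H t + C₂)
    + 1 / 2 * G ((2 : ℝ) • φ.vel t)) with hD
  have hDi : Integrable D (mu T) := hB.add ((((hH.add (((hH.const_mul k₂).add
    (integrable_const C₂)).const_mul (1 / 2))).add
    ((hG.young.memLG_smul φ.memLG_vel 2).2.const_mul (1 / 2)))).const_mul A)
  have hDle : ∀ᵐ t ∂mu T, ∀ k, B t + A * G ((y k + r k • φ).vel t) ≤ D t ∧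
      B t + A * G ((y k).vel t) ≤ D t := by
    filter_upwards [hle, hveq] with t h1 h2 k
    rw [h2 k]
    have a1 := hG.young.add_le ((y k).vel t) (r k • φ.vel t)
    have a2 := hG.young.smul_le_self (hr1 k) ((2 : ℝ) • φ.vel t)
    rw [smul_comm] at a2
    have a3 := hd₂ ((y k).vel t)
    have a4 := mul_le_mul_of_nonneg_left (h1 k) hk₂
    have a5 := hG.nonneg ((y k).vel t)
    have a6 := hG.nonneg ((2 : ℝ) • φ.vel t)
    have a7 : 0 ≤ k₂ * H t := mul_nonneg hk₂ (a5.trans (h1 k))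
    simp only [hD]
    exact ⟨add_le_add_right (mul_le_mul_of_nonneg_left (by linarith [h1 k]) hA) _,
      add_le_add_right (mul_le_mul_of_nonneg_left (by linarith [h1 k]) hA) _⟩
  have e : ∀ k, hL.dAction hT (y k + r k • φ) φ - hL.dAction hT (y k) φ = _ := fun k =>
    Sob.pairing_sub_apply hT (hL.integrable_gradX_sob hT (y k + r k • φ))
      (hL.integrable_gradX_sob hT (y k)) (hL.memLG_gradV_sob hT (y k + r k • φ))
      (hL.memLG_gradV_sob hT (y k)) φ
  simp only [e]
  have hz : (0 : ℝ) = ∫ t : ℝ, (0 : ℝ) ∂mu T := by simp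
  rw [hz]
  refine tendsto_integral_of_dominated_convergence
    (fun t => 2 * D t * R' + 2 * (D t + G (φ.vel t)))
    (fun k => (Sob.integrable_pairing hT ((hL.integrable_gradX_sob hT (y k + r k • φ)).sub
      (hL.integrable_gradX_sob hT (y k))) (hG.conj_young.memLG_sub
      (hL.memLG_gradV_sob hT (y k + r k • φ)) (hL.memLG_gradV_sob hT (y k))) φ).1)
    (((hDi.const_mul 2).mul_const R').add ((hDi.add φ.memLG_vel.2).const_mul 2)) (fun k => ?_) ?_
  · filter_upwards [ae_mem_I, hDle] with t ht h1
    obtain ⟨-, p1, p2⟩ := hgr t ht _ ((y k + r k • φ).vel t) (hposb k t ht)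
    obtain ⟨-, q1, q2⟩ := hgr t ht _ ((y k).vel t) ((hR k t ht).trans (by linarith))
    obtain ⟨h2, h3⟩ := h1 k
    refine (norm_add_le _ _).trans (add_le_add ?_ ?_)
    · refine (norm_inner_le_norm _ _).trans (mul_le_mul ?_ (hφR t ht) (norm_nonneg _) ?_)
      · exact (norm_sub_le _ _).trans (by linarith)
      · linarith [norm_nonneg (gradX L t ((y k).pos t) ((y k).vel t))]
    · rw [inner_sub_left]
      refine (norm_sub_le _ _).trans ?_
      rw [Real.norm_eq_abs, Real.norm_eq_abs]
      linarith [hG.abs_inner_le (φ.vel t) (gradV L t ((y k).pos t) ((y k).vel t)),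
        hG.abs_inner_le (φ.vel t) (gradV L t ((y k + r k • φ).pos t) ((y k + r k • φ).vel t))]
  · filter_upwards [ae_mem_I, hle, hveq] with t ht h1 h2
    have hlim : Tendsto (fun k => ((y k + r k • φ).pos t, (y k + r k • φ).vel t)
        - ((y k).pos t, (y k).vel t)) atTop (𝓝 0) := by
      have : (fun k => ((y k + r k • φ).pos t, (y k + r k • φ).vel t)
          - ((y k).pos t, (y k).vel t)) = fun k => r k • (φ.pos t, φ.vel t) := by
        funext k
        rw [h2 k, Sob.pos_add hT _ _ ht, Sob.pos_smul _ _ ht]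
        simp
      rw [this]
      simpa using hr.smul_const (φ.pos t, φ.vel t)
    -- At fixed t the domination of G and superlinearity keep the velocities in a ball, where the
    -- gradients are uniformly continuous.
    have hb1 : ∀ k, ‖((y k).pos t, (y k).vel t)‖ ≤ (R + R') + (H t + C₁ + ‖φ.vel t‖) := by
      intro k
      have a1 := hs₁ ((y k).vel t)
      rw [Prod.norm_def]
      refine max_le ?_ ?_
      · have := norm_nonneg ((y k).vel t)
        simp only
        linarith [hR k t ht, h1 k, norm_nonneg (φ.vel t)]
      · simp only
        linarith [h1 k, norm_nonneg (φ.vel t), norm_nonneg ((y k).pos t), hR k t ht]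
    have hb2 : ∀ k, ‖((y k + r k • φ).pos t, (y k + r k • φ).vel t)‖ ≤
        (R + R') + (H t + C₁ + ‖φ.vel t‖) := by
      intro k
      have a1 := hs₁ ((y k).vel t)
      rw [Prod.norm_def]
      refine max_le ?_ ?_
      · have := norm_nonneg ((y k).vel t)
        simp only
        linarith [hposb k t ht, h1 k, norm_nonneg (φ.vel t)]
      · simp only [h2 k]
        have a2 := norm_add_le ((y k).vel t) (r k • φ.vel t)
        have a3 : ‖r k • φ.vel t‖ ≤ ‖φ.vel t‖ := by
          rw [norm_smul, Real.norm_eq_abs]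
          exact mul_le_of_le_one_left (norm_nonneg _) (hr1 k)
        linarith [h1 k, norm_nonneg ((y k).pos t), hR k t ht]
    have l1 := tendsto_sub_of_bounded (hL.continuous_gradX ht) hb2 hb1 hlim
    have l2 := tendsto_sub_of_bounded (hL.continuous_gradV ht) hb2 hb1 hlim
    have l3 := (l1.inner (𝕜 := ℝ) (tendsto_const_nhds (x := φ.pos t))).add
      (l2.inner (𝕜 := ℝ) (tendsto_const_nhds (x := φ.vel t)))
    simpa using l3

/-- The velocity is controlled by the convexity defect of the Lagrangian. -/
theorem exists_G_le_defect (hG : IsGFunction G) (R : ℝ) : ∃ (B : ℝ → ℝ) (A c : ℝ),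
    Integrable B (mu T) ∧ 0 ≤ c ∧
    ∀ t ∈ I T, ∀ x v w, ‖x‖ ≤ R → G v ≤
      c * (L t x v - L t x w - inner ℝ (gradV L t x w) (v - w)) + B t + A * G w := by
  obtain ⟨B₁, A, hB₁, hA, h1⟩ := hL.growth R
  obtain ⟨B₂, Λ, hB₂, hΛ, h2⟩ := hL.coercive R
  -- The scale 2/Λ: coercivity times 2/Λ yields 2 G(v), while Fenchel–Young for (2/Λ) L_v against v
  -- costs one G(v), so one copy survives.
  obtain ⟨k, C, hk, hC, hkC⟩ := hG.conj_young.doubling (2 / Λ)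
  refine ⟨fun t => 2 / Λ * (2 * B₁ t + B₂ t) + (k * B₁ t + C), 2 / Λ * (2 * A + 1) + k * A,
    2 / Λ, (((hB₁.const_mul 2).add hB₂).const_mul _).add
      ((hB₁.const_mul k).add (integrable_const C)), by positivity, fun t ht x v w hx => ?_⟩
  obtain ⟨a1, -, a2⟩ := h1 t ht x w hx
  have a3 := h2 t ht x v hx
  have a4 := hG.abs_inner_le v ((2 / Λ) • gradV L t x w)
  have a5 := hG.abs_inner_le w (gradV L t x w)
  have a6 := hkC (gradV L t x w)
  rw [inner_smul_left, conj_trivial] at a4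
  have a7 := mul_le_mul_of_nonneg_left a2 hk
  have hq : 0 < 2 / Λ := by positivity
  rw [inner_sub_right]
  set p := inner ℝ (gradV L t x w) v
  set q := inner ℝ (gradV L t x w) w
  have a8 := (le_abs_self _).trans a4
  have a9 := (neg_le_abs _).trans a5
  have a10 := (le_abs_self _).trans a1
  have a11 : 2 * G v ≤ 2 / Λ * (L t x v + B₂ t) := by
    rw [div_mul_eq_mul_div, le_div_iff₀ hΛ]
    linarith
  have a12 : 2 / Λ * (L t x w - q) ≤ 2 / Λ * (2 * B₁ t + 2 * A * G w + G w) :=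
    mul_le_mul_of_nonneg_left (by linarith) hq.le
  nlinarith

/-- The weak limit of a Palais-Smale sequence is a critical point at the limit level. -/
theorem palaisSmale_limit (hT : 0 ≤ T) {z : ℕ → Sob T hG} {z₀ : Sob T hG} (h : WeakConv z z₀)
    (hPS : Tendsto (fun n => ‖hL.dAction hT (z n)‖) atTop (𝓝 0)) :
    Tendsto (fun n => actionS L (z n)) atTop (𝓝 (actionS L z₀)) ∧ hL.dAction hT z₀ = 0 := by
  obtain ⟨R, hR, hb, hb₀⟩ := h.exists_bound
  obtain ⟨C, hC⟩ := h.bound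
  have hTI' : -T ∈ I T := ⟨le_rfl, by linarith⟩
  obtain ⟨i1, i2, h1, h2⟩ := hL.tendsto_linearized hT h
  have hnorm : ∀ n, ‖z₀ - z n‖ ≤ ‖z₀‖ + (R + (1 + C)) := by
    intro n
    refine (norm_sub_le _ _).trans (add_le_add_right ?_ _)
    rw [Sob.norm_def, ← Sob.pos_left]
    exact add_le_add (hb n _ hTI')
      ((hG.young.luxNorm_le_one_add (z n).memLG_vel).trans (by linarith [hC n]))
  -- the action converges
  obtain ⟨B, A, hB, hA, hgr⟩ := hL.growth R
  have hX : Tendsto (fun n => ∫ t, inner ℝ (gradX L t ((z n).pos t) ((z n).vel t))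
      ((z₀ - z n).pos t) ∂mu T) atTop (𝓝 0) := by
    set M := (∫ t, B t ∂mu T) + A * C with hM
    have hM' : ∀ n, ∫ t, ‖gradX L t ((z n).pos t) ((z n).vel t)‖ ∂mu T ≤ M := by
      intro n
      have i3 : Integrable (fun t => A * G ((z n).vel t)) (mu T) := (z n).memLG_vel.2.const_mul A
      have h3 : ∫ t, ‖gradX L t ((z n).pos t) ((z n).vel t)‖ ∂mu T ≤
          ∫ t, (B t + A * G ((z n).vel t)) ∂mu T := by
        refine integral_mono_ae (hL.integrable_gradX_sob hT (z n)).norm (hB.add i3) ?_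
        filter_upwards [ae_mem_I] with t ht
        exact (hgr t ht _ _ (hb n t ht)).2.1
      rw [integral_add hB i3, integral_const_mul] at h3
      linarith [mul_le_mul_of_nonneg_left (hC n) hA]
    have hM0 : 0 ≤ M := (integral_nonneg fun t => norm_nonneg _).trans (hM' 0)
    rw [Metric.tendsto_nhds]
    intro ε hε
    filter_upwards [h.unif (ε / (M + 1)) (by positivity)] with n hn
    rw [dist_zero_right]
    have h3 : ‖∫ t, inner ℝ (gradX L t ((z n).pos t) ((z n).vel t)) ((z₀ - z n).pos t) ∂mu T‖ ≤
        ∫ t, ‖gradX L t ((z n).pos t) ((z n).vel t)‖ * (ε / (M + 1)) ∂mu T := by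
      refine norm_integral_le_of_norm_le ((hL.integrable_gradX_sob hT (z n)).norm.mul_const _) ?_
      filter_upwards [ae_mem_I] with t ht
      refine (norm_inner_le_norm _ _).trans (mul_le_mul_of_nonneg_left ?_ (norm_nonneg _))
      rw [Sob.pos_sub hT _ _ ht, norm_sub_rev]
      exact hn t ht
    rw [integral_mul_const] at h3
    refine h3.trans_lt ?_
    rw [mul_div_assoc', div_lt_iff₀ (by positivity)]
    nlinarith [hM' n]
  have hdz : Tendsto (fun n => hL.dAction hT (z n) (z₀ - z n)) atTop (𝓝 0) := by
    refine squeeze_zero_norm (fun n => (ContinuousLinearMap.le_opNorm _ _).trans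
      (mul_le_mul_of_nonneg_left (hnorm n) (norm_nonneg _))) ?_
    simpa using hPS.mul_const (‖z₀‖ + (R + (1 + C)))
  -- Convexity at zₙ' tested with z₀'. The velocity pairing is the full derivative in the direction
  -- z₀ − zₙ minus its position part, and both tend to zero.
  have hup : ∀ n, actionS L (z n) ≤ (∫ t, L t ((z n).pos t) (z₀.vel t) ∂mu T) -
      hL.dAction hT (z n) (z₀ - z n) + ∫ t, inner ℝ (gradX L t ((z n).pos t) ((z n).vel t))
      ((z₀ - z n).pos t) ∂mu T := by
    intro n
    have i3 := Sob.integrable_pairing hT (hL.integrable_gradX_sob hT (z n))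
      (hL.memLG_gradV_sob hT (z n)) (z₀ - z n)
    have i4 := Sob.integrable_inner_pos hT (hL.integrable_gradX_sob hT (z n)) (z₀ - z n)
    have i5 : Integrable (fun t => L t ((z n).pos t) (z₀.vel t) -
        (inner ℝ (gradX L t ((z n).pos t) ((z n).vel t)) ((z₀ - z n).pos t) +
          inner ℝ (gradV L t ((z n).pos t) ((z n).vel t)) ((z₀ - z n).vel t))) (mu T) :=
      (i1 n).sub i3
    rw [dAction_apply, ← integral_sub (i1 n) i3, ← integral_add i5 i4]
    refine integral_mono_ae (hL.integrable_sob hT (z n)) (i5.add i4) ?_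
    filter_upwards [ae_mem_I, Sob.vel_sub z₀ (z n)] with t ht h3
    have h4 := hL.add_inner_gradV_le ht ((z n).pos t) ((z n).vel t) (z₀.vel t)
    simp only [h3]
    linarith
  have hlim : Tendsto (fun n => actionS L (z n)) atTop (𝓝 (actionS L z₀)) := by
    have h3 := (h1.sub hdz).add hX
    rw [sub_zero, add_zero] at h3
    rw [Metric.tendsto_nhds]
    intro ε hε
    filter_upwards [hL.actionS_le_of_weakConv hT h (half_pos hε),
      h3.eventually (gt_mem_nhds (lt_add_of_pos_right _ hε))] with n a1 a2
    rw [Real.dist_eq, abs_lt]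
    constructor
    · linarith
    · linarith [hup n]
  refine ⟨hlim, ?_⟩
  -- a subsequence with dominated velocities
  set D : ℕ → ℝ → ℝ := fun n t => max 0 (L t ((z n).pos t) ((z n).vel t)
    - L t ((z n).pos t) (z₀.vel t)
    - inner ℝ (gradV L t ((z n).pos t) (z₀.vel t)) ((z n).vel t - z₀.vel t)) with hD
  have hDeq : ∀ n, D n =ᵐ[mu T] fun t => L t ((z n).pos t) ((z n).vel t)
      - L t ((z n).pos t) (z₀.vel t)
      - inner ℝ (gradV L t ((z n).pos t) (z₀.vel t)) ((z n).vel t - z₀.vel t) := by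
    intro n
    filter_upwards [ae_mem_I] with t ht
    have h4 := hL.add_inner_gradV_le ht ((z n).pos t) (z₀.vel t) ((z n).vel t)
    exact max_eq_right (by linarith)
  have iD : ∀ n, Integrable (fun t => L t ((z n).pos t) ((z n).vel t)
      - L t ((z n).pos t) (z₀.vel t)) (mu T) := fun n => (hL.integrable_sob hT (z n)).sub (i1 n)
  -- The integral of the convexity defect tends to zero because the action and its linearization
  -- have the same limit. The maximum with 0 in `D` only serves times outside I, where convexity is
  -- not assumed.
  obtain ⟨ns, hns, H, hH, hle, -⟩ := exists_dominated_subseq (a := D) (T := T)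
    (fun n t => le_max_left _ _)
    (fun n => (((iD n).sub (i2 n)).congr (hDeq n).symm)) (by
      have e : ∀ n, ∫ t, D n t ∂mu T = actionS L (z n) - (∫ t, L t ((z n).pos t) (z₀.vel t) ∂mu T)
          - ∫ t, inner ℝ (gradV L t ((z n).pos t) (z₀.vel t)) ((z n).vel t - z₀.vel t) ∂mu T := by
        intro n
        rw [integral_congr_ae (hDeq n), integral_sub (iD n) (i2 n),
          integral_sub (hL.integrable_sob hT (z n)) (i1 n)]
        rfl
      simp only [e]
      simpa using (hlim.sub h1).sub h2)
  obtain ⟨B', A', c', hB', hc', hdef⟩ := hL.exists_G_le_defect hG R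
  set H' : ℝ → ℝ := fun t => c' * H t + B' t + A' * G (z₀.vel t) with hH'
  have hHi : Integrable H' (mu T) := ((hH.const_mul c').add hB').add (z₀.memLG_vel.2.const_mul A')
  have hGle : ∀ᵐ t ∂mu T, ∀ k, G ((z (ns k)).vel t) ≤ H' t := by
    filter_upwards [hle, ae_mem_I, ae_all_iff.2 hDeq] with t a1 a2 a3 k
    have a4 := hdef t a2 _ ((z (ns k)).vel t) (z₀.vel t) (hb (ns k) t a2)
    have a5 := a1 k
    rw [a3 (ns k)] at a5
    have := mul_le_mul_of_nonneg_left a5 hc'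
    simp only [hH']
    linarith
  -- the derivative is nonpositive in every direction
  have key : ∀ φ : Sob T hG, hL.dAction hT z₀ φ ≤ 0 := by
    intro φ
    have hs : ∀ k : ℕ, (0 : ℝ) < 1 / ((k : ℝ) + 1) := fun k => by positivity
    -- For the step s = 1/(k+1) both errors in the action are at most s², so they vanish after
    -- division by s. Lower semicontinuity is applied to the translated sequence zₙ + sφ.
    have hchoose : ∀ k : ℕ, ∃ j : ℕ,
        actionS L (z₀ + (1 / ((k : ℝ) + 1)) • φ) ≤
          actionS L (z (ns j) + (1 / ((k : ℝ) + 1)) • φ) + (1 / ((k : ℝ) + 1)) ^ 2 ∧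
        actionS L (z (ns j)) ≤ actionS L z₀ + (1 / ((k : ℝ) + 1)) ^ 2 ∧
        ‖hL.dAction hT (z (ns j))‖ ≤ 1 / ((k : ℝ) + 1) := by
      intro k
      have b1 := hL.actionS_le_of_weakConv hT (h.add_const hT ((1 / ((k : ℝ) + 1)) • φ))
        (pow_pos (hs k) 2)
      have b2 := hlim.eventually (ge_mem_nhds (lt_add_of_pos_right _ (pow_pos (hs k) 2)))
      have b3 := hPS.eventually (ge_mem_nhds (hs k))
      obtain ⟨j, hj⟩ := (hns.tendsto_atTop.eventually (b1.and (b2.and b3))).exists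
      exact ⟨j, hj⟩
    choose j c1 c2 c3 using hchoose
    have hmv : ∀ k : ℕ, ∃ s ∈ Ioo (0 : ℝ) 1,
        actionS L (z (ns (j k)) + (1 / ((k : ℝ) + 1)) • φ) - actionS L (z (ns (j k))) =
        (1 / ((k : ℝ) + 1)) *
          hL.dAction hT (z (ns (j k)) + (s * (1 / ((k : ℝ) + 1))) • φ) φ := by
      intro k
      obtain ⟨s, hs, h5⟩ := hL.actionS_sub_eq hT (z (ns (j k))) ((1 / ((k : ℝ) + 1)) • φ)
      refine ⟨s, hs, ?_⟩
      rw [h5, map_smul, smul_eq_mul, smul_smul]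
    choose s hs01 hmv using hmv
    have hs1 : Tendsto (fun k : ℕ => 1 / ((k : ℝ) + 1)) atTop (𝓝 0) :=
      tendsto_one_div_add_atTop_nhds_zero_nat
    have hle1 : ∀ k : ℕ, 1 / ((k : ℝ) + 1) ≤ 1 := fun k => by
      rw [div_le_one (by positivity)]; linarith [Nat.cast_nonneg (α := ℝ) k]
    have hr0 : ∀ k, 0 ≤ s k * (1 / ((k : ℝ) + 1)) := fun k =>
      mul_nonneg (hs01 k).1.le (hs k).le
    have hrle : ∀ k, s k * (1 / ((k : ℝ) + 1)) ≤ 1 / ((k : ℝ) + 1) := fun k =>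
      mul_le_of_le_one_left (hs k).le (hs01 k).2.le
    have hdiff := hL.tendsto_dAction_sub hT (y := fun k => z (ns (j k))) (fun k => hb _) hHi
      (hGle.mono fun t ht k => ht (j k)) (r := fun k => s k * (1 / ((k : ℝ) + 1)))
      (squeeze_zero hr0 hrle hs1)
      (fun k => by rw [abs_of_nonneg (hr0 k)]; exact (hrle k).trans (hle1 k)) φ
    have hder := (hL.hasDerivAt_actionS hT z₀ φ).tendsto_slope
    have hder' := hder.comp (tendsto_nhdsWithin_iff.2
      ⟨hs1, Eventually.of_forall fun k => (hs k).ne'⟩)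
    have hbnd : Tendsto (fun k : ℕ => 2 * (1 / ((k : ℝ) + 1)) +
        (hL.dAction hT (z (ns (j k)) + (s k * (1 / ((k : ℝ) + 1))) • φ) φ
          - hL.dAction hT (z (ns (j k))) φ) + 1 / ((k : ℝ) + 1) * ‖φ‖) atTop (𝓝 0) := by
      simpa using ((hs1.const_mul 2).add hdiff).add (hs1.mul_const ‖φ‖)
    -- The quotient at z₀ exceeds the one at the chosen zₙ by at most 2s. The latter is a derivative
    -- at zₙ + rφ with r ≤ s, close to the derivative at zₙ, whose norm is at most s.
    refine le_of_tendsto_of_tendsto' hder' hbnd fun k => ?_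
    simp only [Function.comp, slope_def_field, sub_zero, zero_smul, add_zero]
    rw [div_le_iff₀ (hs k)]
    have d1 := (le_abs_self _).trans ((hL.dAction hT (z (ns (j k)))).le_opNorm φ)
    have d2 := mul_le_mul_of_nonneg_right (c3 k) (norm_nonneg φ)
    have d3 := mul_le_mul_of_nonneg_right (d1.trans d2) (hs k).le
    have d4 := hmv k
    have d5 := c1 k
    have d6 := c2 k
    nlinarith
  refine ContinuousLinearMap.ext fun φ => le_antisymm (key φ) ?_
  have := key (-φ)
  rw [map_neg] at this
  simpa using this

end Lagr

end AnisotropicEL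

end
open Set Filter Topology MeasureTheory

noncomputable section

namespace AnisotropicEL

variable {N : ℕ} {T : ℝ} {G : E N → ℝ} {hG : IsGFunction G}

/-! ### Critical points solve the Euler-Lagrange equation -/

theorem ac_inner {P Q : ℝ → E N} {a b : ℝ} (hP : AbsolutelyContinuousOnInterval P a b)
    (hQ : AbsolutelyContinuousOnInterval Q a b) :
    AbsolutelyContinuousOnInterval (fun t => inner ℝ (P t) (Q t)) a b := by
  have h0 : AbsolutelyContinuousOnInterval (0 : ℝ → ℝ) a b :=
    ac_of_dist_le hP fun x _ y _ => by simp
  have e : (fun t => inner ℝ (P t) (Q t)) = ∑ i, ((fun t => Q t i) * fun t => P t i) := by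
    funext t
    simp [PiLp.inner_apply, Finset.sum_apply]
  rw [e]
  exact Finset.sum_induction _ (fun s => AbsolutelyContinuousOnInterval s a b)
    (fun _ _ h1 h2 => h1.add h2) h0 fun i _ => (ac_coord hQ i).mul (ac_coord hP i)

/-- Integration by parts. -/
theorem integral_inner_add_inner (hT : 0 ≤ T) {P Q a b : ℝ → E N}
    (hP : AbsolutelyContinuousOnInterval P (-T) T) (hQ : AbsolutelyContinuousOnInterval Q (-T) T)
    (ha : ∀ᵐ t ∂mu T, HasDerivAt P (a t) t) (hb : ∀ᵐ t ∂mu T, HasDerivAt Q (b t) t) :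
    ∫ t, (inner ℝ (P t) (b t) + inner ℝ (a t) (Q t)) ∂mu T =
      inner ℝ (P T) (Q T) - inner ℝ (P (-T)) (Q (-T)) := by
  rw [← (ac_inner hP hQ).integral_deriv_eq_sub, intervalIntegral_eq hT]
  refine integral_congr_ae ?_
  filter_upwards [ha, hb] with t h1 h2
  exact (h1.inner ℝ h2).deriv.symm

/-- The lemma of Du Bois-Reymond for periodic test curves. -/
theorem exists_ac_of_pairing_eq_zero (hT : 0 < T) {a ψ : ℝ → E N} (ha : Integrable a (mu T))
    (hψ : MemLG T (conj G) ψ)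
    (h : ∀ φ : Sob T hG, ∫ t, (inner ℝ (a t) (φ.pos t) + inner ℝ (ψ t) (φ.vel t)) ∂mu T = 0) :
    ∃ p : ℝ → E N, AbsolutelyContinuousOnInterval p (-T) T ∧ (∀ᵐ t ∂mu T, p t = ψ t) ∧
      ∀ᵐ t ∂mu T, HasDerivAt p (a t) t := by
  set Q : ℝ → E N := fun t => ∫ r in (-T)..t, a r with hQ
  have hQac : AbsolutelyContinuousOnInterval Q (-T) T :=
    ac_intervalIntegral (intervalIntegrable_of_integrable hT.le ha)
  have hQd : ∀ᵐ t ∂mu T, HasDerivAt Q (a t) t := by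
    rw [ae_mu_iff hT.le]
    filter_upwards [(intervalIntegrable_of_integrable hT.le ha).ae_hasDerivAt_integral] with t ht htI
    exact ht htI _ left_mem_uIcc
  have hQ0 : Q (-T) = 0 := by simp [hQ]
  -- Constant test curves show that a has mean zero. Hence Q vanishes at both ends and integration
  -- by parts leaves no boundary term.
  have hQT : Q T = 0 := by
    refine ext_inner_right ℝ fun e => ?_
    have h1 := h (Sob.mk e (fun _ => 0) hG.young.memLG_zero (by simp))
    have hv := Sob.vel_mk (hG := hG) e (fun _ => 0) (hG.young.memLG_zero (T := T)) (by simp)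
    have h2 : ∫ t, inner ℝ e (a t) ∂mu T = 0 := by
      rw [← h1]
      refine integral_congr_ae ?_
      filter_upwards [hv, ae_mem_I] with t h3 ht
      rw [h3, Sob.pos, Sob.base_mk, intervalIntegral_congr_mu hv ht]
      simp [real_inner_comm]
    rw [integral_inner ha] at h2
    rw [hQ]
    simp only
    rw [intervalIntegral_eq hT.le, inner_zero_left, real_inner_comm, h2]
  have hQm : AEStronglyMeasurable Q (mu T) := by
    have := hQac.continuousOn
    rw [uIcc_of_le (by linarith)] at this
    exact this.aestronglyMeasurable measurableSet_Icc
  have hQb : ∀ t ∈ I T, ‖Q t‖ ≤ ∫ r, ‖a r‖ ∂mu T := fun t ht =>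
    norm_intervalIntegral_le ha ⟨le_rfl, by linarith⟩ ht
  have hQLG : MemLG T (conj G) Q := hG.conj_young.memLG_of_bound hQm (ae_mem_I.mono hQb)
  set k : ℝ → E N := fun t => ψ t - Q t with hk
  have hkLG : MemLG T (conj G) k := hG.conj_young.memLG_sub hψ hQLG
  have hki : Integrable k (mu T) := hG.conj_young.integrable hkLG
  have key : ∀ φ : Sob T hG, ∫ t, inner ℝ (k t) (φ.vel t) ∂mu T = 0 := by
    intro φ
    have h1 := integral_inner_add_inner hT.le hQac (Sob.ac_pos hT.le φ) hQd
      (Sob.hasDerivAt_pos hT.le φ)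
    rw [hQ0, hQT, inner_zero_left, inner_zero_left, sub_zero] at h1
    have i1 := Sob.integrable_pairing hT.le ha hψ φ
    have i2 : Integrable (fun t => inner ℝ (Q t) (φ.vel t) + inner ℝ (a t) (φ.pos t)) (mu T) :=
      (integrable_inner hG hQLG φ.memLG_vel).add (Sob.integrable_inner_pos hT.le ha φ)
    have h2 := integral_sub i1 i2
    rw [h1, h φ, sub_zero] at h2
    rw [← h2]
    refine integral_congr_ae (Eventually.of_forall fun t => ?_)
    simp only [hk, inner_sub_left]
    ring
  set c : E N := (2 * T)⁻¹ • ∫ t, k t ∂mu T with hc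
  have hkc : (fun t => k t - c) =ᵐ[mu T] 0 := by
    refine Integrable.ae_eq_zero_of_forall_setIntegral_eq_zero (hki.sub (integrable_const c))
      fun A hA _ => ?_
    refine ext_inner_right ℝ fun e => ?_
    -- The test velocity is e on A, corrected by its mean over I. Pairing it with k shows that k − c
    -- has zero integral over A in every direction e.
    set m : ℝ := (mu T).real A with hm
    have hbd : ∀ t, ‖A.indicator (fun _ => e) t - (m * (2 * T)⁻¹) • e‖ ≤
        ‖e‖ + ‖(m * (2 * T)⁻¹) • e‖ := fun t =>
      (norm_sub_le _ _).trans (add_le_add_left (norm_indicator_le_norm_self (fun _ => e) t) _)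
    have hiA : Integrable (A.indicator (fun _ : ℝ => e)) (mu T) := (integrable_const e).indicator hA
    have hw : MemLG T G (fun t => A.indicator (fun _ => e) t - (m * (2 * T)⁻¹) • e) :=
      hG.young.memLG_of_bound (hiA.1.sub aestronglyMeasurable_const) (Eventually.of_forall hbd)
    have hw0 : ∫ t, (A.indicator (fun _ => e) t - (m * (2 * T)⁻¹) • e) ∂mu T = 0 := by
      rw [integral_sub hiA (integrable_const _), integral_indicator hA, integral_const,
        integral_const, mu_real_univ hT.le, Measure.real, Measure.restrict_apply_univ, smul_smul]
      rw [hm, Measure.real]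
      have : 2 * T * ((mu T A).toReal * (2 * T)⁻¹) = (mu T A).toReal := by field_simp
      rw [this, sub_self]
    have h1 := key (Sob.mk 0 _ hw hw0)
    have h2 : ∫ t, inner ℝ (k t) ((Sob.mk 0 _ hw hw0 : Sob T hG).vel t) ∂mu T =
        ∫ t, (A.indicator (fun t => inner ℝ e (k t)) t - (m * (2 * T)⁻¹) * inner ℝ e (k t))
          ∂mu T := by
      refine integral_congr_ae ?_
      filter_upwards [Sob.vel_mk (hG := hG) 0 _ hw hw0] with t ht
      rw [ht, inner_sub_right, inner_smul_right, real_inner_comm e (k t)]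
      congr 1
      by_cases htA : t ∈ A <;> simp [htA, real_inner_comm]
    have i3 : Integrable (fun t => inner ℝ e (k t)) (mu T) := hki.const_inner e
    rw [h1, integral_sub (i3.indicator hA) (i3.const_mul _), integral_indicator hA,
      integral_const_mul, integral_inner hki, integral_inner hki.integrableOn] at h2
    rw [integral_sub hki.integrableOn (integrable_const c), integral_const, inner_sub_left, hc,
      Measure.real, Measure.restrict_apply_univ, inner_zero_left, inner_smul_left, inner_smul_left,
      real_inner_comm, real_inner_comm e]
    simp only [conj_trivial]
    rw [hm, Measure.real] at h2
    linarith
  refine ⟨fun t => Q t + c, ?_, ?_, ?_⟩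
  · exact ac_of_dist_le hQac fun x _ y _ => by simp
  · filter_upwards [hkc] with t ht
    simp only [hk, Pi.zero_apply] at ht
    rw [sub_eq_zero, sub_eq_iff_eq_add] at ht
    rw [ht, add_comm]
  · filter_upwards [hQd] with t ht using ht.add_const c

theorem action_eq_actionS (hT : 0 ≤ T) (hG : IsGFunction G) (L : ℝ → E N → E N → ℝ)
    {u : ℝ → E N} (hu : u ∈ WT T G) : action T L u = actionS L (toSob hT hG hu) := by
  refine integral_congr_ae ?_
  filter_upwards [ae_mem_I, vel_toSob hT hG hu] with t ht h1
  rw [pos_toSob hT hG hu ht, h1]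

theorem action_pos (hT : 0 ≤ T) (L : ℝ → E N → E N → ℝ) (z : Sob T hG) :
    action T L z.pos = actionS L z := by
  rw [action_eq_actionS hT hG L (Sob.pos_mem_WT hT z), toSob_pos]

namespace Lagr

variable {L : ℝ → E N → E N → ℝ} (hL : Lagr T G L)
include hL

theorem isPeriodicSolution (hT : 0 < T) {z : Sob T hG} (hz : hL.dAction hT.le z = 0) :
    IsPeriodicSolution T G L z.pos := by
  refine ⟨Sob.pos_mem_WT hT.le z, ?_⟩
  obtain ⟨p, h1, h2, h3⟩ := exists_ac_of_pairing_eq_zero hT (hL.integrable_gradX_sob hT.le z)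
    (hL.memLG_gradV_sob hT.le z) (fun φ => by rw [← hL.dAction_apply hT.le, hz]; rfl)
  refine ⟨p, h1, ?_, ?_⟩
  · filter_upwards [h2, Sob.deriv_pos hT.le z] with t a1 a2
    rw [a1, a2]; rfl
  · filter_upwards [h3, Sob.deriv_pos hT.le z] with t a1 a2
    rw [a2]; exact a1

theorem isCriticalPoint (hT : 0 < T) {z : Sob T hG} (hz : hL.dAction hT.le z = 0) :
    IsCriticalPoint T G (action T L) z.pos := by
  refine ⟨Sob.pos_mem_WT hT.le z, fun ε hε => ?_⟩
  obtain ⟨K, hK, hle⟩ := exists_norm_toSob_le hT hG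
  have h1 := hL.hasFDerivAt_actionS hT.le z
  rw [hz, hasFDerivAt_iff_isLittleO_nhds_zero, Asymptotics.isLittleO_iff] at h1
  obtain ⟨δ, hδ, h2⟩ := Metric.eventually_nhds_iff.1 (h1 (div_pos hε hK))
  refine ⟨δ / K, by positivity, fun φ hφ hlt => ?_⟩
  have h3 := hle φ hφ
  rw [lt_div_iff₀ hK] at hlt
  have h4 := @h2 (toSob hT.le hG hφ) (by rw [dist_zero_right]; linarith)
  have hadd := (WT_add hT.le hG (Sob.pos_mem_WT hT.le z) hφ).1
  rw [action_pos hT.le, action_eq_actionS hT.le hG L hadd,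
    toSob_add hT.le hG (Sob.pos_mem_WT hT.le z) hφ hadd, toSob_pos]
  simp only [zero_apply, sub_zero, Real.norm_eq_abs] at h4
  refine h4.trans ((mul_le_mul_of_nonneg_left h3 (by positivity)).trans (le_of_eq ?_))
  field_simp

end Lagr

end AnisotropicEL

end
open Set Filter Topology MeasureTheory

noncomputable section

namespace AnisotropicEL

variable {N : ℕ} {T : ℝ} {G : E N → ℝ}

/-! ### The Lagrangian `F + V + ⟨f, x⟩` -/

/-! ### Measurability and partial gradients of functions on I × X. -/

section Caratheodory

variable {X : Type*} [NormedAddCommGroup X]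

/-- Continuity is available only over I, so time is clamped to I by `projIcc`; this does not change
the composition on I. -/
theorem aestronglyMeasurable_comp_of_continuousOn (hT : 0 < T) {Y : Type*} [TopologicalSpace Y]
    [TopologicalSpace.PseudoMetrizableSpace Y] {g : ℝ × X → Y}
    (hg : ContinuousOn g (I T ×ˢ univ)) {q : ℝ → X} (hq : AEStronglyMeasurable q (mu T)) :
    AEStronglyMeasurable (fun t => g (t, q t)) (mu T) := by
  have hTT : -T ≤ T := by linarith
  have hc : Continuous fun p : ℝ × X => g ((projIcc (-T) T hTT p.1 : ℝ), p.2) := by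
    refine hg.comp_continuous ?_ fun p => ⟨(projIcc (-T) T hTT p.1).2, mem_univ _⟩
    exact ((continuous_subtype_val.comp continuous_projIcc).comp continuous_fst).prodMk
      continuous_snd
  refine (hc.comp_aestronglyMeasurable
    (measurable_id.aestronglyMeasurable.prodMk hq)).congr ?_
  filter_upwards [ae_mem_I] with t ht
  simp only [id]
  rw [projIcc_of_mem _ ht]

variable [NormedSpace ℝ X]

theorem uniqueDiffOn_I (hT : 0 < T) : UniqueDiffOn ℝ (I T ×ˢ (univ : Set X)) :=
  (uniqueDiffOn_Icc (by linarith)).prod uniqueDiffOn_univ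

/-- The partial gradient along a family of directions, as a function on the whole domain. -/
def partialGrad (T : ℝ) (f : ℝ × X → ℝ) (ι : E N →L[ℝ] X) (p : ℝ × X) : E N :=
  (InnerProductSpace.toDual ℝ (E N)).symm
    ((fderivWithin ℝ f (I T ×ˢ univ) p).comp ((ContinuousLinearMap.inr ℝ ℝ X).comp ι))

variable {f : ℝ × X → ℝ} (hf : ContDiffOn ℝ 1 f (I T ×ˢ univ))
include hf

theorem continuousOn_partialGrad (hT : 0 < T) (ι : E N →L[ℝ] X) :
    ContinuousOn (partialGrad T f ι) (I T ×ˢ univ) :=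
  (InnerProductSpace.toDual ℝ (E N)).symm.continuous.comp_continuousOn
    ((hf.continuousOn_fderivWithin (uniqueDiffOn_I hT) le_rfl).clm_comp continuousOn_const)

/-- Moving only in the space variable stays inside I × X, so a within-derivative yields a genuine
derivative, even at the end times. -/
theorem hasFDerivAt_partial {t : ℝ} (ht : t ∈ I T) {c : E N → X} {ι : E N →L[ℝ] X} {y : E N}
    (hc : HasFDerivAt c ι y) : HasFDerivAt (fun y => f (t, c y))
      ((fderivWithin ℝ f (I T ×ˢ univ) (t, c y)).comp ((ContinuousLinearMap.inr ℝ ℝ X).comp ι))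
      y := by
  have h1 : HasFDerivWithinAt f (fderivWithin ℝ f (I T ×ˢ univ) (t, c y)) (I T ×ˢ univ) (t, c y) :=
    (hf.differentiableOn one_ne_zero _ ⟨ht, mem_univ _⟩).hasFDerivWithinAt
  have h2 : HasFDerivAt (fun y => (t, c y)) ((ContinuousLinearMap.inr ℝ ℝ X).comp ι) y :=
    (hasFDerivAt_prodMk_right t (c y)).comp y hc
  have hm : MapsTo (fun y => (t, c y)) univ (I T ×ˢ univ) := fun _ _ => ⟨ht, mem_univ _⟩
  have h3 := HasFDerivWithinAt.comp (s := univ) y h1 h2.hasFDerivWithinAt hm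
  exact hasFDerivWithinAt_univ.1 h3

theorem gradient_partial {t : ℝ} (ht : t ∈ I T) {c : E N → X} {ι : E N →L[ℝ] X} {y : E N}
    (hc : HasFDerivAt c ι y) : gradient (fun y => f (t, c y)) y = partialGrad T f ι (t, c y) := by
  rw [gradient, (hasFDerivAt_partial hf ht hc).fderiv]
  rfl

end Caratheodory

/-! ### Gradients, growth and coercivity of F + V + ⟨f, x⟩. -/

section Specific

variable {F : ℝ → E N → E N → ℝ} {V : ℝ → E N → ℝ} {f : ℝ → E N}
  (hF : ContDiffOn ℝ 1 (fun p : ℝ × E N × E N => F p.1 p.2.1 p.2.2) (I T ×ˢ univ))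
  (hV : ContDiffOn ℝ 1 (fun p : ℝ × E N => V p.1 p.2) (I T ×ˢ univ))

include hF in
theorem gradX_eq_partialGrad {t : ℝ} (ht : t ∈ I T) (x v : E N) : gradX F t x v =
    partialGrad T (fun p : ℝ × E N × E N => F p.1 p.2.1 p.2.2)
      (ContinuousLinearMap.inl ℝ (E N) (E N)) (t, x, v) :=
  gradient_partial hF ht (c := fun y => (y, v)) (hasFDerivAt_prodMk_left x v)

include hF in
theorem gradV_eq_partialGrad {t : ℝ} (ht : t ∈ I T) (x v : E N) : gradV F t x v =
    partialGrad T (fun p : ℝ × E N × E N => F p.1 p.2.1 p.2.2)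
      (ContinuousLinearMap.inr ℝ (E N) (E N)) (t, x, v) :=
  gradient_partial hF ht (c := fun y => (x, y)) (hasFDerivAt_prodMk_right x v)

include hV in
theorem gradient_eq_partialGrad {t : ℝ} (ht : t ∈ I T) (x : E N) : gradient (V t) x =
    partialGrad T (fun p : ℝ × E N => V p.1 p.2) (ContinuousLinearMap.id ℝ (E N)) (t, x) :=
  gradient_partial hV ht (c := fun y => y) (hasFDerivAt_id x)

include hF hV in
theorem gradX_lagrangian {t : ℝ} (ht : t ∈ I T) (x v : E N) :
    gradX (lagrangian F V f) t x v = gradX F t x v + gradient (V t) x + f t := by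
  have h1 : DifferentiableAt ℝ (fun y => F t y v) x := (hasFDerivAt_partial hF ht
    (c := fun y => (y, v)) (hasFDerivAt_prodMk_left x v)).differentiableAt
  have h2 : DifferentiableAt ℝ (V t) x := (hasFDerivAt_partial hV ht
    (c := fun y => y) (hasFDerivAt_id x)).differentiableAt
  have h3 : HasFDerivAt (fun y => inner ℝ (f t) y) (innerSL ℝ (f t)) x :=
    (innerSL ℝ (f t)).hasFDerivAt
  refine HasGradientAt.gradient ?_
  rw [hasGradientAt_iff_hasFDerivAt]
  have h4 := (h1.hasGradientAt.hasFDerivAt.add h2.hasGradientAt.hasFDerivAt).add h3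
  rw [map_add, map_add]
  exact h4

include hF in
theorem gradV_lagrangian {t : ℝ} (ht : t ∈ I T) (x v : E N) :
    gradV (lagrangian F V f) t x v = gradV F t x v := by
  have h1 : DifferentiableAt ℝ (F t x) v := (hasFDerivAt_partial hF ht
    (c := fun y => (x, y)) (hasFDerivAt_prodMk_right x v)).differentiableAt
  refine HasGradientAt.gradient ?_
  rw [hasGradientAt_iff_hasFDerivAt]
  exact (h1.hasGradientAt.hasFDerivAt.add_const _).add_const _

include hV in
/-- `V` and its gradient are bounded on bounded sets. -/
theorem exists_bound_potential (hT : 0 < T) (R : ℝ) : ∃ C : ℝ, 0 ≤ C ∧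
    ∀ t ∈ I T, ∀ x, ‖x‖ ≤ R → |V t x| ≤ C ∧ ‖gradient (V t) x‖ ≤ C := by
  have hK : IsCompact (I T ×ˢ Metric.closedBall (0 : E N) R) :=
    isCompact_Icc.prod (isCompact_closedBall _ _)
  have hsub : I T ×ˢ Metric.closedBall (0 : E N) R ⊆ I T ×ˢ univ :=
    prod_mono_right (subset_univ _)
  obtain ⟨C₁, h1⟩ := hK.exists_bound_of_continuousOn (hV.continuousOn.mono hsub)
  obtain ⟨C₂, h2⟩ := hK.exists_bound_of_continuousOn ((continuousOn_partialGrad hV hT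
    (ContinuousLinearMap.id ℝ (E N))).mono hsub)
  refine ⟨|C₁| + |C₂|, by positivity, fun t ht x hx => ?_⟩
  have hm : (t, x) ∈ I T ×ˢ Metric.closedBall (0 : E N) R := ⟨ht, by simpa using hx⟩
  rw [gradient_eq_partialGrad hV ht]
  exact ⟨(h1 _ hm).trans (by linarith [le_abs_self C₁, abs_nonneg C₂]),
    (h2 _ hm).trans (by linarith [le_abs_self C₂, abs_nonneg C₁])⟩

include hF hV in
-- On ‖x‖ ≤ R compactness bounds a, V and V_x, and `conj_gradient_le` expresses the bound on G*(F_v)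
-- through G(v). The hypotheses are separated from `AssumptionF` and `AssumptionV` so that Φ is
-- covered as well.
theorem lagr_lagrangian (hT : 0 < T) (hG : IsGFunction G)
    (hconv : ∀ t ∈ I T, ∀ x, ConvexOn ℝ univ (F t x))
    (hgr : ∃ a b : ℝ → ℝ, ContinuousOn a (Ici 0) ∧ (∀ r, 0 ≤ r → 0 ≤ a r) ∧
      IntegrableOn b (I T) ∧ (∀ t ∈ I T, 0 ≤ b t) ∧
      ∀ t ∈ I T, ∀ x v,
        |F t x v| ≤ a ‖x‖ * (b t + G v) ∧
        ‖gradient (fun y => F t y v) x‖ ≤ a ‖x‖ * (b t + G v) ∧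
        conj G (gradient (F t x) v) ≤ a ‖x‖ * (b t + conj G (gradient G v)))
    {Λ : ℝ} (hΛ : 0 < Λ) (hell : ∀ t ∈ I T, ∀ x v, Λ * G v ≤ F t x v)
    (hf : MemLG T (conj G) f) : Lagr T G (lagrangian F V f) := by
  have hfi : Integrable f (mu T) := hG.conj_young.integrable hf
  have hFt : ∀ t ∈ I T, ContDiff ℝ 1 (fun p : E N × E N => F t p.1 p.2) := fun t ht =>
    contDiffOn_univ.1 (hF.comp (f := fun p : E N × E N => (t, p))
      (contDiff_const.prodMk contDiff_id).contDiffOn fun _ _ => ⟨ht, mem_univ _⟩)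
  have hVt : ∀ t ∈ I T, ContDiff ℝ 1 (V t) := fun t ht =>
    contDiffOn_univ.1 (hV.comp (f := fun p : E N => (t, p))
      (contDiff_const.prodMk contDiff_id).contDiffOn fun _ _ => ⟨ht, mem_univ _⟩)
  have hbdX : ∀ R : ℝ, ∃ C : ℝ, 0 ≤ C ∧ ∀ t ∈ I T, ∀ x, ‖x‖ ≤ R →
      |V t x| ≤ C ∧ ‖gradient (V t) x‖ ≤ C := exists_bound_potential hV hT
  refine ⟨fun t ht => ?_, fun t ht x => ?_, fun u w hu hw => ?_, fun u w hu hw => ?_,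
    fun u w hu hw => ?_, fun R => ?_, fun R => ?_⟩
  · exact ((hFt t ht).add ((hVt t ht).comp contDiff_fst)).add
      (contDiff_const.inner ℝ contDiff_fst)
  · exact ((hconv t ht x).add_const _).add_const _
  · exact ((aestronglyMeasurable_comp_of_continuousOn hT hF.continuousOn (hu.prodMk hw)).add
      (aestronglyMeasurable_comp_of_continuousOn hT hV.continuousOn hu)).add (hf.1.inner hu)
  · refine (((aestronglyMeasurable_comp_of_continuousOn hT (continuousOn_partialGrad hF hT
      (ContinuousLinearMap.inl ℝ (E N) (E N))) (hu.prodMk hw)).add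
      (aestronglyMeasurable_comp_of_continuousOn hT (continuousOn_partialGrad hV hT
        (ContinuousLinearMap.id ℝ (E N))) hu)).add hf.1).congr ?_
    filter_upwards [ae_mem_I] with t ht
    rw [gradX_lagrangian hF hV ht, gradX_eq_partialGrad hF ht, gradient_eq_partialGrad hV ht]
    rfl
  · refine (aestronglyMeasurable_comp_of_continuousOn hT (continuousOn_partialGrad hF hT
      (ContinuousLinearMap.inr ℝ (E N) (E N))) (hu.prodMk hw)).congr ?_
    filter_upwards [ae_mem_I] with t ht
    rw [gradV_lagrangian hF ht, gradV_eq_partialGrad hF ht]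
  · obtain ⟨a, b, ha, ha0, hb, hb0, h⟩ := hgr
    obtain ⟨C₁, hC₁, h1⟩ := hbdX R
    obtain ⟨k, C, hk, hC, hkC⟩ := hG.conj_gradient_le
    obtain ⟨M, hM⟩ := (isCompact_Icc (a := 0) (b := R)).exists_bound_of_continuousOn
      (ha.mono Icc_subset_Ici_self)
    have hM0 := abs_nonneg M
    refine ⟨fun t => |M| * (b t + C) + (C₁ + ‖f t‖ * |R|) + ‖f t‖, |M| * (1 + k), ?_,
      by positivity, fun t ht x v hx => ?_⟩
    · exact (((Integrable.add hb (integrable_const C)).const_mul _).add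
        ((integrable_const C₁).add (hfi.norm.mul_const _))).add hfi.norm
    · obtain ⟨p1, p2, p3⟩ := h t ht x v
      obtain ⟨q1, q2⟩ := h1 t ht x hx
      have hGv := hG.nonneg v
      have hkG : 0 ≤ k * G v := mul_nonneg hk hGv
      have haM : a ‖x‖ ≤ |M| :=
        ((le_abs_self _).trans (hM ‖x‖ ⟨norm_nonneg _, hx⟩)).trans (le_abs_self M)
      have hR : ‖x‖ ≤ |R| := hx.trans (le_abs_self R)
      have hfx : |inner ℝ (f t) x| ≤ ‖f t‖ * |R| := (abs_real_inner_le_norm _ _).trans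
        (mul_le_mul_of_nonneg_left hR (norm_nonneg _))
      have hfx0 : 0 ≤ ‖f t‖ * |R| := by positivity
      have hf0 := norm_nonneg (f t)
      have hbt := hb0 t ht
      have m1 : a ‖x‖ * (b t + G v) ≤ |M| * (b t + C + (1 + k) * G v) :=
        mul_le_mul haM (by linarith) (by linarith) hM0
      have m2 : a ‖x‖ * (b t + conj G (gradient G v)) ≤ |M| * (b t + C + (1 + k) * G v) :=
        mul_le_mul haM (by linarith [hkC v]) (by linarith [hG.conj_nonneg (gradient G v)]) hM0
      refine ⟨?_, ?_, ?_⟩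
      · have := abs_add_three (F t x v) (V t x) (inner ℝ (f t) x)
        change |F t x v + V t x + inner ℝ (f t) x| ≤ _
        linarith
      · rw [gradX_lagrangian hF hV ht]
        have := norm_add₃_le (a := gradX F t x v) (b := gradient (V t) x) (c := f t)
        change ‖gradX F t x v‖ ≤ _ at p2
        linarith
      · rw [gradV_lagrangian hF ht]
        change conj G (gradV F t x v) ≤ _ at p3
        linarith
  · obtain ⟨C₁, hC₁, h1⟩ := hbdX R
    refine ⟨fun t => C₁ + ‖f t‖ * |R|, Λ, (integrable_const C₁).add (hfi.norm.mul_const _), hΛ,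
      fun t ht x v hx => ?_⟩
    obtain ⟨q1, q2⟩ := h1 t ht x hx
    have hR : ‖x‖ ≤ |R| := hx.trans (le_abs_self R)
    have hfx : |inner ℝ (f t) x| ≤ ‖f t‖ * |R| := (abs_real_inner_le_norm _ _).trans
      (mul_le_mul_of_nonneg_left hR (norm_nonneg _))
    have := hell t ht x v
    change _ ≤ F t x v + V t x + inner ℝ (f t) x + _
    linarith [neg_abs_le (V t x), neg_abs_le (inner ℝ (f t) x)]

end Specific

/-- The functional `Φ` is the action of the Lagrangian `G(v) + G(x)`. -/
theorem lagr_modular (hT : 0 < T) (hG : IsGFunction G) :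
    Lagr T G (lagrangian (fun _ _ v => G v) (fun _ x => G x) 0) := by
  refine lagr_lagrangian ?_ ?_ hT hG (fun t _ x => hG.convex) ⟨fun _ => 1, fun _ => 0,
    continuousOn_const, fun _ _ => zero_le_one, integrableOn_zero, fun _ _ => le_rfl,
    fun t _ x v => ⟨?_, ?_, ?_⟩⟩ one_pos (fun t _ x v => (one_mul _).le) hG.conj_young.memLG_zero
  · exact (hG.contDiff.comp (contDiff_snd.comp contDiff_snd)).contDiffOn
  · exact (hG.contDiff.comp contDiff_snd).contDiffOn
  · simp [abs_of_nonneg (hG.nonneg v)]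
  · have : gradient (fun _ : E N => G v) x = 0 := by simp [gradient]
    rw [this, norm_zero]
    simpa using hG.nonneg v
  · simp

end AnisotropicEL

end
open Set Filter Topology MeasureTheory

noncomputable section

namespace AnisotropicEL

variable {N : ℕ} {T : ℝ} {G : E N → ℝ} {hG : IsGFunction G}

/-! ### Geometry of the action functional -/

/-- The Lagrangian `G(v) + G(x)`. -/
abbrev modularLagrangian (G : E N → ℝ) : ℝ → E N → E N → ℝ :=
  lagrangian (fun _ _ v => G v) (fun _ x => G x) 0

theorem actionS_modular (hT : 0 ≤ T) (z : Sob T hG) : actionS (modularLagrangian G) z =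
    (∫ t, G (z.vel t) ∂mu T) + ∫ t, G (z.pos t) ∂mu T := by
  rw [← integral_add z.memLG_vel.2 (z.memLG_pos hT).2]
  refine integral_congr_ae (Eventually.of_forall fun t => ?_)
  simp [lagrangian]

theorem Phi_eq_actionS (hT : 0 ≤ T) (hG : IsGFunction G) {u : ℝ → E N} (hu : u ∈ WT T G) :
    Phi T G u = actionS (modularLagrangian G) (toSob hT hG hu) := by
  rw [← action_eq_actionS hT hG]
  refine integral_congr_ae (Eventually.of_forall fun t => ?_)
  simp [lagrangian]

theorem Phi_pos (hT : 0 ≤ T) (z : Sob T hG) :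
    Phi T G z.pos = actionS (modularLagrangian G) z := by
  rw [Phi_eq_actionS hT hG (Sob.pos_mem_WT hT z), toSob_pos]

/-- Jensen's inequality on a subset of `I`. -/
theorem G_setIntegral_le (hT : 0 < T) (hG : IsGFunction G) {w : ℝ → E N} (hw : MemLG T G w)
    {A : Set ℝ} (hA : MeasurableSet A) :
    G ((2 * T)⁻¹ • ∫ t in A, w t ∂mu T) ≤ (2 * T)⁻¹ * ∫ t, G (w t) ∂mu T := by
  have hne : NeZero (mu T) := ⟨fun h => by
    have := mu_real_univ hT.le
    rw [h] at this
    simp at this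
    linarith⟩
  -- Jensen is applied to the indicator times w on all of I, so that the normalization is |I| and
  -- not |A|.
  have hGA : ∀ t, G (A.indicator w t) = A.indicator (fun t => G (w t)) t := by
    intro t
    by_cases ht : t ∈ A <;> simp [ht, hG.zero]
  have hi := (hG.young.integrable hw).indicator hA
  have hi2 : Integrable (fun t => G (A.indicator w t)) (mu T) := by
    simp only [hGA]
    exact hw.2.indicator hA
  have h1 := hG.convex.map_average_le hG.young.cont.continuousOn isClosed_univ
    (Eventually.of_forall fun _ => mem_univ _) hi hi2
  rw [average_eq, average_eq, mu_real_univ hT.le, integral_indicator hA, smul_eq_mul] at h1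
  refine h1.trans (mul_le_mul_of_nonneg_left ?_ (by positivity))
  refine integral_mono hi2 hw.2 fun t => ?_
  simp only [hGA]
  exact indicator_le_self' (fun _ _ => hG.nonneg _) t

/-- An increment is the integral of the velocity over a subinterval, so Jensen applies; evenness of
G reduces to s ≤ t. -/
theorem Sob.G_pos_sub_le (hT : 0 < T) (z : Sob T hG) {s t : ℝ} (hs : s ∈ I T) (ht : t ∈ I T) :
    G ((2 * T)⁻¹ • (z.pos t - z.pos s)) ≤ (2 * T)⁻¹ * ∫ t, G (z.vel t) ∂mu T := by
  wlog hst : s ≤ t generalizing s t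
  · rw [← neg_sub, smul_neg, hG.even]
    exact this ht hs (le_of_not_ge hst)
  · have hsub : Ioc s t ⊆ I T := fun r hr => ⟨hs.1.trans hr.1.le, hr.2.trans ht.2⟩
    have e : z.pos t - z.pos s = ∫ r in Ioc s t, z.vel r ∂mu T := by
      rw [Measure.restrict_restrict measurableSet_Ioc, inter_eq_self_of_subset_left hsub,
        ← intervalIntegral.integral_of_le hst, Sob.pos, Sob.pos, add_sub_add_left_eq_sub,
        intervalIntegral.integral_interval_sub_left (intervalIntegrable_sub hT.le z.integrable_vel ht)
          (intervalIntegrable_sub hT.le z.integrable_vel hs)]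
    rw [e]
    exact G_setIntegral_le hT hG z.memLG_vel measurableSet_Ioc

/-- Values of curves with small modular are small. -/
theorem Sob.G_pos_le (hT : 1 ≤ 2 * T) (z : Sob T hG) {t : ℝ} (ht : t ∈ I T) :
    G ((2 * (2 * T))⁻¹ • z.pos t) ≤ actionS (modularLagrangian G) z / 2 := by
  have hT0 : 0 < T := by linarith
  have h1 : ∀ s ∈ I T, G ((2 * (2 * T))⁻¹ • z.pos t) ≤
      (2 * T)⁻¹ / 2 * G (z.pos s) + (2 * T)⁻¹ / 2 * ∫ t, G (z.vel t) ∂mu T := by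
    intro s hs
    -- The point u(t)/(2|I|) is the midpoint of u(s)/|I| and (u(t) − u(s))/|I|; averaging over s
    -- follows. Contracting by |I|⁻¹ is where |I| ≥ 1 enters.
    have a1 := hG.convex.2 (mem_univ ((2 * T)⁻¹ • z.pos s))
      (mem_univ ((2 * T)⁻¹ • (z.pos t - z.pos s)))
      (by norm_num : (0 : ℝ) ≤ 1 / 2) (by norm_num : (0 : ℝ) ≤ 1 / 2) (by norm_num)
    have e : (1 / 2 : ℝ) • (2 * T)⁻¹ • z.pos s + (1 / 2 : ℝ) • (2 * T)⁻¹ • (z.pos t - z.pos s)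
        = (2 * (2 * T))⁻¹ • z.pos t := by
      rw [← smul_add, ← smul_add, add_sub_cancel, smul_smul]
      congr 1
      rw [mul_inv 2 (2 * T)]; norm_num
    rw [e, smul_eq_mul, smul_eq_mul] at a1
    have habs : |(2 * T)⁻¹| ≤ 1 := by
      rw [abs_of_pos (by positivity)]; exact inv_le_one_of_one_le₀ hT
    have a2 := hG.young.smul_le habs (z.pos s)
    rw [abs_of_pos (by positivity)] at a2
    have a3 := z.G_pos_sub_le hT0 hs ht
    linarith
  have i1 : Integrable (fun s => (2 * T)⁻¹ / 2 * G (z.pos s)) (mu T) :=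
    (z.memLG_pos hT0.le).2.const_mul _
  have h2 := integral_mono_ae (μ := mu T) (integrable_const _) (i1.add (integrable_const _))
    (ae_mem_I.mono h1)
  simp only [Pi.add_apply] at h2
  rw [integral_add i1 (integrable_const _), integral_const, integral_const, mu_real_univ hT0.le,
    integral_const_mul, smul_eq_mul, smul_eq_mul] at h2
  rw [actionS_modular hT0.le]
  have p1 : 0 ≤ ∫ t, G (z.pos t) ∂mu T := integral_nonneg fun _ => hG.nonneg _
  have p2 : 0 ≤ ∫ t, G (z.vel t) ∂mu T := integral_nonneg fun _ => hG.nonneg _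
  set P := ∫ t, G (z.pos t) ∂mu T
  set Q := ∫ t, G (z.vel t) ∂mu T
  set q := G ((2 * (2 * T))⁻¹ • z.pos t)
  have hinv : (2 * T)⁻¹ ≤ 1 := inv_le_one_of_one_le₀ hT
  have e2 : 2 * T * ((2 * T)⁻¹ / 2 * Q) = Q / 2 := by field_simp
  have q0 : 0 ≤ q := hG.nonneg _
  have h3 : (2 * T)⁻¹ / 2 * P ≤ 1 / 2 * P := mul_le_mul_of_nonneg_right (by linarith) p1
  nlinarith

/-! ### The action under the assumptions on F, V and f. -/

section

variable {F : ℝ → E N → E N → ℝ} {Λ θF : ℝ} (hF : AssumptionF T G F Λ θF)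
  {V : ℝ → E N → ℝ} {ρ b : ℝ} {g : ℝ → ℝ} (hV : AssumptionV T G V θF ρ b g)
  {f : ℝ → E N} (hf : MemLG T (conj G) f)

include hF hV hf in
theorem lagr_of_assumptions (hT : 0 < T) (hG : IsGFunction G) : Lagr T G (lagrangian F V f) :=
  lagr_lagrangian hF.contDiffOn hV.contDiffOn hT hG hF.convex hF.growth hF.lambda_pos
    hF.ellipticity hf

include hF hV hf in
/-- The action is bounded below by the modular in the region `Φ ≤ ρ`. -/
theorem le_actionS (hT : 1 ≤ 2 * T) (z : Sob T hG) (hz : actionS (modularLagrangian G) z ≤ ρ) :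
    min Λ (b - 1) * actionS (modularLagrangian G) z - ∫ t, (conj G (f t) + g t) ∂mu T ≤
      actionS (lagrangian F V f) z := by
  have hT0 : 0 < T := by linarith
  have i1 : Integrable (fun t => Λ * G (z.vel t) + (b - 1) * G (z.pos t)) (mu T) :=
    (z.memLG_vel.2.const_mul _).add ((z.memLG_pos hT0.le).2.const_mul _)
  have i2 : Integrable (fun t => conj G (f t) + g t) (mu T) := Integrable.add hf.2 hV.integrable_g
  have h1 : ∫ t, ((Λ * G (z.vel t) + (b - 1) * G (z.pos t)) - (conj G (f t) + g t)) ∂mu T ≤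
      actionS (lagrangian F V f) z := by
    refine integral_mono_ae (i1.sub i2)
      ((lagr_of_assumptions hF hV hf hT0 hG).integrable_sob hT0.le z) ?_
    filter_upwards [ae_mem_I] with t ht
    have a1 := hF.ellipticity t ht (z.pos t) (z.vel t)
    -- The bound Φ ≤ ρ keeps every value of the curve in the region of (V3). Fenchel–Young then
    -- spends one G(u) on the forcing, leaving the factor b − 1.
    have a2 := hV.lower_bound t ht (z.pos t) ((z.G_pos_le hT ht).trans (by linarith))
    have a3 := (abs_le.1 (hG.abs_inner_le (z.pos t) (f t))).1
    simp only [lagrangian]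
    linarith
  rw [integral_sub i1 i2, integral_add (z.memLG_vel.2.const_mul _)
    ((z.memLG_pos hT0.le).2.const_mul _), integral_const_mul, integral_const_mul] at h1
  rw [actionS_modular hT0.le]
  have p1 : 0 ≤ ∫ t, G (z.pos t) ∂mu T := integral_nonneg fun _ => hG.nonneg _
  have p2 : 0 ≤ ∫ t, G (z.vel t) ∂mu T := integral_nonneg fun _ => hG.nonneg _
  have m1 := mul_le_mul_of_nonneg_right (min_le_left Λ (b - 1)) p2
  have m2 := mul_le_mul_of_nonneg_right (min_le_right Λ (b - 1)) p1
  linarith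

/-- Constant curves. -/
def Sob.const (T : ℝ) (hG : IsGFunction G) (x : E N) : Sob T hG :=
  Sob.mk x (fun _ => 0) hG.young.memLG_zero (by simp)

theorem Sob.vel_const (x : E N) : (Sob.const T hG x).vel =ᵐ[mu T] fun _ => 0 := Sob.vel_mk _ _ _ _

theorem Sob.pos_const (x : E N) {t : ℝ} (ht : t ∈ I T) : (Sob.const T hG x).pos t = x := by
  rw [Sob.pos, intervalIntegral_congr_mu (Sob.vel_const x) ht]
  simp [Sob.const, Sob.base_mk]

theorem actionS_const (L : ℝ → E N → E N → ℝ) (x : E N) :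
    actionS L (Sob.const T hG x) = ∫ t, L t x 0 ∂mu T := by
  refine integral_congr_ae ?_
  filter_upwards [ae_mem_I, Sob.vel_const (hG := hG) x] with t ht h1
  rw [Sob.pos_const x ht, h1]

theorem Sob.zero_eq_const (hT : 0 ≤ T) : (0 : Sob T hG) = Sob.const T hG 0 := by
  rw [← toSob_pos hT (Sob.const T hG 0)]
  symm
  exact toSob_eq hT hG _ fun t ht => by rw [Sob.pos_const 0 ht, Sob.pos_zero ht]

include hF hV in
theorem actionS_zero (hT : 0 ≤ T) : actionS (lagrangian F V f) (0 : Sob T hG) = 0 := by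
  rw [Sob.zero_eq_const hT, actionS_const, ← hV.integral_zero]
  refine integral_congr_ae ?_
  filter_upwards [ae_mem_I] with t ht
  simp [lagrangian, (hF.zero t ht 0).1]

theorem modular_zero (hT : 0 ≤ T) : actionS (modularLagrangian G) (0 : Sob T hG) = 0 := by
  rw [Sob.zero_eq_const hT, actionS_const]
  simp [lagrangian, hG.zero]

include hF hV in
-- F vanishes on constant curves. By (V2) the function s^(−θ) V(t, s x₀) is nonincreasing for s ≥ 1,
-- so V(t, l x₀) ≤ l^θ V(t, x₀) with V(t, x₀) < 0. Since θ > 1, this beats the forcing, which is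
-- linear in l.
theorem exists_neg_endpoint (hT : 0 < T) (hG : IsGFunction G) (hf : MemLG T (conj G) f)
    [Nontrivial (E N)] : ∃ z : Sob T hG, ρ < actionS (modularLagrangian G) z ∧
      actionS (lagrangian F V f) z < 0 := by
  obtain ⟨K, W, hKW, M, ε, θ, p, hM, hε, hθF, hp, hpθ, h⟩ := hV.decomposition
  have hfi : Integrable f (mu T) := hG.conj_young.integrable hf
  obtain ⟨x₀, hx₀⟩ := exists_norm_eq (E N) (by linarith : 0 ≤ M + 1)
  have hscale : ∀ t ∈ I T, ∀ l : ℝ, 1 ≤ l → V t (l • x₀) ≤ l ^ θ * V t x₀ := by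
    intro t ht l hl
    have hd : ∀ s : ℝ, 1 ≤ s → HasDerivAt (fun s : ℝ => s ^ (-θ) * V t (s • x₀))
        ((-θ * s ^ (-θ - 1)) * V t (s • x₀) +
          s ^ (-θ) * inner ℝ (gradient (V t) (s • x₀)) x₀) s := by
      intro s hs
      have d1 : HasDerivAt (fun s : ℝ => s ^ (-θ)) (-θ * s ^ (-θ - 1)) s :=
        Real.hasDerivAt_rpow_const (Or.inl (by linarith))
      have d2 : HasDerivAt (fun s : ℝ => s • x₀) x₀ s := by
        simpa using (hasDerivAt_id s).smul_const x₀
      have d3 : DifferentiableAt ℝ (V t) (s • x₀) := (hasFDerivAt_partial hV.contDiffOn ht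
        (c := fun y => y) (hasFDerivAt_id (s • x₀))).differentiableAt
      have d4 : HasDerivAt (fun s : ℝ => V t (s • x₀))
          (inner ℝ (gradient (V t) (s • x₀)) x₀) s :=
        HasFDerivAt.comp_hasDerivAt (l := V t) s (hasFDerivAt_gradient d3) d2
      exact d1.mul d4
    have hanti : AntitoneOn (fun s : ℝ => s ^ (-θ) * V t (s • x₀)) (Ici 1) := by
      refine antitoneOn_of_hasDerivWithinAt_nonpos (convex_Ici 1)
        (fun s hs => (hd s hs).continuousAt.continuousWithinAt)
        (fun s hs => (hd s (interior_subset hs)).hasDerivWithinAt) fun s hs => ?_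
      have hs1 : (1 : ℝ) ≤ s := interior_subset hs
      have hs0 : 0 < s := by linarith
      have hn : M < ‖s • x₀‖ := by
        rw [norm_smul, hx₀, Real.norm_of_nonneg hs0.le]; nlinarith
      obtain ⟨a1, a2, a3⟩ := h t ht _ hn
      rw [inner_smul_right] at a1
      have hK0 : 0 ≤ K t (s • x₀) := (Real.rpow_nonneg (norm_nonneg _) _).trans a3.le
      have a4 : s * inner ℝ (gradient (V t) (s • x₀)) x₀ ≤ θ * V t (s • x₀) := by
        rw [hKW t ht]
        nlinarith
      have e : s ^ (-θ) = s ^ (-θ - 1) * s := by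
        rw [← Real.rpow_add_one hs0.ne']; congr 1; ring
      rw [e]
      have hpos : 0 ≤ s ^ (-θ - 1) := Real.rpow_nonneg hs0.le _
      nlinarith [mul_le_mul_of_nonneg_left a4 hpos]
    have h1 := hanti (mem_Ici.2 le_rfl) (mem_Ici.2 hl) hl
    simp only [Real.one_rpow, one_smul, one_mul] at h1
    have hl0 : 0 < l := by linarith
    have h2 := mul_le_mul_of_nonneg_left h1 (Real.rpow_nonneg hl0.le θ)
    rwa [← mul_assoc, ← Real.rpow_add hl0, add_neg_cancel, Real.rpow_zero, one_mul] at h2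
  -- a uniform negative upper bound
  obtain ⟨m, hm, hVm⟩ : ∃ m > 0, ∀ t ∈ I T, V t x₀ ≤ -m := by
    have hc : ContinuousOn (fun t => V t x₀) (I T) :=
      hV.contDiffOn.continuousOn.comp (f := fun t => (t, x₀)) (by fun_prop)
        fun t ht => ⟨ht, mem_univ _⟩
    obtain ⟨t₀, ht₀, hmax⟩ := isCompact_Icc.exists_isMaxOn ⟨-T, le_rfl, by linarith⟩ hc
    have hn : M < ‖x₀‖ := by rw [hx₀]; linarith
    refine ⟨-V t₀ x₀, ?_, fun t ht => by simpa using hmax ht⟩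
    rw [hKW t₀ ht₀]
    linarith [(h t₀ ht₀ x₀ hn).2.1]
  obtain ⟨C, hC, hsup⟩ := hG.young.superlinear 1 one_pos
  set A := ∫ t, ‖f t‖ ∂mu T with hA
  have hA0 : 0 ≤ A := integral_nonneg fun _ => norm_nonneg _
  -- The first threshold lets the potential win over the forcing; the second pushes Φ above ρ.
  have e1 : ∀ᶠ l : ℝ in atTop, (M + 1) * A / (2 * T * m) < l ^ (θ - 1) :=
    (tendsto_rpow_atTop (by linarith : 0 < θ - 1)).eventually_gt_atTop _
  have e2 : ∀ᶠ l : ℝ in atTop, ρ / (2 * T) + C < l := eventually_gt_atTop _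
  obtain ⟨l, h1, h2, hl⟩ := (e1.and (e2.and (eventually_ge_atTop 1))).exists
  have hl0 : 0 < l := by linarith
  refine ⟨Sob.const T hG (l • x₀), ?_, ?_⟩
  · rw [actionS_const]
    have h3 : ∫ t, modularLagrangian G t (l • x₀) 0 ∂mu T = 2 * T * G (l • x₀) := by
      simp [lagrangian, hG.zero, mu_real_univ hT.le]
    rw [h3]
    have h4 := hsup (l • x₀)
    rw [norm_smul, hx₀, Real.norm_of_nonneg hl0.le] at h4
    have h5 : ρ / (2 * T) < G (l • x₀) := by nlinarith
    rw [div_lt_iff₀ (by positivity)] at h5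
    linarith
  · rw [actionS_const]
    have h3 : ∫ t, lagrangian F V f t (l • x₀) 0 ∂mu T ≤
        ∫ t, (-(l ^ θ * m) + ‖f t‖ * (l * (M + 1))) ∂mu T := by
      refine integral_mono_ae ?_ ((integrable_const _).add (hfi.norm.mul_const _)) ?_
      · exact (lagr_of_assumptions hF hV hf hT hG).integrable_comp (R := ‖l • x₀‖)
          aestronglyMeasurable_const (Eventually.of_forall fun _ => le_rfl) hG.young.memLG_zero
      · filter_upwards [ae_mem_I] with t ht
        have a1 := hscale t ht l hl
        have a2 := mul_le_mul_of_nonneg_left (hVm t ht) (Real.rpow_nonneg hl0.le θ)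
        have a3 := (le_abs_self _).trans (abs_real_inner_le_norm (f t) (l • x₀))
        rw [norm_smul, hx₀, Real.norm_of_nonneg hl0.le] at a3
        simp only [lagrangian, (hF.zero t ht _).1]
        linarith
    rw [integral_add (integrable_const _) (hfi.norm.mul_const _), integral_mul_const,
      integral_const, mu_real_univ hT.le, smul_eq_mul, ← hA] at h3
    refine h3.trans_lt ?_
    rw [div_lt_iff₀ (by positivity)] at h1
    have e3 : l ^ θ = l ^ (θ - 1) * l := by
      rw [← Real.rpow_add_one hl0.ne']; congr 1; ring
    rw [e3]
    nlinarith

/-- The initial value is controlled by the mean of the curve. -/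
theorem Sob.norm_base_le_mean (hT : 0 < T) (z : Sob T hG) : ‖z.base‖ ≤
    (2 * T)⁻¹ * (∫ t, ‖z.pos t‖ ∂mu T) + ∫ t, ‖z.vel t‖ ∂mu T := by
  have hip : Integrable (fun t => ‖z.pos t‖) (mu T) :=
    (hG.young.integrable (z.memLG_pos hT.le)).norm
  have hb : ∀ t ∈ I T, ‖z.base‖ ≤ ‖z.pos t‖ + ∫ r, ‖z.vel r‖ ∂mu T := by
    intro t ht
    have e : z.base = z.pos t - ∫ r in (-T)..t, z.vel r := by rw [Sob.pos]; abel
    rw [e]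
    exact (norm_sub_le _ _).trans (add_le_add_right
      (norm_intervalIntegral_le z.integrable_vel ⟨le_rfl, by linarith⟩ ht) _)
  have h3 : ∫ _, ‖z.base‖ ∂mu T ≤ ∫ t, (‖z.pos t‖ + ∫ r, ‖z.vel r‖ ∂mu T) ∂mu T :=
    integral_mono_ae (integrable_const _) (hip.add (integrable_const _)) (ae_mem_I.mono hb)
  rw [integral_add hip (integrable_const _), integral_const,
    integral_const, mu_real_univ hT.le, smul_eq_mul, smul_eq_mul] at h3
  have h2T : 0 < 2 * T := by positivity
  refine le_of_mul_le_mul_left ?_ h2T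
  rw [mul_add, mul_inv_cancel_left₀ h2T.ne']
  exact h3

theorem YoungFn.integral_norm_le {Φ : E N → ℝ} (h : YoungFn Φ) (hT : 0 ≤ T) {η C : ℝ}
    (hC : ∀ x, ‖x‖ ≤ η * Φ x + C) {w : ℝ → E N} (hw : MemLG T Φ w) :
    ∫ t, ‖w t‖ ∂mu T ≤ η * (∫ t, Φ (w t) ∂mu T) + 2 * T * C := by
  have h1 : ∫ t, ‖w t‖ ∂mu T ≤ ∫ t, (η * Φ (w t) + C) ∂mu T :=
    integral_mono (h.integrable hw).norm (Integrable.add (hw.2.const_mul η) (integrable_const C))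
      fun t => hC (w t)
  rwa [integral_add (hw.2.const_mul η) (integrable_const C), integral_const_mul, integral_const,
    mu_real_univ hT, smul_eq_mul] at h1

/-- Powers with exponent greater than one dominate linear functions. -/
theorem exists_mul_le_rpow {p ε : ℝ} (hp : 1 < p) (hε : 0 < ε) (κ : ℝ) :
    ∃ C : ℝ, 0 ≤ C ∧ ∀ r : ℝ, 0 ≤ r → κ * r ≤ ε * r ^ p + C := by
  obtain ⟨r₀, hr₀⟩ := eventually_atTop.1
    ((tendsto_rpow_atTop (by linarith : 0 < p - 1)).eventually_ge_atTop (|κ| / ε))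
  refine ⟨|κ| * |r₀|, by positivity, fun r hr => ?_⟩
  have hrp : 0 ≤ r ^ p := Real.rpow_nonneg hr p
  rcases le_total r |r₀| with hle | hle
  · have := mul_le_mul (le_abs_self κ) hle hr (abs_nonneg κ)
    nlinarith
  · rcases hr.eq_or_lt with h0 | h0
    · rw [← h0]; rw [← h0] at hrp; nlinarith [mul_nonneg (abs_nonneg κ) (abs_nonneg r₀)]
    · have h1 := hr₀ r ((le_abs_self r₀).trans hle)
      rw [div_le_iff₀ hε] at h1
      have e : r ^ p = r ^ (p - 1) * r := by
        rw [← Real.rpow_add_one h0.ne']; congr 1; ring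
      have h2 := mul_le_mul_of_nonneg_right ((le_abs_self κ).trans h1) hr
      rw [e]
      nlinarith [mul_nonneg (abs_nonneg κ) (abs_nonneg r₀)]

include hF hV hf in
/-- Palais-Smale sequences are bounded. -/
theorem palaisSmale_bounded (hT : 0 < T) (hG : IsGFunction G)
    (hL : Lagr T G (lagrangian F V f)) : ∃ δ > 0, ∀ c : ℝ, ∃ C : ℝ, ∀ z : Sob T hG,
      actionS (lagrangian F V f) z ≤ c → ‖hL.dAction hT.le z‖ ≤ δ →
      ‖z.base‖ ≤ C ∧ ∫ t, G (z.vel t) ∂mu T ≤ C := by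
  obtain ⟨K, W, hKW, M, ε, θ, p, hM, hε, hθF, hp, hpθ, h⟩ := hV.decomposition
  have hfi : Integrable f (mu T) := hG.conj_young.integrable hf
  set A := (θ - 1) * ∫ t, ‖f t‖ ∂mu T with hA
  have hA0 : 0 ≤ A := mul_nonneg (by linarith) (integral_nonneg fun _ => norm_nonneg _)
  set μ := (θ - θF) * Λ with hμ
  have hμ0 : 0 < μ := mul_pos (by linarith) hF.lambda_pos
  have h2T : 0 < 2 * T := by positivity
  -- The slope required from the potential: A times the mean of |u| pays for the forcing, one mean
  -- pays for J'(u)u, and one full ∫|u| is left over.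
  set κ := (A + 1) * (2 * T)⁻¹ + 1 with hκ
  -- the potential part
  obtain ⟨C₁, hC₁, h1⟩ := exists_bound_potential hV.contDiffOn hT M
  obtain ⟨C₂, hC₂, h2⟩ := exists_mul_le_rpow hp hε κ
  have hκ0 : 0 ≤ κ := by positivity
  set C₃ := θ * C₁ + C₁ * M + κ * M + C₂ with hC₃
  have hθ0 : 0 ≤ θ := by linarith
  -- Outside the ball (V2) gives θV − ⟨V_x, x⟩ ≥ εK > ε|x|^p, which outgrows every linear function.
  have hpot : ∀ t ∈ I T, ∀ x, κ * ‖x‖ - C₃ ≤ θ * V t x - inner ℝ (gradient (V t) x) x := by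
    intro t ht x
    rcases le_or_gt ‖x‖ M with hx | hx
    · obtain ⟨a1, a2⟩ := h1 t ht x hx
      have a3 := (le_abs_self _).trans (abs_real_inner_le_norm (gradient (V t) x) x)
      have a4 := mul_le_mul a2 hx (norm_nonneg _) hC₁
      have a5 := mul_le_mul_of_nonneg_left (abs_le.1 a1).1 hθ0
      have a6 := mul_le_mul_of_nonneg_left hx hκ0
      linarith
    · obtain ⟨a1, a2, a3⟩ := h t ht x hx
      have a4 := h2 ‖x‖ (norm_nonneg _)
      have a5 := mul_le_mul_of_nonneg_left a3.le hε.le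
      have a6 : 0 ≤ θ * C₁ + C₁ * M + κ * M := by positivity
      rw [hKW t ht]
      nlinarith
  -- Chosen so that 2(A + 1)η = μ/4. The bound δ ≤ μ/4 costs another quarter, and half of μQ
  -- survives.
  set η := μ / (8 * (A + 1)) with hη
  have hη0 : 0 < η := by positivity
  obtain ⟨C₄, hC₄, hs⟩ := hG.young.superlinear η hη0
  set δ := min 1 (μ / 4) with hδ
  have hδ0 : 0 < δ := lt_min one_pos (by positivity)
  refine ⟨δ, hδ0, fun c => ?_⟩
  set D := θ * |c| + 1 + 2 * T * C₃ + 2 * (A + 1) * (2 * T * C₄) with hD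
  refine ⟨max (2 * D / μ) ((2 * T)⁻¹ * D + (η * (2 * D / μ) + 2 * T * C₄)), fun z hJ hdJ => ?_⟩
  set P := ∫ t, ‖z.pos t‖ ∂mu T with hP
  set Q := ∫ t, G (z.vel t) ∂mu T with hQ
  have hP0 : 0 ≤ P := integral_nonneg fun _ => norm_nonneg _
  have hQ0 : 0 ≤ Q := integral_nonneg fun _ => hG.nonneg _
  have hvel : ∫ t, ‖z.vel t‖ ∂mu T ≤ η * Q + 2 * T * C₄ :=
    hG.young.integral_norm_le hT.le hs z.memLG_vel
  have hbase := z.norm_base_le_mean hT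
  have hip : Integrable (fun t => ‖z.pos t‖) (mu T) :=
    (hG.young.integrable (z.memLG_pos hT.le)).norm
  set U := (2 * T)⁻¹ * P + 2 * (η * Q + 2 * T * C₄) with hU
  have hsup : ∀ t ∈ I T, ‖z.pos t‖ ≤ U := fun t ht => by
    linarith [z.norm_pos_le_of_integral ht]
  have hU0 : 0 ≤ U := by positivity
  -- the Ambrosetti-Rabinowitz combination
  have i1 : Integrable (fun t => μ * G (z.vel t)) (mu T) := z.memLG_vel.2.const_mul μ
  have i2 : Integrable (fun t => κ * ‖z.pos t‖ - C₃) (mu T) :=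
    (hip.const_mul κ).sub (integrable_const C₃)
  have i3 : Integrable (fun t => (θ - 1) * ‖f t‖ * U) (mu T) :=
    (hfi.norm.const_mul (θ - 1)).mul_const U
  -- By (F3) and (F4) the F-part of θJ − J'(u)u is at least (θ − θ_F)Λ G(u'); the forcing
  -- contributes at worst −(θ − 1)|f| sup|u|.
  have hAR : ∫ t, (μ * G (z.vel t) + (κ * ‖z.pos t‖ - C₃) - (θ - 1) * ‖f t‖ * U) ∂mu T ≤
      θ * actionS (lagrangian F V f) z - hL.dAction hT.le z z := by
    have i4 := Sob.integrable_pairing hT.le (hL.integrable_gradX_sob hT.le z)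
      (hL.memLG_gradV_sob hT.le z) z
    have i5 := (hL.integrable_sob hT.le z).const_mul θ
    rw [hL.dAction_apply, actionS, ← integral_const_mul, ← integral_sub i5 i4]
    refine integral_mono_ae ((i1.add i2).sub i3) (i5.sub i4) ?_
    filter_upwards [ae_mem_I] with t ht
    rw [gradX_lagrangian hF.contDiffOn hV.contDiffOn ht, gradV_lagrangian hF.contDiffOn ht,
      inner_add_left, inner_add_left]
    have b1 := hF.ar t ht (z.pos t) (z.vel t)
    have b2 := hF.ellipticity t ht (z.pos t) (z.vel t)
    have b3 := hpot t ht (z.pos t)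
    have b4 := (abs_le.1 ((abs_real_inner_le_norm (f t) (z.pos t)).trans
      (mul_le_mul_of_nonneg_left (hsup t ht) (norm_nonneg _)))).1
    have b5 := mul_le_mul_of_nonneg_left b2 (by linarith : 0 ≤ θ - θF)
    have b6 := mul_le_mul_of_nonneg_left b4 (by linarith : 0 ≤ θ - 1)
    simp only [lagrangian, gradX, gradV, hμ] at b1 b5 ⊢
    linarith
  have i12 : Integrable (fun t => μ * G (z.vel t) + (κ * ‖z.pos t‖ - C₃)) (mu T) := i1.add i2
  rw [integral_sub i12 i3, integral_add i1 i2, integral_sub (hip.const_mul κ)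
    (integrable_const C₃), integral_const_mul, integral_const_mul, integral_mul_const,
    integral_const_mul, integral_const, mu_real_univ hT.le, smul_eq_mul, ← hA] at hAR
  have hnorm : ‖z‖ ≤ U + (1 + Q) := by
    rw [Sob.norm_def]
    refine add_le_add ?_ (hG.young.luxNorm_le_one_add z.memLG_vel)
    have : 0 ≤ η * Q + 2 * T * C₄ := by positivity
    linarith
  have hdz : -(δ * (U + (1 + Q))) ≤ hL.dAction hT.le z z :=
    (abs_le.1 ((hL.dAction hT.le z).le_opNorm z |>.trans
      (mul_le_mul hdJ hnorm (norm_nonneg _) hδ0.le))).1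
  have hJc : θ * actionS (lagrangian F V f) z ≤ θ * |c| :=
    mul_le_mul_of_nonneg_left (hJ.trans (le_abs_self c)) hθ0
  have d1 : δ * U ≤ U := mul_le_of_le_one_left hU0 (min_le_left _ _)
  have d2 : δ * Q ≤ μ / 4 * Q := mul_le_mul_of_nonneg_right (min_le_right _ _) hQ0
  have d3 : δ ≤ 1 := min_le_left _ _
  have e1 : (A + 1) * U = (A + 1) * (2 * T)⁻¹ * P + μ / 4 * Q + 2 * (A + 1) * (2 * T * C₄) := by
    rw [hU, hη]
    field_simp
    ring
  have hfin : μ / 2 * Q + P ≤ D := by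
    rw [hκ] at hAR
    rw [hD]
    nlinarith
  have hQle : Q ≤ 2 * D / μ := by
    rw [le_div_iff₀ hμ0]; linarith
  have hPle : P ≤ D := by
    have : 0 ≤ μ / 2 * Q := by positivity
    linarith
  refine ⟨le_trans ?_ (le_max_right _ _), hQle.trans (le_max_left _ _)⟩
  have k1 := mul_le_mul_of_nonneg_left hPle (inv_pos.2 h2T).le
  have k2 := mul_le_mul_of_nonneg_left hQle hη0.le
  linarith

end

end AnisotropicEL

end
open Set Filter Topology MeasureTheory

noncomputable section

namespace AnisotropicEL

variable {N : ℕ} {T : ℝ} {G : E N → ℝ} {hG : IsGFunction G}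

/-! ### Paths, minimizers and the two solutions -/

/-- A path in the function space gives a path in the model space. -/
theorem exists_continuousMap_of_isPath (hT : 0 < T) (hG : IsGFunction G) {e : Sob T hG}
    {γ : ℝ → ℝ → E N} (hγ : IsPath T G e.pos γ) :
    ∃ σ : C(unitInterval, Sob T hG), σ 0 = 0 ∧ σ 1 = e ∧
      ∀ s : unitInterval, ∀ L : ℝ → E N → E N → ℝ, action T L (γ s) = actionS L (σ s) := by
  obtain ⟨h1, h2, h3, h4⟩ := hγ
  obtain ⟨K, hK, hle⟩ := exists_norm_toSob_le hT hG
  refine ⟨⟨fun s => toSob hT.le hG (h1 s s.2), ?_⟩, ?_, ?_, fun s L => ?_⟩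
  · rw [Metric.continuous_iff]
    intro s ε hε
    obtain ⟨δ, hδ, h⟩ := h2 s s.2 (ε / K) (by positivity)
    refine ⟨δ, hδ, fun r hr => ?_⟩
    have h5 := h r r.2 (by rwa [Subtype.dist_eq, Real.dist_eq] at hr)
    rw [lt_div_iff₀ hK] at h5
    have hm := (WT_sub hT.le hG (h1 r r.2) (h1 s s.2)).1
    rw [dist_eq_norm, ← toSob_sub hT.le hG (h1 r r.2) (h1 s s.2) hm]
    linarith [hle _ hm]
  · exact toSob_eq hT.le hG (h1 0 (by simp)) fun t ht => by rw [Sob.pos_zero ht]; exact h3 ht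
  · exact toSob_eq hT.le hG (h1 1 (by simp)) h4
  · exact action_eq_actionS hT.le hG L (h1 s s.2)

/-- A path in the model space gives a path in the function space. -/
theorem isPath_of_continuousMap (hT : 0 ≤ T) {e : Sob T hG} {σ : C(unitInterval, Sob T hG)}
    (h0 : σ 0 = 0) (h1 : σ 1 = e) :
    IsPath T G e.pos fun s => (σ (projIcc 0 1 zero_le_one s)).pos := by
  obtain ⟨K, hK, hle⟩ := exists_sobNorm_le hT hG
  have hc : Continuous fun s : ℝ => σ (projIcc 0 1 zero_le_one s) :=
    σ.continuous.comp continuous_projIcc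
  refine ⟨fun s _ => Sob.pos_mem_WT hT _, fun s _ ε hε => ?_, fun t ht => ?_, fun t ht => ?_⟩
  · obtain ⟨δ, hδ, h⟩ := Metric.continuous_iff.1 hc s (ε / K) (by positivity)
    refine ⟨δ, hδ, fun r _ hrs => ?_⟩
    have h5 := h r (by rwa [Real.dist_eq])
    rw [lt_div_iff₀ hK, dist_eq_norm] at h5
    have hr := Sob.pos_mem_WT hT (σ (projIcc 0 1 zero_le_one r))
    have hs := Sob.pos_mem_WT hT (σ (projIcc 0 1 zero_le_one s))
    have hm := (WT_sub hT hG hr hs).1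
    have h6 := hle _ hm
    rw [toSob_sub hT hG hr hs hm, toSob_pos, toSob_pos] at h6
    exact h6.trans_lt (by linarith)
  · simp only [projIcc_left, Pi.zero_apply]
    have : (⟨0, left_mem_Icc.2 zero_le_one⟩ : unitInterval) = 0 := rfl
    rw [this, h0, Sob.pos_zero ht]
  · simp only [projIcc_right]
    have : (⟨1, right_mem_Icc.2 zero_le_one⟩ : unitInterval) = 1 := rfl
    rw [this, h1]

theorem continuous_modular (hT : 0 < T) :
    Continuous (actionS (modularLagrangian G) : Sob T hG → ℝ) :=
  continuous_iff_continuousAt.2 fun z =>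
    ((lagr_modular hT hG).hasFDerivAt_actionS hT.le z).continuousAt

/-- A bound for the modular bounds the initial value and the modular of the velocity. -/
theorem exists_bound_of_modular_le (hT : 0 < T) (hG : IsGFunction G) (ρ : ℝ) :
    ∃ C : ℝ, ∀ z : Sob T hG, actionS (modularLagrangian G) z ≤ ρ →
      ‖z.base‖ ≤ C ∧ ∫ t, G (z.vel t) ∂mu T ≤ C := by
  obtain ⟨C, hC, hs⟩ := hG.young.superlinear 1 one_pos
  refine ⟨max ρ ((2 * T)⁻¹ * (ρ + 2 * T * C) + (ρ + 2 * T * C)), fun z hz => ?_⟩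
  rw [actionS_modular hT.le] at hz
  have p1 : 0 ≤ ∫ t, G (z.pos t) ∂mu T := integral_nonneg fun _ => hG.nonneg _
  have p2 : 0 ≤ ∫ t, G (z.vel t) ∂mu T := integral_nonneg fun _ => hG.nonneg _
  have h1 := hG.young.integral_norm_le hT.le hs (z.memLG_pos hT.le)
  have h2 := hG.young.integral_norm_le hT.le hs z.memLG_vel
  have h3 := z.norm_base_le_mean hT
  have h4 : (2 * T)⁻¹ * ∫ t, ‖z.pos t‖ ∂mu T ≤ (2 * T)⁻¹ * (ρ + 2 * T * C) :=
    mul_le_mul_of_nonneg_left (by linarith) (by positivity)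
  exact ⟨le_trans (by linarith) (le_max_right _ _), le_trans (by linarith) (le_max_left _ _)⟩

/-- A weakly lower semicontinuous action attains its minimum on `{Φ ≤ ρ}`. -/
theorem Lagr.exists_minimizer {L : ℝ → E N → E N → ℝ} (hL : Lagr T G L) (hT : 0 < T)
    (hG : IsGFunction G) {ρ B : ℝ} (hρ : 0 ≤ ρ)
    (hB : ∀ z : Sob T hG, actionS (modularLagrangian G) z ≤ ρ → B ≤ actionS L z) :
    ∃ z₀ : Sob T hG, actionS (modularLagrangian G) z₀ ≤ ρ ∧
      ∀ z : Sob T hG, actionS (modularLagrangian G) z ≤ ρ → actionS L z₀ ≤ actionS L z := by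
  set S : Set ℝ := actionS L '' {z : Sob T hG | actionS (modularLagrangian G) z ≤ ρ} with hS
  have hne : S.Nonempty := ⟨_, 0, by rw [mem_ofPred_eq, modular_zero hT.le]; exact hρ, rfl⟩
  have hbdd : BddBelow S := ⟨B, by rintro _ ⟨z, hz, rfl⟩; exact hB z hz⟩
  obtain ⟨v, -, hv, hvS⟩ := exists_seq_tendsto_sInf hne hbdd
  choose z hz hzv using hvS
  obtain ⟨C, hC⟩ := exists_bound_of_modular_le hT hG ρ
  obtain ⟨ns, hns, z₀, hw⟩ := Sob.exists_weakConv hT.le (fun n => (hC _ (hz n)).1)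
    (fun n => (hC _ (hz n)).2)
  refine ⟨z₀, ?_, fun y hy => ?_⟩
  -- Φ is itself the action of an admissible Lagrangian, so its weak lower semicontinuity keeps the
  -- limit in the sublevel set.
  · refine le_of_forall_pos_le_add fun ε hε => ?_
    obtain ⟨n, hn⟩ := ((lagr_modular hT hG).actionS_le_of_weakConv hT.le hw hε).exists
    have := hz (ns n)
    rw [mem_ofPred_eq] at this
    linarith
  · refine le_trans ?_ (csInf_le hbdd ⟨y, hy, rfl⟩)
    refine le_of_forall_pos_le_add fun ε hε => ?_
    have h1 := hL.actionS_le_of_weakConv hT.le hw (half_pos hε)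
    have h2 := (hv.comp hns.tendsto_atTop).eventually
      (gt_mem_nhds (lt_add_of_pos_right _ (half_pos hε)))
    obtain ⟨n, h3, h4⟩ := (h1.and h2).exists
    simp only [Function.comp] at h4
    rw [hzv] at h3
    linarith

/-- Existence of a critical point at the mountain pass level. -/
theorem Lagr.exists_mountainPass {L : ℝ → E N → E N → ℝ} (hL : Lagr T G L) (hT : 0 < T)
    (hG : IsGFunction G) {ρ α : ℝ} (hρ : 0 ≤ ρ) {e : Sob T hG}
    (hα : ∀ z : Sob T hG, actionS (modularLagrangian G) z = ρ → α ≤ actionS L z)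
    (h0 : actionS L (0 : Sob T hG) < α) (he : actionS L e < α)
    (heρ : ρ ≤ actionS (modularLagrangian G) e)
    (hPS : ∃ δ > 0, ∀ c : ℝ, ∃ C : ℝ, ∀ z : Sob T hG,
      actionS L z ≤ c → ‖hL.dAction hT.le z‖ ≤ δ →
      ‖z.base‖ ≤ C ∧ ∫ t, G (z.vel t) ∂mu T ≤ C) :
    ∃ z : Sob T hG, hL.dAction hT.le z = 0 ∧ α ≤ actionS L z ∧
      IsMountainPassLevel T G (action T L) e.pos (actionS L z) := by
  set S : Set ℝ := {m : ℝ | ∃ γ, IsPath T G e.pos γ ∧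
    IsGreatest ((fun s => action T L (γ s)) '' Icc (0 : ℝ) 1) m} with hS
  have hJc : Continuous (actionS L : Sob T hG → ℝ) :=
    continuous_iff_continuousAt.2 fun z => (hL.hasFDerivAt_actionS hT.le z).continuousAt
  have hmax : ∀ σ : C(unitInterval, Sob T hG), σ 0 = 0 → σ 1 = e →
      ∃ s, actionS L (σ s) ∈ S := by
    intro σ hσ0 hσ1
    obtain ⟨s, -, hs⟩ := (isCompact_univ (X := unitInterval)).exists_isMaxOn ⟨0, mem_univ _⟩
      (hJc.comp σ.continuous).continuousOn
    refine ⟨s, _, isPath_of_continuousMap hT.le hσ0 hσ1, ⟨s, s.2, ?_⟩, ?_⟩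
    · simp only [projIcc_val]
      exact action_pos hT.le L _
    · rintro _ ⟨r, hr, rfl⟩
      simp only
      rw [action_pos hT.le]
      exact hs (mem_univ _)
  -- Along any path Φ is continuous and passes from 0 to at least ρ, so the path meets the rim,
  -- where J ≥ α.
  have hlow : ∀ m ∈ S, α ≤ m := by
    rintro m ⟨γ, hγ, hm⟩
    obtain ⟨σ, hσ0, hσ1, hσ⟩ := exists_continuousMap_of_isPath hT hG hγ
    obtain ⟨s, hs⟩ : ∃ s, actionS (modularLagrangian G) (σ s) = ρ :=
      mem_range_of_exists_le_of_exists_ge ((continuous_modular hT).comp σ.continuous)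
        ⟨0, by rw [hσ0, modular_zero hT.le]; exact hρ⟩
        ⟨1, by rw [hσ1]; exact heρ⟩
    have h1 := hm.2 ⟨s, s.2, rfl⟩
    simp only [hσ s L] at h1
    exact (hα _ hs).trans h1
  have hbdd : BddBelow S := ⟨α, hlow⟩
  have hne : S.Nonempty := by
    obtain ⟨s, hs⟩ := hmax ⟨fun s => (s : ℝ) • e, by fun_prop⟩ (by simp) (by simp)
    exact ⟨_, hs⟩
  have hcα : α ≤ sInf S := le_csInf hne hlow
  have hps : ∀ ε > 0, ∃ z : Sob T hG, |actionS L z - sInf S| ≤ ε ∧ ‖hL.dAction hT.le z‖ ≤ ε := by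
    intro ε hε
    refine mountain_pass (fun z => hL.hasFDerivAt_actionS hT.le z) (hL.continuous_dAction hT.le)
      (e := e) (fun σ hσ0 hσ1 => ?_) (fun δ hδ => ?_) (by linarith) (by linarith) hε
    · obtain ⟨s, hs⟩ := hmax σ hσ0 hσ1
      exact ⟨s, csInf_le hbdd hs⟩
    · obtain ⟨m, ⟨γ, hγ, hm⟩, hlt⟩ := exists_lt_of_csInf_lt hne (lt_add_of_pos_right (sInf S) hδ)
      obtain ⟨σ, hσ0, hσ1, hσ⟩ := exists_continuousMap_of_isPath hT hG hγ
      refine ⟨σ, hσ0, hσ1, fun s => ?_⟩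
      rw [← hσ]
      exact (hm.2 ⟨s, s.2, rfl⟩).trans_lt hlt
  obtain ⟨δ, hδ, hbd⟩ := hPS
  obtain ⟨C, hC⟩ := hbd (sInf S + δ)
  -- The cap δ makes the boundedness hypothesis apply to every term; 1/(n+1) makes the sequence
  -- Palais–Smale.
  have hpos : ∀ n : ℕ, 0 < min δ (1 / ((n : ℝ) + 1)) := fun n => lt_min hδ (by positivity)
  choose z hz1 hz2 using fun n : ℕ => hps _ (hpos n)
  have hzb : ∀ n, ‖(z n).base‖ ≤ C ∧ ∫ t, G ((z n).vel t) ∂mu T ≤ C := fun n =>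
    hC _ (by linarith [(abs_le.1 (hz1 n)).2, min_le_left δ (1 / ((n : ℝ) + 1))])
      ((hz2 n).trans (min_le_left _ _))
  obtain ⟨ns, hns, z₀, hw⟩ := Sob.exists_weakConv hT.le (fun n => (hzb n).1) (fun n => (hzb n).2)
  have hlim : Tendsto (fun n : ℕ => 1 / ((n : ℝ) + 1)) atTop (𝓝 0) :=
    tendsto_one_div_add_atTop_nhds_zero_nat
  have hd : Tendsto (fun n => ‖hL.dAction hT.le (z n)‖) atTop (𝓝 0) :=
    squeeze_zero (fun _ => norm_nonneg _) (fun n => (hz2 n).trans (min_le_right _ _)) hlim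
  have hJ : Tendsto (fun n => actionS L (z n)) atTop (𝓝 (sInf S)) := by
    rw [tendsto_iff_dist_tendsto_zero]
    refine squeeze_zero (fun _ => dist_nonneg) (fun n => ?_) hlim
    rw [Real.dist_eq]
    exact (hz1 n).trans (min_le_right _ _)
  obtain ⟨h1, h2⟩ := hL.palaisSmale_limit hT.le hw (hd.comp hns.tendsto_atTop)
  have hlev : actionS L z₀ = sInf S := tendsto_nhds_unique h1 (hJ.comp hns.tendsto_atTop)
  refine ⟨z₀, h2, by rw [hlev]; exact hcα, ?_⟩
  rw [hlev]
  exact isGLB_csInf hne hbdd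

/-- If the zero curve is a solution and `V_x(t, 0) = 0`, then the forcing vanishes. -/
theorem forcing_eq_zero (hT : 0 < T) {F : ℝ → E N → E N → ℝ} {Λ θF : ℝ}
    (hF : AssumptionF T G F Λ θF) {V : ℝ → E N → ℝ} {ρ b : ℝ} {g : ℝ → ℝ}
    (hV : AssumptionV T G V θF ρ b g) {f u : ℝ → E N}
    (hVx : ∀ᵐ t ∂mu T, gradient (V t) 0 = 0)
    (h : IsPeriodicSolution T G (lagrangian F V f) u) (hu : EqOn u 0 (I T)) :
    ∀ᵐ t ∂mu T, f t = 0 := by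
  obtain ⟨-, p, hp, h1, h2⟩ := h
  have hIoo : ∀ᵐ t ∂mu T, t ∈ Ioo (-T) T := by
    rw [mu, I, ← restrict_Ioo_eq_restrict_Icc]
    exact ae_restrict_mem measurableSet_Ioo
  have hd : ∀ t ∈ Ioo (-T) T, deriv u t = 0 := fun t ht => by
    have : u =ᶠ[𝓝 t] fun _ => 0 := by
      filter_upwards [Ioo_mem_nhds ht.1 ht.2] with s hs using hu (Ioo_subset_Icc_self hs)
    rw [this.deriv_eq, deriv_const]
  -- On the zero curve the momentum is F_v(t, 0, 0) = 0. Its continuous representative then vanishes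
  -- on I, so p' = 0, and F_x(t, 0, 0) = 0 together with V_x(t, 0) = 0 leaves only f.
  have hp0 : p =ᵐ[mu T] fun _ => 0 := by
    filter_upwards [h1, ae_mem_I, hIoo] with t h3 ht ht'
    have h4 := gradV_lagrangian (V := V) (f := f) hF.contDiffOn ht 0 0
    simp only [gradV] at h4
    rw [h3, hd t ht', hu ht, Pi.zero_apply, h4]
    exact (hF.zero t ht 0).2
  have hc : ContinuousOn p (I T) := by
    have := hp.continuousOn
    rwa [uIcc_of_le (by linarith)] at this
  have heq : EqOn p (fun _ => 0) (I T) :=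
    Measure.eqOn_Icc_of_ae_eq volume (by linarith) hp0 hc continuousOn_const
  filter_upwards [h2, hVx, hIoo, ae_mem_I] with t a1 a2 a3 ht
  have a4 : HasDerivAt p 0 t := by
    refine (hasDerivAt_const t (0 : E N)).congr_of_eventuallyEq ?_
    filter_upwards [Ioo_mem_nhds a3.1 a3.2] with s hs using heq (Ioo_subset_Icc_self hs)
  have a5 := a1.unique a4
  rw [hd t a3, hu ht, Pi.zero_apply] at a5
  have a6 := gradX_lagrangian (f := f) hF.contDiffOn hV.contDiffOn ht 0 0
  simp only [gradX] at a6
  have a7 : (fun y => F t y 0) = fun _ => 0 := funext fun y => (hF.zero t ht y).1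
  rw [a5, a2, a7] at a6
  simpa [gradient] using a6.symm

end AnisotropicEL

end

/-! ### The main theorem. -/

open AnisotropicEL in
theorem theorem4p2 {N : ℕ} (T : ℝ) (hT : 1 ≤ 2 * T)
    (G : E N → ℝ) (hG : IsGFunction G)
    (F : ℝ → E N → E N → ℝ) (Λ θF : ℝ) (hF : AssumptionF T G F Λ θF)
    (V : ℝ → E N → ℝ) (ρ b : ℝ) (g : ℝ → ℝ) (hV : AssumptionV T G V θF ρ b g)
    (f : ℝ → E N) (hf_mem : MemLG T (conj G) f)
    (hf : ∫ t in I T, (conj G (f t) + g t) < min Λ (b - 1) * ρ)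
    (hf_ne : ¬ ∀ᵐ t ∂(volume.restrict (I T)), f t = 0) :
    ∃ u₁ u₂ : ℝ → E N,
      -- two different periodic solutions
      IsPeriodicSolution T G (lagrangian F V f) u₁ ∧
      IsPeriodicSolution T G (lagrangian F V f) u₂ ∧
      ¬ EqOn u₁ u₂ (I T) ∧
      -- the first one is nontrivial and of mountain pass type
      ¬ EqOn u₁ 0 (I T) ∧
      IsCriticalPoint T G (action T (lagrangian F V f)) u₁ ∧
      0 < action T (lagrangian F V f) u₁ ∧
      (∃ e ∈ WT T G, ρ < Phi T G e ∧ action T (lagrangian F V f) e < 0 ∧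
        IsMountainPassLevel T G (action T (lagrangian F V f)) e
          (action T (lagrangian F V f) u₁)) ∧
      -- the second one lies in `Ω` and minimizes the action on the closure of `Ω`
      IsCriticalPoint T G (action T (lagrangian F V f)) u₂ ∧
      action T (lagrangian F V f) u₂ ≤ 0 ∧
      u₂ ∈ Omega T G ρ ∧
      (∀ w ∈ normClosure T G (Omega T G ρ),
        action T (lagrangian F V f) u₂ ≤ action T (lagrangian F V f) w) ∧
      -- it is nontrivial as soon as `V_x(t, 0) = 0`
      ((∀ᵐ t ∂(volume.restrict (I T)), gradient (V t) 0 = 0) → ¬ EqOn u₂ 0 (I T)) := by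
  have hT0 : 0 < T := by linarith
  have hL := lagr_of_assumptions hF hV hf_mem hT0 hG
  have hρ := hV.rho_pos
  have hJ0 : actionS (lagrangian F V f) (0 : Sob T hG) = 0 := actionS_zero hF hV hT0.le
  set β := ∫ t in I T, (conj G (f t) + g t) with hβ
  have hαpos : 0 < min Λ (b - 1) * ρ - β := by linarith
  have hα : ∀ z : Sob T hG, actionS (modularLagrangian G) z = ρ →
      min Λ (b - 1) * ρ - β ≤ actionS (lagrangian F V f) z := by
    intro z hz
    have := le_actionS hF hV hf_mem hT z hz.le
    rwa [hz] at this
  -- In dimension zero f would vanish; a nonzero vector is needed for the far endpoint e.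
  have hnt : Nontrivial (E N) := by
    by_contra h
    rw [not_nontrivial_iff_subsingleton] at h
    exact hf_ne (Eventually.of_forall fun t => Subsingleton.elim _ _)
  obtain ⟨e, heρ, he⟩ := exists_neg_endpoint hF hV hT0 hG hf_mem
  obtain ⟨z₁, hz₁, hz₁α, hz₁lev⟩ := hL.exists_mountainPass hT0 hG hρ.le hα (by rw [hJ0]; exact hαpos)
    (he.trans hαpos) heρ.le (palaisSmale_bounded hF hV hf_mem hT0 hG hL)
  have hmin0 : 0 ≤ min Λ (b - 1) := le_min hF.lambda_pos.le (by linarith [hV.one_lt_b])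
  obtain ⟨z₂, hz₂ρ, hz₂⟩ := hL.exists_minimizer hT0 hG hρ.le (B := -β) fun z hz => by
    have h1 := le_actionS hF hV hf_mem hT z hz
    have h2 : 0 ≤ actionS (modularLagrangian G) z := by
      rw [actionS_modular hT0.le]
      exact add_nonneg (integral_nonneg fun _ => hG.nonneg _) (integral_nonneg fun _ => hG.nonneg _)
    linarith [mul_nonneg hmin0 h2]
  have hz₂0 : actionS (lagrangian F V f) z₂ ≤ 0 := by
    rw [← hJ0]
    exact hz₂ 0 (by rw [modular_zero hT0.le]; exact hρ.le)
  -- On the rim the action is positive, whereas the minimum is at most J(0) = 0. The minimizer is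
  -- therefore interior and Fermat's rule applies.
  have hz₂lt : actionS (modularLagrangian G) z₂ < ρ :=
    lt_of_le_of_ne hz₂ρ fun h => by linarith [hα z₂ h]
  have hz₂crit : hL.dAction hT0.le z₂ = 0 := by
    refine IsLocalMin.hasFDerivAt_eq_zero ?_ (hL.hasFDerivAt_actionS hT0.le z₂)
    filter_upwards [(continuous_modular hT0).continuousAt.eventually (gt_mem_nhds hz₂lt)] with y hy
    exact hz₂ y hy.le
  have hJ1 : 0 < action T (lagrangian F V f) z₁.pos := by
    rw [action_pos hT0.le]; linarith
  have hJ2 : action T (lagrangian F V f) z₂.pos ≤ 0 := by rwa [action_pos hT0.le]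
  -- The sign of the action separates the mountain pass point both from the minimizer and from 0.
  have hne : ∀ {z : Sob T hG}, EqOn z₁.pos z.pos (I T) →
      actionS (lagrangian F V f) z ≤ 0 → False := by
    intro z h1 h2
    have h3 := toSob_eq hT0.le hG (Sob.pos_mem_WT hT0.le z₁) h1
    rw [toSob_pos] at h3
    rw [h3, action_pos hT0.le] at hJ1
    linarith
  refine ⟨z₁.pos, z₂.pos, hL.isPeriodicSolution hT0 hz₁, hL.isPeriodicSolution hT0 hz₂crit,
    fun h => hne h hz₂0, fun h => hne (z := 0) (fun t ht => ?_) hJ0.le,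
    hL.isCriticalPoint hT0 hz₁, hJ1, ⟨e.pos, Sob.pos_mem_WT hT0.le e, ?_, ?_, ?_⟩,
    hL.isCriticalPoint hT0 hz₂crit, hJ2, ⟨Sob.pos_mem_WT hT0.le z₂, ?_⟩, fun w hw => ?_,
    fun hVx h => hf_ne ?_⟩
  · rw [Sob.pos_zero ht]; exact h ht
  · rwa [Phi_pos hT0.le]
  · rwa [action_pos hT0.le]
  · rwa [action_pos hT0.le]
  · rwa [Phi_pos hT0.le]
  · obtain ⟨hwT, hcl⟩ := hw
    rw [action_pos hT0.le, action_eq_actionS hT0.le hG _ hwT]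
    refine hz₂ _ ?_
    obtain ⟨K, hK, hle⟩ := exists_norm_toSob_le hT0 hG
    -- Only the inclusion of the closure of Ω in {Φ ≤ ρ} is needed, since the minimum was taken over
    -- the larger set.
    have hmem : toSob hT0.le hG hwT ∈
        closure {z : Sob T hG | actionS (modularLagrangian G) z ≤ ρ} := by
      rw [Metric.mem_closure_iff]
      intro ε hε
      obtain ⟨v, ⟨hvT, hv⟩, hlt⟩ := hcl (ε / K) (by positivity)
      refine ⟨toSob hT0.le hG hvT, ?_, ?_⟩
      · rw [Set.mem_ofPred_eq, ← Phi_eq_actionS hT0.le hG hvT]; exact hv.le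
      · have hm := (WT_sub hT0.le hG hwT hvT).1
        rw [dist_eq_norm, ← toSob_sub hT0.le hG hwT hvT hm]
        rw [lt_div_iff₀ hK] at hlt
        linarith [hle _ hm]
    exact (isClosed_le (continuous_modular hT0) continuous_const).closure_subset hmem
  · exact forcing_eq_zero hT0 hF hV hVx (hL.isPeriodicSolution hT0 hz₂crit) h
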